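/- Let $n\ge 1$ and $0<\alpha\le 2$. There is a constant $C=C_{n,\alpha}$ such that the following holds. Let $(X_t)_{t\ge 0}$ be a rotationally invariant $\alpha$-stable process on $\mathbb{R}^n$, that is, a Lévy process ($X_0=0$ a.s., independent and stationary increments, stochastically continuous) with $\mathbb{E}\,e^{i\xi\cdot X_t}=e^{-t|\xi|^\alpha}$, let $\varphi$ be the (continuous) density of $X_1$, and for $y>0$ let $\varphi_y(x)=y^{-n}\varphi(x/y)$. Let $A(x,y)=(a^{i,j}(x,y))$ be a measurable $(n+1)\times(n+1)$ matrix-valued function (with complex entries) on $\mathbb{R}^n\times(0,\infty)$ with $$\|A\|=\Big\|\sup_{|v|\le 1}|A(x,y)v|\Big\|_{L^\infty(\mathbb{R}^n\times(0,\infty))}<\infty,$$ such that $a^{i,j}(x,y)$ does not depend on $x$ whenever $i=n+1$ or $j=n+1$. With $\nabla=(\partial_{x_1},\dots,\partial_{x_n},\partial_y)$ put $$K_{A,y}(x,\tilde x)=\int_{\mathbb{R}^n}2y\,A(\bar x,y)\nabla\varphi_y(\bar x-\tilde x)\cdot\nabla\varphi_y(\bar x-x)\,d\bar x,\qquad K_A(x,\tilde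 x)=\int_0^\infty K_{A,y}(x,\tilde x)\,dy ,$$ and, for Schwartz functions $f$ on $\mathbb{R}^n$, let $$T_Af(x)=\int_0^\infty\Big(\int_{\mathbb{R}^n}K_{A,y}(x,\tilde x)f(\tilde x)\,d\tilde x\Big)dy .$$ Then the double integral defining $K_A(x,\tilde x)$ converges absolutely for all $x\neq\tilde x$, each of the successive integrals defining $T_Af(x)$ converges absolutely (the inner ones for almost every $y$), and $T_A$ is a Calderón–Zygmund operator with kernel $K_A$ and constant $\kappa=C\|A\|$, that is: 1. $T_A$ is linear and extends to a bounded operator on $L^2(\mathbb{R}^n)$ of norm at most $\kappa$. 2. For all $x\ne\tilde x$, $K_A$ is differentiable in each of its two variables at $(x,\tilde x)$, and $$|K_A(x,\tilde x)|\le\frac{\kappa}{|x-\tilde x|^{n}},\qquad |\nabla_xK_A(x,\tilde x)|\le\frac{\kappa}{|x-\tilde x|^{n+1}},\qquad |\nabla_{\tilde x}K_A(x,\tilde x)|\le\frac{\kappa}{|x-\tilde x|^{n+1}} .$$ 3. For every Schwartz function $f$, $T_Af(x)=\int_{\mathbb{R}^n}K_A(x,\tilde x)f(\tilde x)\,d\tilde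 x$, as an absolutely convergent integral if $x\notin\operatorname{supp}f$, and for every $x$ in the principal value sense up to a bounded multiplier: there are functions $b_\varepsilon:\mathbb{R}^n\to\mathbb{C}$ ($\varepsilon>0$), independent of $f$, with $|b_\varepsilon|\le\kappa$ and $$T_Af(x)=\lim_{\varepsilon\downarrow 0}\Big(\int_{|x-\tilde x|>\varepsilon}K_A(x,\tilde x)f(\tilde x)\,d\tilde x+b_\varepsilon(x)f(x)\Big),$$ where the truncated integrals converge absolutely. -/

import Mathlib

open MeasureTheory ProbabilityTheory Filter Topology Set
open scoped ENNReal NNReal Matrix SchwartzMap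

noncomputable section

namespace StableCZ

/-- A Lévy process on `ℝⁿ`: it starts at `0`, has independent and stationary increments and is
stochastically continuous (at time `0`, hence at every time). -/
structure IsLevyProcess {n : ℕ} {Ω : Type*} [MeasurableSpace Ω]
    (X : ℝ≥0 → Ω → EuclideanSpace ℝ (Fin n)) (P : Measure Ω) : Prop where
  aemeasurable : ∀ t, AEMeasurable (X t) P
  start : ∀ᵐ ω ∂P, X 0 ω = 0
  indep : HasIndepIncrements X P
  stationary : ∀ s t, IdentDistrib (fun ω => X (s + t) ω - X s ω) (fun ω => X t ω - X 0 ω) P P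
  stochCont : ∀ ε : ℝ, 0 < ε → Tendsto (fun t : ℝ≥0 => P {ω | ε < ‖X t ω‖}) (𝓝[>] 0) (𝓝 0)

/-- The rotationally invariant `α`-stable process on `ℝⁿ`: the Lévy process with
`𝔼 exp (i ξ · X_t) = exp (-t |ξ|^α)`. -/
structure IsRotInvStable {n : ℕ} {Ω : Type*} [MeasurableSpace Ω] (α : ℝ)
    (X : ℝ≥0 → Ω → EuclideanSpace ℝ (Fin n)) (P : Measure Ω) : Prop extends
    IsLevyProcess X P where
  charFun_eq : ∀ (t : ℝ≥0) (ξ : EuclideanSpace ℝ (Fin n)),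
    charFun (P.map (X t)) ξ = Complex.exp (-((t : ℝ) * ‖ξ‖ ^ α : ℝ))

/-- `φ` is the continuous version of the density of the random vector `Y`; continuity fixes the
values of `φ` at every point. -/
structure IsContDensity {n : ℕ} {Ω : Type*} [MeasurableSpace Ω]
    (φ : EuclideanSpace ℝ (Fin n) → ℝ) (Y : Ω → EuclideanSpace ℝ (Fin n)) (P : Measure Ω) :
    Prop where
  continuous : Continuous φ
  nonneg : ∀ x, 0 ≤ φ x
  map_eq : P.map Y = volume.withDensity (fun x => ENNReal.ofReal (φ x))

/-- `φ_y(x) = y⁻ⁿ φ(x / y)`. -/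
def dil {n : ℕ} (φ : EuclideanSpace ℝ (Fin n) → ℝ) (y : ℝ) (x : EuclideanSpace ℝ (Fin n)) : ℝ :=
  (y ^ n)⁻¹ * φ (y⁻¹ • x)

/-- The full gradient `(∂_{x_1}, …, ∂_{x_n}, ∂_y)` of `(x, y) ↦ φ_y(x)`, with (complexified)
entries; the last entry is the derivative in `y`. -/
def fullGrad {n : ℕ} (φ : EuclideanSpace ℝ (Fin n) → ℝ) (y : ℝ) (x : EuclideanSpace ℝ (Fin n)) :
    Fin (n + 1) → ℂ :=
  Fin.snoc (α := fun _ => ℂ)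
    (fun i : Fin n => ((fderiv ℝ (dil φ y) x (EuclideanSpace.single i 1) : ℝ) : ℂ))
    ((deriv (fun s : ℝ => dil φ s x) y : ℝ) : ℂ)

/-- Lebesgue measure on the half-space `ℝⁿ × (0, ∞)`. -/
def halfMeasure (n : ℕ) : Measure (EuclideanSpace ℝ (Fin n) × ℝ) :=
  (volume : Measure (EuclideanSpace ℝ (Fin n))).prod (volume.restrict (Ioi (0 : ℝ)))

/-- `‖A‖ = ‖ sup_{|v| ≤ 1} |A(x,y) v| ‖_{L^∞}`: the essential supremum over the half-space of the
Euclidean operator norm of `A(x, y)`. -/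
def coeffNorm {n : ℕ}
    (A : EuclideanSpace ℝ (Fin n) → ℝ → Matrix (Fin (n + 1)) (Fin (n + 1)) ℂ) : ℝ≥0∞ :=
  eLpNorm (fun p : EuclideanSpace ℝ (Fin n) × ℝ =>
    Matrix.toEuclideanCLM (n := Fin (n + 1)) (𝕜 := ℂ) (A p.1 p.2)) ∞ (halfMeasure n)

/-- `2 y A(x̄, y) ∇φ_y(x̄ - x') · ∇φ_y(x̄ - x)`; here `x'` is the second variable of the kernel and
the dot product is bilinear. -/
def kernelIntegrand {n : ℕ} (φ : EuclideanSpace ℝ (Fin n) → ℝ)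
    (A : EuclideanSpace ℝ (Fin n) → ℝ → Matrix (Fin (n + 1)) (Fin (n + 1)) ℂ)
    (x x' xbar : EuclideanSpace ℝ (Fin n)) (y : ℝ) : ℂ :=
  2 * (y : ℂ) * ((A xbar y *ᵥ fullGrad φ y (xbar - x')) ⬝ᵥ fullGrad φ y (xbar - x))

/-- The inner integral over `x̄`, at a fixed height `y`. -/
def sliceKernel {n : ℕ} (φ : EuclideanSpace ℝ (Fin n) → ℝ)
    (A : EuclideanSpace ℝ (Fin n) → ℝ → Matrix (Fin (n + 1)) (Fin (n + 1)) ℂ)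
    (y : ℝ) (x x' : EuclideanSpace ℝ (Fin n)) : ℂ :=
  ∫ xbar, kernelIntegrand φ A x x' xbar y

/-- The kernel `K_A(x, x') = ∫₀^∞ ∫ 2 y A(x̄, y) ∇φ_y(x̄ - x') · ∇φ_y(x̄ - x) dx̄ dy`. -/
def kernelK {n : ℕ} (φ : EuclideanSpace ℝ (Fin n) → ℝ)
    (A : EuclideanSpace ℝ (Fin n) → ℝ → Matrix (Fin (n + 1)) (Fin (n + 1)) ℂ)
    (x x' : EuclideanSpace ℝ (Fin n)) : ℂ :=
  ∫ y in Ioi (0 : ℝ), sliceKernel φ A y x x'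

/-- The operator `T_A` with kernel `K_A`, on Schwartz functions. The kernel is singular on the
diagonal; the integral against `f` is regularised by integrating in `y` last, that is
`T_A f (x) = lim_{δ → 0} ∫ (∫_δ^∞ K_{A,y}(x, x') dy) f(x') dx'`, where `K_{A,y}` is the slice of
the kernel at height `y`. -/
def opT {n : ℕ} (φ : EuclideanSpace ℝ (Fin n) → ℝ)
    (A : EuclideanSpace ℝ (Fin n) → ℝ → Matrix (Fin (n + 1)) (Fin (n + 1)) ℂ)
    (f : 𝓢(EuclideanSpace ℝ (Fin n), ℂ)) (x : EuclideanSpace ℝ (Fin n)) : ℂ :=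
  ∫ y in Ioi (0 : ℝ), ∫ x', sliceKernel φ A y x x' * f x'

/-- `K` satisfies, off the diagonal, the size estimate and the two gradient estimates of a
Calderón–Zygmund kernel with constant `κ`; differentiability is part of the gradient estimates. -/
structure IsCZKernel {n : ℕ}
    (K : EuclideanSpace ℝ (Fin n) → EuclideanSpace ℝ (Fin n) → ℂ) (κ : ℝ) : Prop where
  size : ∀ x x', x ≠ x' → ‖K x x'‖ ≤ κ / ‖x - x'‖ ^ n
  differentiable_fst : ∀ x x', x ≠ x' → DifferentiableAt ℝ (fun z => K z x') x
  differentiable_snd : ∀ x x', x ≠ x' → DifferentiableAt ℝ (fun z => K x z) x'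
  grad_fst : ∀ x x', x ≠ x' → ‖fderiv ℝ (fun z => K z x') x‖ ≤ κ / ‖x - x'‖ ^ (n + 1)
  grad_snd : ∀ x x', x ≠ x' → ‖fderiv ℝ (fun z => K x z) x'‖ ≤ κ / ‖x - x'‖ ^ (n + 1)

/-- `T`, acting on Schwartz functions, is a Calderón–Zygmund operator with kernel `K` and
constant `κ`: it is linear, it has a bounded extension to `L²`, `K` is a Calderón–Zygmund kernel,
and `T f (x) = ∫ K(x, x') f(x') dx'`. The last identity holds as an absolutely convergent integral
if `x` is outside the support of `f`, and for every `x` in the principal value sense. As a kernel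
off the diagonal determines such an operator only up to multiplication by a bounded function (the
identity has kernel `0`, for instance), and as the truncated integrals of a kernel which is not odd
may oscillate boundedly, the principal value is corrected by bounded multiples `b ε x` of `f x`
that do not depend on `f`. -/
structure IsCZOperator {n : ℕ}
    (T : 𝓢(EuclideanSpace ℝ (Fin n), ℂ) → EuclideanSpace ℝ (Fin n) → ℂ)
    (K : EuclideanSpace ℝ (Fin n) → EuclideanSpace ℝ (Fin n) → ℂ) (κ : ℝ) : Prop where
  map_add : ∀ f g x, T (f + g) x = T f x + T g x
  map_smul : ∀ (c : ℂ) f x, T (c • f) x = c * T f x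
  l2_bounded : ∃ S : Lp ℂ 2 (volume : Measure (EuclideanSpace ℝ (Fin n))) →L[ℂ]
      Lp ℂ 2 (volume : Measure (EuclideanSpace ℝ (Fin n))),
    ‖S‖ ≤ κ ∧ ∀ f : 𝓢(EuclideanSpace ℝ (Fin n), ℂ), S (f.toLp 2) =ᵐ[volume] T f
  kernel : IsCZKernel K κ
  off_support : ∀ (f : 𝓢(EuclideanSpace ℝ (Fin n), ℂ)) (x), x ∉ tsupport f →
    Integrable (fun x' => K x x' * f x') ∧ T f x = ∫ x', K x x' * f x'
  truncated_integrable : ∀ (f : 𝓢(EuclideanSpace ℝ (Fin n), ℂ)) (x) (ε : ℝ), 0 < ε →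
    IntegrableOn (fun x' => K x x' * f x') {x' | ε < ‖x - x'‖}
  principal_value : ∃ b : ℝ → EuclideanSpace ℝ (Fin n) → ℂ,
    (∀ ε, 0 < ε → ∀ x, ‖b ε x‖ ≤ κ) ∧
    ∀ (f : 𝓢(EuclideanSpace ℝ (Fin n), ℂ)) (x),
      Tendsto (fun ε : ℝ => (∫ x' in {x' | ε < ‖x - x'‖}, K x x' * f x') + b ε x * f x)
        (𝓝[>] 0) (𝓝 (T f x))

end StableCZ

end

/-! Let `r = |x - x'|`. Up to the factor `‖A‖`, the slice of `K_A` at height `y` is bounded by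
`y⁻ⁿ⁻¹ (1 + r/y)⁻ⁿ⁻ᵅ`, its gradients are smaller by a further factor `(y + r)⁻¹`, and its integral
in `x'` vanishes, because that of `∇φ_y` does. Integrating these bounds in `y` gives the
estimates on `K_A`; the cancellation bounds the integral `b_ε(x)` of the slices over all heights
and over the ball `|x - x'| ≤ ε`, and this is the multiplier of the principal value formula. For
the `L²` bound, `⟨T_A f, g⟩` is controlled through Cauchy–Schwarz by the vertical square functions
of `f` and `g`, which Plancherel's theorem bounds by `‖f‖₂` and `‖g‖₂`.

The components of `∇φ_y` are dilates `y⁻ⁿ⁻¹ Φ_i(x/y)` of profiles with Fourier transforms of the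
form `c ∏ ⟨v_i, ξ⟩ |ξ|^{kα} exp(-b|ξ|^α)`. The decay of the profiles is read off high-order finite
differences of these multipliers, which Cauchy's estimates bound because the multipliers extend
holomorphically along lines. The `x`-profiles decay to the order `n + 1 + α`, which suffices for
the gradient bounds of their slices. The `y`-profile decays only to the order `n + α`; but its
coefficients do not depend on `x`, so its slices are dilates of correlations of two profiles, and
these are inverse Fourier transforms of multipliers of the same family, whose gradients again
decay to the order `n + 1 + α`. -/

noncomputable section

namespace StableCZ

/-- `ℝⁿ` with the Euclidean norm. -/
abbrev Eu (n : ℕ) := EuclideanSpace ℝ (Fin n)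

section Weights

/-- The weight on heights `y > 0` that grows like `y ^ (p - 1)` up to the scale `r` and decays like
`y ^ (-q - 1)` beyond it, normalised so that its mass `1 / p + 1 / q` does not depend on `r`. -/
def scaleWeight (r p q y : ℝ) : ℝ :=
  if y ≤ r then r ^ (-p) * y ^ (p - 1) else r ^ q * y ^ (-q - 1)

/-- The size at height `y` and distance `r` of a kernel slice that is homogeneous of degree `-m`,
with `δ` orders of decay to spare. -/
def sliceWeight (m δ r y : ℝ) : ℝ := y ^ (-m - 1) * (1 + r / y) ^ (-(m + δ))

variable {m δ r p q y : ℝ}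

lemma scaleWeight_of_le (h : y ≤ r) : scaleWeight r p q y = r ^ (-p) * y ^ (p - 1) := if_pos h

lemma scaleWeight_of_lt (h : r < y) : scaleWeight r p q y = r ^ q * y ^ (-q - 1) :=
  if_neg h.not_ge

lemma scaleWeight_nonneg (hr : 0 < r) (hy : 0 < y) : 0 ≤ scaleWeight r p q y := by
  unfold scaleWeight
  split_ifs <;> positivity

lemma le_max_mul_scaleWeight {u a b : ℝ} (hr : 0 < r) (hy : 0 < y)
    (hle : y ≤ r → u ≤ a * y ^ (p - 1)) (hlt : r < y → u ≤ b * y ^ (-q - 1)) :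
    u ≤ max (a * r ^ p) (b * r ^ (-q)) * scaleWeight r p q y := by
  have hw := scaleWeight_nonneg (p := p) (q := q) hr hy
  rcases le_or_gt y r with h | h
  · refine le_trans ?_ (mul_le_mul_of_nonneg_right (le_max_left _ _) hw)
    rw [scaleWeight_of_le h, mul_assoc, ← mul_assoc (r ^ p), ← Real.rpow_add hr, add_neg_cancel,
      Real.rpow_zero, one_mul]
    exact hle h
  · refine le_trans ?_ (mul_le_mul_of_nonneg_right (le_max_right _ _) hw)
    rw [scaleWeight_of_lt h, mul_assoc, ← mul_assoc (r ^ (-q)), ← Real.rpow_add hr, neg_add_cancel,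
      Real.rpow_zero, one_mul]
    exact hlt h

lemma integrableOn_Ioc_scaleWeight (hp : 0 < p) (hr : 0 < r) :
    IntegrableOn (scaleWeight r p q) (Ioc 0 r) := by
  have h := (intervalIntegral.intervalIntegrable_rpow' (a := 0) (b := r) (r := p - 1)
    (by linarith)).const_mul (r ^ (-p))
  rw [intervalIntegrable_iff_integrableOn_Ioc_of_le hr.le] at h
  exact h.congr_fun (fun y hy => (scaleWeight_of_le hy.2).symm) measurableSet_Ioc

lemma integrableOn_Ioi_self_scaleWeight (hq : 0 < q) (hr : 0 < r) :
    IntegrableOn (scaleWeight r p q) (Ioi r) := by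
  have h : IntegrableOn (fun y => r ^ q * y ^ (-q - 1)) (Ioi r) :=
    (integrableOn_Ioi_rpow_of_lt (by linarith) hr).const_mul _
  exact h.congr_fun (fun _ hy => (scaleWeight_of_lt hy).symm) measurableSet_Ioi

lemma integrableOn_scaleWeight (hp : 0 < p) (hq : 0 < q) (hr : 0 < r) :
    IntegrableOn (scaleWeight r p q) (Ioi 0) := by
  rw [← Ioc_union_Ioi_eq_Ioi hr.le]
  exact (integrableOn_Ioc_scaleWeight hp hr).union (integrableOn_Ioi_self_scaleWeight hq hr)

lemma integral_scaleWeight (hp : 0 < p) (hq : 0 < q) (hr : 0 < r) :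
    ∫ y in Ioi 0, scaleWeight r p q y = 1 / p + 1 / q := by
  have hlow : ∫ y in Ioc 0 r, scaleWeight r p q y = 1 / p := by
    rw [setIntegral_congr_fun measurableSet_Ioc fun y hy => scaleWeight_of_le hy.2,
      integral_const_mul, ← intervalIntegral.integral_of_le hr.le,
      integral_rpow (Or.inl (by linarith)), sub_add_cancel, Real.zero_rpow hp.ne', sub_zero,
      mul_div_assoc', ← Real.rpow_add hr, neg_add_cancel, Real.rpow_zero]
  have hhigh : ∫ y in Ioi r, scaleWeight r p q y = 1 / q := by
    rw [setIntegral_congr_fun measurableSet_Ioi fun y hy => scaleWeight_of_lt hy,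
      integral_const_mul, integral_Ioi_rpow_of_lt (by linarith) hr, sub_add_cancel,
      neg_div_neg_eq, mul_div_assoc', ← Real.rpow_add hr, add_neg_cancel, Real.rpow_zero]
  rw [← Ioc_union_Ioi_eq_Ioi hr.le, setIntegral_union (Ioc_disjoint_Ioi le_rfl) measurableSet_Ioi
    (integrableOn_Ioc_scaleWeight hp hr) (integrableOn_Ioi_self_scaleWeight hq hr), hlow, hhigh]

lemma integrableOn_of_norm_le_scaleWeight {E : Type*} [NormedAddCommGroup E] {F : ℝ → E} {b : ℝ}
    (hp : 0 < p) (hq : 0 < q) (hr : 0 < r) (hF : AEStronglyMeasurable F (volume.restrict (Ioi 0)))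
    (hb : ∀ y, 0 < y → ‖F y‖ ≤ b * scaleWeight r p q y) : IntegrableOn F (Ioi 0) :=
  ((integrableOn_scaleWeight hp hq hr).const_mul b).mono' hF
    ((ae_restrict_mem measurableSet_Ioi).mono hb)

lemma norm_integral_le_of_norm_le_scaleWeight {E : Type*} [NormedAddCommGroup E] [NormedSpace ℝ E]
    {F : ℝ → E} {b : ℝ} (hp : 0 < p) (hq : 0 < q) (hr : 0 < r)
    (hb : ∀ y, 0 < y → ‖F y‖ ≤ b * scaleWeight r p q y) :
    ‖∫ y in Ioi 0, F y‖ ≤ b * (1 / p + 1 / q) := by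
  rw [← integral_scaleWeight hp hq hr, ← integral_const_mul]
  exact norm_integral_le_of_norm_le ((integrableOn_scaleWeight hp hq hr).const_mul b)
    ((ae_restrict_mem measurableSet_Ioi).mono hb)

lemma sliceWeight_nonneg (hr : 0 ≤ r) (hy : 0 < y) : 0 ≤ sliceWeight m δ r y := by
  unfold sliceWeight
  positivity

lemma sliceWeight_anti {r' : ℝ} (hm : 0 ≤ m + δ) (hr : 0 ≤ r) (hrr' : r ≤ r') (hy : 0 < y) :
    sliceWeight m δ r' y ≤ sliceWeight m δ r y := by
  unfold sliceWeight
  gcongr ?_ * ?_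
  exact Real.rpow_le_rpow_of_nonpos (by positivity) (by gcongr) (by linarith)

lemma sliceWeight_le_rpow (hm : 0 ≤ m + δ) (hr : 0 ≤ r) (hy : 0 < y) :
    sliceWeight m δ r y ≤ y ^ (-m - 1) :=
  mul_le_of_le_one_right (by positivity) <|
    Real.rpow_le_one_of_one_le_of_nonpos (by linarith [div_nonneg hr hy.le]) (by linarith)

lemma sliceWeight_le_rpow_mul_rpow (hm : 0 ≤ m + δ) (hr : 0 < r) (hy : 0 < y) :
    sliceWeight m δ r y ≤ r ^ (-(m + δ)) * y ^ (δ - 1) := by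
  calc y ^ (-m - 1) * (1 + r / y) ^ (-(m + δ))
      ≤ y ^ (-m - 1) * (r / y) ^ (-(m + δ)) := by
        gcongr ?_ * ?_
        exact Real.rpow_le_rpow_of_nonpos (by positivity) (by linarith) (by linarith)
    _ = r ^ (-(m + δ)) * y ^ (δ - 1) := by
        rw [Real.div_rpow hr.le hy.le, Real.rpow_neg hy.le (m + δ), div_inv_eq_mul, mul_left_comm,
          ← Real.rpow_add hy]
        ring_nf

lemma sliceWeight_le_scaleWeight (hm : 0 ≤ m + δ) (hr : 0 < r) (hy : 0 < y) :
    sliceWeight m δ r y ≤ r ^ (-m) * scaleWeight r δ m y := by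
  have h := le_max_mul_scaleWeight (p := δ) (q := m) hr hy
    (fun _ => sliceWeight_le_rpow_mul_rpow hm hr hy)
    (fun _ => (sliceWeight_le_rpow hm hr.le hy).trans_eq (one_mul _).symm)
  rwa [← Real.rpow_add hr, one_mul, show -(m + δ) + δ = -m by ring, max_self] at h

lemma sliceWeight_mul_rpow_le {s : ℝ} (hs : 0 ≤ s) (hr : 0 ≤ r) (hy : 0 < y) :
    sliceWeight m δ r y * r ^ s ≤ y ^ s * sliceWeight m (δ - s) r y := by
  have hpos : 0 < 1 + r / y := by positivity
  have hrs : r ^ s ≤ y ^ s * (1 + r / y) ^ s := by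
    rw [← Real.mul_rpow hy.le hpos.le, mul_add, mul_div_cancel₀ _ hy.ne']
    exact Real.rpow_le_rpow hr (by linarith) hs
  calc sliceWeight m δ r y * r ^ s
      ≤ sliceWeight m δ r y * (y ^ s * (1 + r / y) ^ s) :=
        mul_le_mul_of_nonneg_left hrs (sliceWeight_nonneg hr hy)
    _ = y ^ s * (y ^ (-m - 1) * ((1 + r / y) ^ (-(m + δ)) * (1 + r / y) ^ s)) := by
        unfold sliceWeight; ring
    _ = y ^ s * sliceWeight m (δ - s) r y := by
        rw [← Real.rpow_add hpos, sliceWeight]; ring_nf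

end Weights

section DecayMass

variable {n : ℕ} {N δ y : ℝ}

/-- The integral over `ℝⁿ` of the weight `(1 + |u|) ^ (-N)`, finite when `N > n`. -/
def decayMass (n : ℕ) (N : ℝ) : ℝ := ∫ u : Eu n, (1 + ‖u‖) ^ (-N)

lemma decayMass_nonneg (n : ℕ) (N : ℝ) : 0 ≤ decayMass n N :=
  integral_nonneg fun _ => by positivity

lemma integrable_decay (hN : n < N) : Integrable (fun u : Eu n => (1 + ‖u‖) ^ (-N)) :=
  integrable_one_add_norm (by simpa using hN)

lemma norm_inv_smul {E : Type*} [SeminormedAddCommGroup E] [NormedSpace ℝ E] (hy : 0 < y) (u : E) :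
    ‖y⁻¹ • u‖ = ‖u‖ / y := by
  rw [norm_smul, norm_inv, Real.norm_of_nonneg hy.le, div_eq_inv_mul]

lemma integrable_decay_div (hN : n < N) (hy : 0 < y) :
    Integrable (fun u : Eu n => (1 + ‖u‖ / y) ^ (-N)) := by
  simpa only [norm_inv_smul hy] using (integrable_decay hN).comp_smul (inv_ne_zero hy.ne')

lemma integral_decay_div (hy : 0 < y) :
    ∫ u : Eu n, (1 + ‖u‖ / y) ^ (-N) = y ^ n * decayMass n N := by
  simpa [norm_inv_smul hy, decayMass] using Measure.integral_comp_inv_smul_of_nonneg volume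
    (fun u : Eu n => (1 + ‖u‖) ^ (-N)) hy.le

lemma integrable_sliceWeight (hδ : 0 < δ) (hy : 0 < y) (x : Eu n) :
    Integrable (fun x' => sliceWeight n δ ‖x - x'‖ y) :=
  ((integrable_decay_div (by linarith) hy).const_mul _).comp_sub_left x

lemma integral_sliceWeight (hy : 0 < y) (x : Eu n) :
    ∫ x', sliceWeight n δ ‖x - x'‖ y = y⁻¹ * decayMass n (n + δ) := by
  rw [integral_sub_left_eq_self (fun u : Eu n => sliceWeight n δ ‖u‖ y) volume x]
  unfold sliceWeight
  rw [integral_const_mul, integral_decay_div hy, ← mul_assoc, ← Real.rpow_natCast y n,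
    ← Real.rpow_add hy, ← Real.rpow_neg_one]
  ring_nf

end DecayMass

section Parametric

lemma aestronglyMeasurable_fderiv_param {α E F : Type*} [MeasurableSpace α] {μ : Measure α}
    [NormedAddCommGroup E] [NormedSpace ℝ E] [FiniteDimensional ℝ E] [NormedAddCommGroup F]
    [NormedSpace ℝ F] {q : α → E → F} {x : E} (hq : ∀ z, AEStronglyMeasurable (fun a => q a z) μ)
    (hd : ∀ᵐ a ∂μ, DifferentiableAt ℝ (q a) x) :
    AEStronglyMeasurable (fun a => fderiv ℝ (q a) x) μ := by
  have happ (v : E) : AEStronglyMeasurable (fun a => fderiv ℝ (q a) x v) μ := by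
    refine aestronglyMeasurable_of_tendsto_ae atTop
      (f := fun (m : ℕ) a => (m : ℝ) • (q a (x + (m : ℝ)⁻¹ • v) - q a x))
      (fun m => ((hq _).sub (hq _)).const_smul (m : ℝ)) ?_
    filter_upwards [hd] with a ha
    exact ha.hasFDerivAt.lim v (by simpa using tendsto_natCast_atTop_atTop (R := ℝ))
  let b := Module.finBasis ℝ E
  have hdec : (fun a => fderiv ℝ (q a) x) = fun a => ∑ i, ContinuousLinearMap.smulRightL ℝ E F
      (LinearMap.toContinuousLinearMap (b.coord i)) (fderiv ℝ (q a) x (b i)) := by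
    funext a
    ext v
    conv_lhs => rw [← b.sum_repr v, map_sum]
    simp [map_smul]
  rw [hdec]
  exact Finset.aestronglyMeasurable_fun_sum _ fun i _ =>
    (ContinuousLinearMap.continuous _).comp_aestronglyMeasurable (happ _)

lemma hasFDerivAt_integral_of_sliceWeight {E F : Type*} [NormedAddCommGroup E] [NormedSpace ℝ E]
    [FiniteDimensional ℝ E] [NormedAddCommGroup F] [NormedSpace ℝ F] {q : ℝ → E → F} {c x : E}
    {B m δ : ℝ} (hm : 0 < m) (hδ : 0 < δ) (hB : 0 ≤ B)
    (hq : ∀ z, AEStronglyMeasurable (fun y => q y z) (volume.restrict (Ioi 0)))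
    (hx : x ≠ c) (hint : IntegrableOn (fun y => q y x) (Ioi 0))
    (hd : ∀ y, 0 < y → ∀ z, DifferentiableAt ℝ (q y) z)
    (hg : ∀ y, 0 < y → ∀ z, ‖fderiv ℝ (q y) z‖ ≤ B * sliceWeight m δ ‖z - c‖ y) :
    HasFDerivAt (fun z => ∫ y in Ioi 0, q y z) (∫ y in Ioi 0, fderiv ℝ (q y) x) x := by
  have hr : 0 < ‖x - c‖ / 2 := half_pos (norm_pos_iff.2 (sub_ne_zero.2 hx))
  have hpos : ∀ᵐ y ∂(volume.restrict (Ioi (0 : ℝ))), 0 < y := ae_restrict_mem measurableSet_Ioi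
  refine hasFDerivAt_integral_of_dominated_of_fderiv_le (F' := fun z y => fderiv ℝ (q y) z)
    (bound := fun y => B * ((‖x - c‖ / 2) ^ (-m) * scaleWeight (‖x - c‖ / 2) δ m y))
    (Metric.ball_mem_nhds x hr) (.of_forall hq) hint
    (aestronglyMeasurable_fderiv_param hq (hpos.mono fun y hy => hd y hy x)) ?_
    (((integrableOn_scaleWeight hδ hm hr).const_mul _).const_mul B)
    (hpos.mono fun y hy z _ => (hd y hy z).hasFDerivAt)
  filter_upwards [hpos] with y hy z hz
  have hzc : ‖x - c‖ / 2 ≤ ‖z - c‖ := by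
    rw [Metric.mem_ball, dist_eq_norm, norm_sub_rev] at hz
    linarith [norm_sub_le_norm_sub_add_norm_sub x z c]
  refine (hg y hy z).trans (mul_le_mul_of_nonneg_left ?_ hB)
  exact (sliceWeight_anti (by positivity) hr.le hzc hy).trans
    (sliceWeight_le_scaleWeight (by positivity) hr hy)

lemma norm_integral_le_of_sliceWeight {E : Type*} [NormedAddCommGroup E] [NormedSpace ℝ E]
    {F : ℝ → E} {B m δ r : ℝ} (hm : 0 < m) (hδ : 0 < δ) (hB : 0 ≤ B) (hr : 0 < r)
    (hF : ∀ y, 0 < y → ‖F y‖ ≤ B * sliceWeight m δ r y) :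
    ‖∫ y in Ioi 0, F y‖ ≤ B * (1 / δ + 1 / m) / r ^ m := by
  refine (norm_integral_le_of_norm_le_scaleWeight (b := B * r ^ (-m)) hδ hm hr fun y hy =>
    (hF y hy).trans ?_).trans_eq ?_
  · rw [mul_assoc]
    exact mul_le_mul_of_nonneg_left (sliceWeight_le_scaleWeight (by positivity) hr hy) hB
  · rw [Real.rpow_neg hr.le]
    ring

lemma exists_holderWith {E F : Type*} [NormedAddCommGroup E] [NormedSpace ℝ E]
    [NormedAddCommGroup F] [NormedSpace ℝ F] (f : 𝓢(E, F)) {s : ℝ≥0} (hs : s ≤ 1) :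
    ∃ L, HolderWith L s f := by
  obtain ⟨K, hK⟩ := f.decay 0 1
  have hLip : LipschitzWith K.toNNReal f := lipschitzWith_of_nnnorm_fderiv_le f.differentiable
    fun x => by
      rw [← NNReal.coe_le_coe, Real.coe_toNNReal _ hK.1.le, coe_nnnorm]
      simpa [norm_iteratedFDeriv_one] using hK.2 x
  obtain ⟨S, hS⟩ : ∃ S, ∀ x, ‖f x‖ ≤ S := ⟨_, fun x => SchwartzMap.norm_le_seminorm ℝ f x⟩
  have hbdd : HolderWith (2 * S).toNNReal 0 f := fun x x' => by
    rw [NNReal.coe_zero, ENNReal.rpow_zero, mul_one, edist_dist, dist_eq_norm]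
    exact ENNReal.ofReal_le_ofReal (by linarith [norm_sub_le (f x) (f x'), hS x, hS x'])
  have h := hbdd.interpolate (holderWith_one.2 hLip) (tsub_add_cancel_of_le hs)
  rw [zero_mul, zero_add, one_mul] at h
  exact ⟨_, h⟩

end Parametric

/-- A family of kernel slices `k y`, `y > 0`, with the size, cancellation, gradient and `L²` bounds
under which `∫₀^∞ k y dy` is a Calderón–Zygmund kernel. The `L²` bound is in dual form, as the
operator is only a convergent integral of the slices when tested against `L²` functions. -/
structure IsCZSlices {n : ℕ} (k : ℝ → Eu n → Eu n → ℂ) (B δ : ℝ) : Prop where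
  nonneg : 0 ≤ B
  decay_pos : 0 < δ
  measurable : Measurable (fun p : ℝ × Eu n × Eu n => k p.1 p.2.1 p.2.2)
  size : ∀ y, 0 < y → ∀ x x', ‖k y x x'‖ ≤ B * sliceWeight n δ ‖x - x'‖ y
  cancel : ∀ y, 0 < y → ∀ x, ∫ x', k y x x' = 0
  differentiable_fst : ∀ y, 0 < y → ∀ x x', DifferentiableAt ℝ (fun z => k y z x') x
  differentiable_snd : ∀ y, 0 < y → ∀ x x', DifferentiableAt ℝ (fun z => k y x z) x'
  grad_fst : ∀ y, 0 < y → ∀ x x',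
    ‖fderiv ℝ (fun z => k y z x') x‖ ≤ B * sliceWeight (n + 1) δ ‖x - x'‖ y
  grad_snd : ∀ y, 0 < y → ∀ x x',
    ‖fderiv ℝ (fun z => k y x z) x'‖ ≤ B * sliceWeight (n + 1) δ ‖x - x'‖ y
  l2 : ∀ (f : 𝓢(Eu n, ℂ)) (g : Eu n → ℂ), Integrable g → MemLp g 2 volume →
    ∫⁻ y in Ioi (0 : ℝ), ‖∫ x, (∫ x', k y x x' * f x') * g x‖ₑ ≤
      ENNReal.ofReal B * eLpNorm f 2 volume * eLpNorm g 2 volume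

/-- The kernel `∫₀^∞ k y dy` assembled from slices. -/
def slicesKernel {n : ℕ} (k : ℝ → Eu n → Eu n → ℂ) (x x' : Eu n) : ℂ :=
  ∫ y in Ioi (0 : ℝ), k y x x'

/-- The operator assembled from slices; integrating in the height last regularises the singularity
of `slicesKernel k` on the diagonal. -/
def slicesOp {n : ℕ} (k : ℝ → Eu n → Eu n → ℂ) (f : 𝓢(Eu n, ℂ)) (x : Eu n) : ℂ :=
  ∫ y in Ioi (0 : ℝ), ∫ x', k y x x' * f x'

/-- The multiplier that corrects the integral of `slicesKernel k` truncated at distance `ε`. -/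
def pvMultiplier {n : ℕ} (k : ℝ → Eu n → Eu n → ℂ) (ε : ℝ) (x : Eu n) : ℂ :=
  ∫ y in Ioi (0 : ℝ), ∫ x' in Metric.closedBall x ε, k y x x'

/-- The constant in the bounds on integrals of slices over balls about the diagonal. -/
def nearConst (n : ℕ) (δ s : ℝ) : ℝ :=
  max (decayMass n (n + (δ - s))) (volume.real (Metric.ball (0 : Eu n) 1))

namespace IsCZSlices

variable {n : ℕ} {k : ℝ → Eu n → Eu n → ℂ} {B δ : ℝ} {x x' : Eu n} {y : ℝ}

section Kernel

lemma measurable_height (hk : IsCZSlices k B δ) (x x' : Eu n) : Measurable (fun y => k y x x') :=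
  hk.measurable.comp (f := fun y => (y, x, x')) (by fun_prop)

lemma measurable_snd (hk : IsCZSlices k B δ) (y : ℝ) (x : Eu n) : Measurable (k y x) :=
  hk.measurable.comp (f := fun x' => (y, x, x')) (by fun_prop)

lemma integrableOn_height (hk : IsCZSlices k B δ) (hn : 0 < n) (hx : x ≠ x') :
    IntegrableOn (fun y => k y x x') (Ioi 0) := by
  have hr : 0 < ‖x - x'‖ := norm_pos_iff.2 (sub_ne_zero.2 hx)
  have hδ := hk.decay_pos
  refine integrableOn_of_norm_le_scaleWeight (b := B * ‖x - x'‖ ^ (-(n : ℝ))) hδ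
    (Nat.cast_pos.2 hn) hr (hk.measurable_height x x').aestronglyMeasurable fun y hy =>
      (hk.size y hy x x').trans ?_
  rw [mul_assoc]
  exact mul_le_mul_of_nonneg_left (sliceWeight_le_scaleWeight (by positivity) hr hy) hk.nonneg

lemma isCZKernel (hk : IsCZSlices k B δ) (hn : 0 < n) :
    IsCZKernel (slicesKernel k) (B * (1 / δ + 1 / n)) := by
  have hδ := hk.decay_pos
  have hn' : (0 : ℝ) < n := Nat.cast_pos.2 hn
  have hfst (x x' : Eu n) (hx : x ≠ x') := hasFDerivAt_integral_of_sliceWeight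
    (by positivity) hδ hk.nonneg (fun z => (hk.measurable_height z x').aestronglyMeasurable) hx
    (hk.integrableOn_height hn hx) (fun y hy z => hk.differentiable_fst y hy z x')
    (fun y hy z => hk.grad_fst y hy z x')
  have hsnd (x x' : Eu n) (hx : x ≠ x') := hasFDerivAt_integral_of_sliceWeight
    (by positivity) hδ hk.nonneg (fun z => (hk.measurable_height x z).aestronglyMeasurable) hx.symm
    (hk.integrableOn_height hn hx) (fun y hy z => hk.differentiable_snd y hy x z)
    (fun y hy z => norm_sub_rev x z ▸ hk.grad_snd y hy x z)
  have hgrad {x x' : Eu n} (hx : x ≠ x') {D : ℝ → Eu n →L[ℝ] ℂ}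
      (hD : ∀ y, 0 < y → ‖D y‖ ≤ B * sliceWeight (n + 1) δ ‖x - x'‖ y) :
      ‖∫ y in Ioi 0, D y‖ ≤ B * (1 / δ + 1 / n) / ‖x - x'‖ ^ (n + 1) := by
    refine (norm_integral_le_of_sliceWeight (by positivity) hδ hk.nonneg
      (norm_pos_iff.2 (sub_ne_zero.2 hx)) hD).trans ?_
    have := hk.nonneg
    rw [← Nat.cast_add_one, Real.rpow_natCast]
    gcongr
    linarith
  refine ⟨fun x x' hx => ?_, fun x x' hx => (hfst x x' hx).differentiableAt,
    fun x x' hx => (hsnd x x' hx).differentiableAt, fun x x' hx => ?_, fun x x' hx => ?_⟩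
  · rw [← Real.rpow_natCast]
    exact norm_integral_le_of_sliceWeight hn' hδ hk.nonneg (norm_pos_iff.2 (sub_ne_zero.2 hx))
      fun y hy => hk.size y hy x x'
  · refine (congrArg norm (hfst x x' hx).fderiv).trans_le ?_
    exact hgrad hx fun y hy => hk.grad_fst y hy x x'
  · refine (congrArg norm (hsnd x x' hx).fderiv).trans_le ?_
    exact hgrad hx fun y hy => hk.grad_snd y hy x x'

end Kernel

section Far

variable {r : ℝ} {t : Set (Eu n)} {h : Eu n → ℂ}

lemma integrable_prod_of_far (hk : IsCZSlices k B δ) (hn : 0 < n) (hr : 0 < r)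
    (ht : MeasurableSet t) (hfar : ∀ x' ∈ t, r ≤ ‖x - x'‖) (hh : IntegrableOn h t) :
    Integrable (fun p : ℝ × Eu n => k p.1 x p.2 * h p.2)
      ((volume.restrict (Ioi (0 : ℝ))).prod (volume.restrict t)) := by
  have hδ := hk.decay_pos
  have hpos : ∀ᵐ p ∂((volume.restrict (Ioi (0 : ℝ))).prod (volume.restrict t)), 0 < p.1 :=
    Measure.quasiMeasurePreserving_fst.ae (ae_restrict_mem measurableSet_Ioi)
  have hmem : ∀ᵐ p ∂((volume.restrict (Ioi (0 : ℝ))).prod (volume.restrict t)), p.2 ∈ t :=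
    Measure.quasiMeasurePreserving_snd.ae (ae_restrict_mem ht)
  have hw := ((integrableOn_scaleWeight hδ (Nat.cast_pos.2 hn) hr).const_mul
    (r ^ (-(n : ℝ)))).const_mul B
  refine (hw.mul_prod hh.norm).mono' ((hk.measurable.comp (f := fun p : ℝ × Eu n => (p.1, x, p.2))
      (by fun_prop)).aestronglyMeasurable.mul hh.aestronglyMeasurable.comp_snd) ?_
  filter_upwards [hpos, hmem] with p hp hpt
  rw [norm_mul]
  refine mul_le_mul_of_nonneg_right ((hk.size _ hp _ _).trans ?_) (norm_nonneg _)
  refine mul_le_mul_of_nonneg_left ?_ hk.nonneg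
  exact (sliceWeight_anti (by positivity) hr.le (hfar _ hpt) hp).trans
    (sliceWeight_le_scaleWeight (by positivity) hr hp)

lemma integrableOn_slicesKernel_mul (hk : IsCZSlices k B δ) (hn : 0 < n) (hr : 0 < r)
    (ht : MeasurableSet t) (hfar : ∀ x' ∈ t, r ≤ ‖x - x'‖) (hh : IntegrableOn h t) :
    IntegrableOn (fun x' => slicesKernel k x x' * h x') t := by
  simp only [slicesKernel, ← integral_mul_const]
  exact (hk.integrable_prod_of_far hn hr ht hfar hh).integral_prod_right

lemma integrableOn_setIntegral_of_far (hk : IsCZSlices k B δ) (hn : 0 < n) (hr : 0 < r)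
    (ht : MeasurableSet t) (hfar : ∀ x' ∈ t, r ≤ ‖x - x'‖) (hh : IntegrableOn h t) :
    IntegrableOn (fun y => ∫ x' in t, k y x x' * h x') (Ioi 0) :=
  (hk.integrable_prod_of_far hn hr ht hfar hh).integral_prod_left

lemma integral_setIntegral_eq_of_far (hk : IsCZSlices k B δ) (hn : 0 < n) (hr : 0 < r)
    (ht : MeasurableSet t) (hfar : ∀ x' ∈ t, r ≤ ‖x - x'‖) (hh : IntegrableOn h t) :
    ∫ y in Ioi (0 : ℝ), ∫ x' in t, k y x x' * h x' = ∫ x' in t, slicesKernel k x x' * h x' := by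
  simp only [slicesKernel, ← integral_mul_const]
  exact integral_integral_swap (hk.integrable_prod_of_far hn hr ht hfar hh)

lemma exists_far_of_notMem {s : Set (Eu n)} (hs : IsClosed s) (hx : x ∉ s) :
    ∃ r, 0 < r ∧ ∀ x' ∈ s, r ≤ ‖x - x'‖ := by
  obtain ⟨r, hr, hball⟩ := Metric.isOpen_iff.1 hs.isOpen_compl x hx
  refine ⟨r, hr, fun x' hx' => not_lt.1 fun hlt => hball ?_ hx'⟩
  rwa [Metric.mem_ball, dist_eq_norm, norm_sub_rev]

end Far

section SliceBounds

variable {s L : ℝ} {h : Eu n → ℂ}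

lemma integrable (hk : IsCZSlices k B δ) (hy : 0 < y) (x : Eu n) : Integrable (k y x) :=
  ((integrable_sliceWeight hk.decay_pos hy x).const_mul B).mono'
    (hk.measurable_snd y x).aestronglyMeasurable (.of_forall (hk.size y hy x))

lemma norm_le_rpow (hk : IsCZSlices k B δ) (hy : 0 < y) (x x' : Eu n) :
    ‖k y x x'‖ ≤ B * y ^ (-n - 1 : ℝ) := by
  have hδ := hk.decay_pos
  exact (hk.size y hy x x').trans
    (mul_le_mul_of_nonneg_left (sliceWeight_le_rpow (by positivity) (norm_nonneg _) hy) hk.nonneg)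

lemma integrable_mul (hk : IsCZSlices k B δ) (hy : 0 < y) (x : Eu n) (hh : Integrable h) :
    Integrable (fun x' => k y x x' * h x') :=
  hh.bdd_mul (hk.measurable_snd y x).aestronglyMeasurable (.of_forall (hk.norm_le_rpow hy x))

lemma stronglyMeasurable_setIntegral (hk : IsCZSlices k B δ) (hh : Measurable h)
    (t : Set (Eu n)) : StronglyMeasurable (fun p : ℝ × Eu n => ∫ x' in t, k p.1 p.2 x' * h x') := by
  refine StronglyMeasurable.integral_prod_right
    (f := fun (p : ℝ × Eu n) x' => k p.1 p.2 x' * h x') (Measurable.stronglyMeasurable ?_)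
  exact (hk.measurable.comp (f := fun p : (ℝ × Eu n) × Eu n => (p.1.1, p.1.2, p.2))
    (by fun_prop)).mul (hh.comp _root_.measurable_snd)

lemma aestronglyMeasurable_setIntegral (hk : IsCZSlices k B δ) (hh : Measurable h)
    (t : Set (Eu n)) (x : Eu n) :
    AEStronglyMeasurable (fun y => ∫ x' in t, k y x x' * h x') (volume.restrict (Ioi 0)) :=
  ((hk.stronglyMeasurable_setIntegral hh t).comp_measurable
    (g := fun y => (y, x)) (by fun_prop)).aestronglyMeasurable

lemma norm_setIntegral_mul_le (hk : IsCZSlices k B δ) (hy : 0 < y) {t : Set (Eu n)}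
    (hh : IntegrableOn h t) :
    ‖∫ x' in t, k y x x' * h x'‖ ≤ B * (∫ x' in t, ‖h x'‖) * y ^ (-n - 1 : ℝ) := by
  rw [mul_right_comm, ← integral_const_mul]
  refine norm_integral_le_of_norm_le (hh.norm.const_mul _) (.of_forall fun x' => ?_)
  rw [norm_mul]
  exact mul_le_mul_of_nonneg_right (hk.norm_le_rpow hy x x') (norm_nonneg _)

lemma norm_setIntegral_mul_le_of_holder (hk : IsCZSlices k B δ) (hs0 : 0 ≤ s) (hs : s < δ)
    (hy : 0 < y) {t : Set (Eu n)} (ht : MeasurableSet t) (hL : 0 ≤ L)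
    (hh : ∀ x' ∈ t, ‖h x'‖ ≤ L * ‖x - x'‖ ^ s) :
    ‖∫ x' in t, k y x x' * h x'‖ ≤ B * L * decayMass n (n + (δ - s)) * y ^ (s - 1) := by
  have hB := hk.nonneg
  have hw (x' : Eu n) : 0 ≤ sliceWeight n (δ - s) ‖x - x'‖ y :=
    sliceWeight_nonneg (norm_nonneg _) hy
  have hint : Integrable (fun x' => B * L * (y ^ s * sliceWeight n (δ - s) ‖x - x'‖ y)) :=
    ((integrable_sliceWeight (sub_pos.2 hs) hy x).const_mul _).const_mul _
  calc ‖∫ x' in t, k y x x' * h x'‖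
      ≤ ∫ x' in t, B * L * (y ^ s * sliceWeight n (δ - s) ‖x - x'‖ y) := by
        refine norm_integral_le_of_norm_le hint.integrableOn ?_
        filter_upwards [ae_restrict_mem ht] with x' hx'
        calc ‖k y x x' * h x'‖
            ≤ (B * sliceWeight n δ ‖x - x'‖ y) * (L * ‖x - x'‖ ^ s) := by
              rw [norm_mul]
              exact mul_le_mul (hk.size y hy x x') (hh x' hx') (norm_nonneg _)
                (mul_nonneg hB (sliceWeight_nonneg (norm_nonneg _) hy))
          _ = B * L * (sliceWeight n δ ‖x - x'‖ y * ‖x - x'‖ ^ s) := by ring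
          _ ≤ B * L * (y ^ s * sliceWeight n (δ - s) ‖x - x'‖ y) := by
              gcongr ?_ * ?_
              exact sliceWeight_mul_rpow_le hs0 (norm_nonneg _) hy
    _ ≤ ∫ x', B * L * (y ^ s * sliceWeight n (δ - s) ‖x - x'‖ y) :=
        setIntegral_le_integral hint (.of_forall fun x' => by have := hw x'; positivity)
    _ = B * L * decayMass n (n + (δ - s)) * y ^ (s - 1) := by
        rw [integral_const_mul, integral_const_mul, integral_sliceWeight hy,
          Real.rpow_sub_one hy.ne']
        ring

end SliceBounds

section Near

variable {s L ε : ℝ} {h : Eu n → ℂ}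

lemma setIntegral_closedBall_eq_neg_compl (hk : IsCZSlices k B δ) (hy : 0 < y) (x : Eu n) :
    ∫ x' in Metric.closedBall x ε, k y x x' = -∫ x' in (Metric.closedBall x ε)ᶜ, k y x x' := by
  rw [eq_neg_iff_add_eq_zero, integral_add_compl measurableSet_closedBall (hk.integrable hy x),
    hk.cancel y hy]

lemma norm_setIntegral_closedBall_mul_le (hk : IsCZSlices k B δ) (hy : 0 < y) (hε : 0 ≤ ε)
    (hh : ∀ x' ∈ Metric.closedBall x ε, ‖h x'‖ ≤ L) :
    ‖∫ x' in Metric.closedBall x ε, k y x x' * h x'‖ ≤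
      B * L * (ε ^ n * volume.real (Metric.ball (0 : Eu n) 1)) * y ^ (-n - 1 : ℝ) := by
  have hB := hk.nonneg
  have hvol : volume.real (Metric.closedBall x ε) =
      ε ^ n * volume.real (Metric.ball (0 : Eu n) 1) := by
    simpa using Measure.addHaar_real_closedBall (volume : Measure (Eu n)) x hε
  rw [← hvol, mul_right_comm, mul_right_comm B]
  refine norm_setIntegral_le_of_norm_le_const measure_closedBall_lt_top fun x' hx' => ?_
  rw [norm_mul]
  exact mul_le_mul (hk.norm_le_rpow hy x x') (hh x' hx') (norm_nonneg _) (by positivity)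

lemma norm_setIntegral_closedBall_le_scaleWeight (hk : IsCZSlices k B δ) (hs0 : 0 ≤ s) (hs : s < δ)
    (hε : 0 < ε) (hy : 0 < y) (x : Eu n) :
    ‖∫ x' in Metric.closedBall x ε, k y x x'‖ ≤ B * nearConst n δ s * scaleWeight ε s n y := by
  have hB := hk.nonneg
  have hlow : ‖∫ x' in Metric.closedBall x ε, k y x x'‖ ≤
      B * ε ^ (-s) * decayMass n (n + (δ - s)) * y ^ (s - 1) := by
    rw [hk.setIntegral_closedBall_eq_neg_compl hy, norm_neg]
    have hfar : ∀ x' ∈ (Metric.closedBall x ε)ᶜ, ‖(1 : ℂ)‖ ≤ ε ^ (-s) * ‖x - x'‖ ^ s := by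
      intro x' hx'
      rw [mem_compl_iff, Metric.mem_closedBall, dist_eq_norm, norm_sub_rev, not_le] at hx'
      rw [norm_one, Real.rpow_neg hε.le, ← div_eq_inv_mul, ← Real.div_rpow (norm_nonneg _) hε.le]
      exact Real.one_le_rpow ((one_le_div hε).2 hx'.le) hs0
    simpa only [mul_one] using hk.norm_setIntegral_mul_le_of_holder hs0 hs hy
      measurableSet_closedBall.compl (by positivity) hfar
  have hhigh : ‖∫ x' in Metric.closedBall x ε, k y x x'‖ ≤
      B * 1 * (ε ^ n * volume.real (Metric.ball (0 : Eu n) 1)) * y ^ (-n - 1 : ℝ) := by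
    simpa only [Pi.one_apply, mul_one] using hk.norm_setIntegral_closedBall_mul_le (x := x) (L := 1)
      (h := 1) hy hε.le (by simp)
  refine (le_max_mul_scaleWeight hε hy (fun _ => hlow) fun _ => hhigh).trans_eq ?_
  rw [nearConst, mul_max_of_nonneg _ _ hB, ← Real.rpow_natCast ε n, Real.rpow_neg hε.le,
    Real.rpow_neg hε.le]
  congr 2 <;> field_simp

lemma norm_setIntegral_closedBall_mul_le_scaleWeight (hk : IsCZSlices k B δ) (hs0 : 0 ≤ s)
    (hs : s < δ) (hL : 0 ≤ L) (hε : 0 < ε) (hy : 0 < y) (hh : ∀ x', ‖h x'‖ ≤ L * ‖x - x'‖ ^ s) :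
    ‖∫ x' in Metric.closedBall x ε, k y x x' * h x'‖ ≤
      B * L * nearConst n δ s * ε ^ s * scaleWeight ε s n y := by
  have hB := hk.nonneg
  have hlow := hk.norm_setIntegral_mul_le_of_holder hs0 hs hy (measurableSet_closedBall (x := x)
    (ε := ε)) hL fun x' _ => hh x'
  have hhigh := hk.norm_setIntegral_closedBall_mul_le (x := x) (L := L * ε ^ s) hy hε.le
    fun x' hx' => (hh x').trans <| by
      rw [Metric.mem_closedBall, dist_eq_norm, norm_sub_rev] at hx'
      gcongr
  refine (le_max_mul_scaleWeight hε hy (fun _ => hlow) fun _ => hhigh).trans_eq ?_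
  have hBL : 0 ≤ B * L := by positivity
  have hεs : 0 ≤ ε ^ s := by positivity
  rw [nearConst, mul_max_of_nonneg _ _ hBL, max_mul_of_nonneg _ _ hεs, ← Real.rpow_natCast ε n,
    Real.rpow_neg hε.le]
  congr 2
  field_simp

end Near

section PrincipalValue

variable {ε : ℝ}

lemma exists_holder (hk : IsCZSlices k B δ) (f : 𝓢(Eu n, ℂ)) : ∃ s L : ℝ, 0 < s ∧ s < δ ∧ 0 ≤ L ∧
    ∀ x x', ‖f x' - f x‖ ≤ L * ‖x - x'‖ ^ s := by
  have hδ := half_pos hk.decay_pos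
  obtain ⟨L, hL⟩ := exists_holderWith f (min_le_right (δ / 2).toNNReal 1)
  refine ⟨(min (δ / 2).toNNReal 1 : ℝ≥0), L,
    NNReal.coe_pos.2 (lt_min (Real.toNNReal_pos.2 hδ) one_pos),
    (NNReal.coe_le_coe.2 (min_le_left (δ / 2).toNNReal 1)).trans_lt ?_, L.2, fun x x' => ?_⟩
  · rw [Real.coe_toNNReal _ hδ.le]
    exact half_lt_self hk.decay_pos
  · simpa only [dist_eq_norm, norm_sub_rev x'] using hL.dist_le x' x

lemma integral_mul_sub (hk : IsCZSlices k B δ) (hy : 0 < y) {h : Eu n → ℂ} (hh : Integrable h)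
    (x : Eu n) (c : ℂ) (t : Set (Eu n)) : ∫ x' in t, k y x x' * (h x' - c) =
      (∫ x' in t, k y x x' * h x') - (∫ x' in t, k y x x') * c := by
  simp only [mul_sub]
  rw [integral_sub (hk.integrable_mul hy x hh).integrableOn
    ((hk.integrable hy x).mul_const _).integrableOn, integral_mul_const]

lemma exists_norm_integral_mul_le (hk : IsCZSlices k B δ) (f : 𝓢(Eu n, ℂ)) :
    ∃ s D : ℝ, 0 < s ∧ ∀ y, 0 < y → ∀ x,
      ‖∫ x', k y x x' * f x'‖ ≤ D * scaleWeight 1 s n y := by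
  obtain ⟨s, L, hs, hsδ, hL, hf⟩ := hk.exists_holder f
  refine ⟨s, max (B * L * decayMass n (n + (δ - s)) * 1 ^ s)
    (B * (∫ x', ‖f x'‖) * 1 ^ (-(n : ℝ))), hs, fun y hy x => ?_⟩
  have hlow := hk.norm_setIntegral_mul_le_of_holder hs.le hsδ hy .univ hL fun x' _ => hf x x'
  have hhigh := hk.norm_setIntegral_mul_le (x := x) hy f.integrable.integrableOn (t := univ)
  rw [hk.integral_mul_sub hy f.integrable, setIntegral_univ, setIntegral_univ, hk.cancel y hy,
    zero_mul, sub_zero] at hlow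
  simp only [setIntegral_univ] at hhigh
  exact le_max_mul_scaleWeight one_pos hy (fun _ => hlow) fun _ => hhigh

lemma integrableOn_setIntegral_closedBall (hk : IsCZSlices k B δ) (hn : 0 < n) (hε : 0 < ε)
    (x : Eu n) : IntegrableOn (fun y => ∫ x' in Metric.closedBall x ε, k y x x') (Ioi 0) := by
  have hδ := half_pos hk.decay_pos
  refine integrableOn_of_norm_le_scaleWeight hδ (Nat.cast_pos.2 hn) hε ?_ fun y hy =>
    hk.norm_setIntegral_closedBall_le_scaleWeight hδ.le (half_lt_self hk.decay_pos) hε hy x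
  simpa only [Pi.one_apply, mul_one] using
    hk.aestronglyMeasurable_setIntegral (h := 1) measurable_one (Metric.closedBall x ε) x

lemma norm_pvMultiplier_le (hk : IsCZSlices k B δ) (hn : 0 < n) (hε : 0 < ε) (x : Eu n) :
    ‖pvMultiplier k ε x‖ ≤ B * nearConst n δ (δ / 2) * (1 / (δ / 2) + 1 / n) :=
  have hδ := half_pos hk.decay_pos
  norm_integral_le_of_norm_le_scaleWeight hδ (Nat.cast_pos.2 hn) hε fun _ hy =>
    hk.norm_setIntegral_closedBall_le_scaleWeight hδ.le (half_lt_self hk.decay_pos) hε hy x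

lemma integrableOn_setIntegral_closedBall_sub (hk : IsCZSlices k B δ) (hn : 0 < n) (hε : 0 < ε)
    (f : 𝓢(Eu n, ℂ)) (x : Eu n) :
    IntegrableOn (fun y => ∫ x' in Metric.closedBall x ε, k y x x' * (f x' - f x)) (Ioi 0) := by
  obtain ⟨s, L, hs, hsδ, hL, hf⟩ := hk.exists_holder f
  exact integrableOn_of_norm_le_scaleWeight hs (Nat.cast_pos.2 hn) hε
    (hk.aestronglyMeasurable_setIntegral (f.continuous.measurable.sub measurable_const) _ x)
    fun y hy => hk.norm_setIntegral_closedBall_mul_le_scaleWeight hs.le hsδ hL hε hy (hf x)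

lemma tendsto_setIntegral_closedBall_sub (hk : IsCZSlices k B δ) (hn : 0 < n) (f : 𝓢(Eu n, ℂ))
    (x : Eu n) : Tendsto (fun ε => ∫ y in Ioi (0 : ℝ), ∫ x' in Metric.closedBall x ε,
      k y x x' * (f x' - f x)) (𝓝[>] 0) (𝓝 0) := by
  obtain ⟨s, L, hs, hsδ, hL, hf⟩ := hk.exists_holder f
  have hbound : Tendsto (fun ε : ℝ => B * L * nearConst n δ s * ε ^ s * (1 / s + 1 / n))
      (𝓝[>] 0) (𝓝 (B * L * nearConst n δ s * 0 ^ s * (1 / s + 1 / n))) :=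
    (((Real.continuousAt_rpow_const 0 s (.inr hs.le)).tendsto.mono_left
      nhdsWithin_le_nhds).const_mul _).mul_const _
  rw [Real.zero_rpow hs.ne', mul_zero, zero_mul] at hbound
  refine squeeze_zero_norm' (eventually_mem_nhdsWithin.mono fun ε hε => ?_) hbound
  exact norm_integral_le_of_norm_le_scaleWeight hs (Nat.cast_pos.2 hn) hε fun y hy =>
    hk.norm_setIntegral_closedBall_mul_le_scaleWeight hs.le hsδ hL hε hy (hf x)

lemma slicesOp_eq (hk : IsCZSlices k B δ) (hn : 0 < n) (hε : 0 < ε) (f : 𝓢(Eu n, ℂ)) (x : Eu n) :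
    slicesOp k f x = (∫ x' in (Metric.closedBall x ε)ᶜ, slicesKernel k x x' * f x') +
      pvMultiplier k ε x * f x +
      ∫ y in Ioi (0 : ℝ), ∫ x' in Metric.closedBall x ε, k y x x' * (f x' - f x) := by
  have hfar : ∀ x' ∈ (Metric.closedBall x ε)ᶜ, ε ≤ ‖x - x'‖ := fun x' hx' => by
    rw [mem_compl_iff, Metric.mem_closedBall, dist_eq_norm, norm_sub_rev, not_le] at hx'
    exact hx'.le
  have hball : MeasurableSet (Metric.closedBall x ε)ᶜ := measurableSet_closedBall.compl
  have hfar_int := hk.integrableOn_setIntegral_of_far hn hε hball hfar f.integrable.integrableOn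
  have hnear_int := (hk.integrableOn_setIntegral_closedBall hn hε x).mul_const (f x)
  have hsum_int : IntegrableOn (fun y => (∫ x' in (Metric.closedBall x ε)ᶜ, k y x x' * f x') +
      (∫ x' in Metric.closedBall x ε, k y x x') * f x) (Ioi 0) := hfar_int.add hnear_int
  rw [← hk.integral_setIntegral_eq_of_far hn hε hball hfar f.integrable.integrableOn, pvMultiplier,
    ← integral_mul_const, ← integral_add hfar_int hnear_int,
    ← integral_add hsum_int (hk.integrableOn_setIntegral_closedBall_sub hn hε f x)]
  refine setIntegral_congr_fun measurableSet_Ioi fun y hy => ?_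
  rw [hk.integral_mul_sub hy f.integrable, ← integral_add_compl measurableSet_closedBall
    (hk.integrable_mul hy x f.integrable)]
  ring

lemma tendsto_truncated (hk : IsCZSlices k B δ) (hn : 0 < n) (f : 𝓢(Eu n, ℂ)) (x : Eu n) :
    Tendsto (fun ε : ℝ => (∫ x' in (Metric.closedBall x ε)ᶜ, slicesKernel k x x' * f x') +
      pvMultiplier k ε x * f x) (𝓝[>] 0) (𝓝 (slicesOp k f x)) := by
  have h := (hk.tendsto_setIntegral_closedBall_sub hn f x).const_sub (slicesOp k f x)
  rw [sub_zero] at h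
  refine h.congr' (eventually_mem_nhdsWithin.mono fun ε hε => ?_)
  rw [hk.slicesOp_eq hn hε, add_sub_cancel_right]

end PrincipalValue

end IsCZSlices

section L2Duality

variable {X : Type*} [MeasurableSpace X] {μ : Measure X}

lemma eLpNorm_two_sq {F : Type*} [NormedAddCommGroup F] (f : X → F) (μ : Measure X) :
    eLpNorm f 2 μ ^ 2 = ∫⁻ x, ‖f x‖ₑ ^ 2 ∂μ := by
  simpa using eLpNorm_nnreal_pow_eq_lintegral (f := f) (μ := μ) (two_ne_zero (α := ℝ≥0))

lemma enorm_integral_mul_star_self {h : X → ℂ} (hh : MemLp h 2 μ) :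
    ‖∫ x, h x * star (h x) ∂μ‖ₑ = eLpNorm h 2 μ ^ 2 := by
  have hsq : ∫ x, h x * star (h x) ∂μ = ((∫ x, ‖h x‖ ^ 2 ∂μ : ℝ) : ℂ) := by
    rw [← integral_complex_ofReal]
    refine integral_congr_ae (.of_forall fun x => ?_)
    simp only [Complex.star_def, Complex.mul_conj, Complex.normSq_eq_norm_sq]
  rw [hsq, eLpNorm_two_sq, ← ofReal_norm, Complex.norm_real,
    Real.norm_of_nonneg (integral_nonneg fun x => by positivity),
    ofReal_integral_eq_lintegral_ofReal (hh.integrable_norm_pow two_ne_zero)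
      (.of_forall fun x => by positivity)]
  refine lintegral_congr fun x => ?_
  rw [ENNReal.ofReal_pow (norm_nonneg _), ofReal_norm]

lemma eLpNorm_two_le_of_enorm_integral_mul_le {h : X → ℂ} {C : ℝ≥0∞} (hh : MemLp h 2 μ)
    (hh1 : Integrable h μ) (hC : ∀ g : X → ℂ, Integrable g μ → MemLp g 2 μ →
      ‖∫ x, h x * g x ∂μ‖ₑ ≤ C * eLpNorm g 2 μ) : eLpNorm h 2 μ ≤ C := by
  have hsq := hC (star h) (memLp_one_iff_integrable.1 (memLp_one_iff_integrable.2 hh1).star) hh.star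
  simp only [Pi.star_apply] at hsq
  rw [enorm_integral_mul_star_self hh, eLpNorm_star, sq] at hsq
  rcases eq_or_ne (eLpNorm h 2 μ) 0 with h0 | h0
  · exact h0.trans_le zero_le
  · exact (ENNReal.mul_le_mul_iff_left h0 hh.eLpNorm_ne_top).1 hsq

lemma eLpNorm_two_le_of_enorm_integral_mul_le_of_bound [SigmaFinite μ] {F : X → ℂ} {C : ℝ≥0∞}
    {D : ℝ} (hF : AEStronglyMeasurable F μ) (hD : ∀ x, ‖F x‖ ≤ D)
    (hC : ∀ g : X → ℂ, Integrable g μ → MemLp g 2 μ →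
      ‖∫ x, F x * g x ∂μ‖ₑ ≤ C * eLpNorm g 2 μ) : eLpNorm F 2 μ ≤ C := by
  have hS := measurableSet_spanningSets μ
  have hmem (p : ℝ≥0∞) (m : ℕ) : MemLp ((spanningSets μ m).indicator F) p μ := by
    have : IsFiniteMeasure (μ.restrict (spanningSets μ m)) :=
      ⟨by simpa using measure_spanningSets_lt_top μ m⟩
    rw [memLp_indicator_iff_restrict (hS m)]
    exact .of_bound hF.restrict D (.of_forall hD)
  have htrunc (m : ℕ) : eLpNorm ((spanningSets μ m).indicator F) 2 μ ≤ C := by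
    refine eLpNorm_two_le_of_enorm_integral_mul_le (hmem 2 m)
      (memLp_one_iff_integrable.1 (hmem 1 m)) fun g hg hg2 => ?_
    have hswap : ∀ x, (spanningSets μ m).indicator F x * g x =
        F x * (spanningSets μ m).indicator g x := fun x => by
      by_cases hx : x ∈ spanningSets μ m <;> simp [hx]
    simp only [hswap]
    exact (hC _ (hg.indicator (hS m)) (hg2.indicator (hS m))).trans
      (mul_le_mul_right (eLpNorm_indicator_le g) C)
  refine Lp.eLpNorm_le_of_ae_tendsto (u := atTop) (.of_forall htrunc)
    (fun m => (hmem 2 m).aestronglyMeasurable) (.of_forall fun x => ?_)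
  exact tendsto_const_nhds.congr' ((eventually_ge_atTop (spanningSetsIndex μ x)).mono fun m hm =>
    (indicator_of_mem (mem_spanningSets_of_index_le μ x hm) F).symm)

end L2Duality

lemma exists_clm_extension_of_eLpNorm_le {n : ℕ} {B : ℝ} (hB : 0 ≤ B)
    {T : 𝓢(Eu n, ℂ) → Eu n → ℂ} (hadd : ∀ f g x, T (f + g) x = T f x + T g x)
    (hsmul : ∀ (c : ℂ) f x, T (c • f) x = c * T f x)
    (hT : ∀ f, AEStronglyMeasurable (T f) volume)
    (hL2 : ∀ f, eLpNorm (T f) 2 volume ≤ ENNReal.ofReal B * eLpNorm f 2 volume) :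
    ∃ S : Lp ℂ 2 (volume : Measure (Eu n)) →L[ℂ] Lp ℂ 2 (volume : Measure (Eu n)),
      ‖S‖ ≤ B ∧ ∀ f : 𝓢(Eu n, ℂ), S (f.toLp 2) =ᵐ[volume] T f := by
  have hfin (f : 𝓢(Eu n, ℂ)) : ENNReal.ofReal B * eLpNorm f 2 volume ≠ ∞ :=
    ENNReal.mul_ne_top ENNReal.ofReal_ne_top (f.memLp 2 volume).eLpNorm_ne_top
  have hmem (f : 𝓢(Eu n, ℂ)) : MemLp (T f) 2 volume := ⟨hT f, (hL2 f).trans_lt (hfin f).lt_top⟩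
  let T₂ : 𝓢(Eu n, ℂ) →ₗ[ℂ] Lp ℂ 2 (volume : Measure (Eu n)) :=
    { toFun f := (hmem f).toLp
      map_add' f g := by
        rw [← MemLp.toLp_add]
        exact MemLp.toLp_congr _ _ (.of_forall (hadd f g))
      map_smul' c f := by
        rw [RingHom.id_apply, ← MemLp.toLp_const_smul]
        exact MemLp.toLp_congr _ _ (.of_forall (hsmul c f)) }
  let e : 𝓢(Eu n, ℂ) →ₗ[ℂ] Lp ℂ 2 (volume : Measure (Eu n)) :=
    (SchwartzMap.toLpCLM ℂ ℂ 2 volume).toLinearMap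
  have hdense : DenseRange e :=
    SchwartzMap.denseRange_toLpCLM (F := ℂ) (p := 2) ENNReal.ofNat_ne_top
  have hnorm (f) : ‖T₂ f‖ ≤ B * ‖e f‖ := by
    change ‖(hmem f).toLp‖ ≤ B * ‖f.toLp 2 volume‖
    rw [Lp.norm_toLp, SchwartzMap.norm_toLp, ← ENNReal.toReal_ofReal hB, ← ENNReal.toReal_mul]
    exact ENNReal.toReal_mono (hfin f) (hL2 f)
  refine ⟨T₂.extendOfNorm e, ContinuousLinearMap.opNorm_le_bound _ hB
    (LinearMap.norm_extendOfNorm_apply_le hdense B hnorm), fun f => ?_⟩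
  have hext : T₂.extendOfNorm e (f.toLp 2) = T₂ f := LinearMap.extendOfNorm_eq hdense ⟨B, hnorm⟩ f
  rw [hext]
  exact (hmem f).coeFn_toLp

lemma setOf_lt_norm_sub_eq_compl_closedBall {E : Type*} [SeminormedAddCommGroup E] (x : E) (ε : ℝ) :
    {x' | ε < ‖x - x'‖} = (Metric.closedBall x ε)ᶜ := by
  ext x'
  simp [dist_eq_norm, norm_sub_rev x]

lemma slicesOp_smul {n : ℕ} {k : ℝ → Eu n → Eu n → ℂ} (c : ℂ) (f : 𝓢(Eu n, ℂ)) (x : Eu n) :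
    slicesOp k (c • f) x = c * slicesOp k f x := by
  simp only [slicesOp, smul_apply, smul_eq_mul, mul_left_comm _ c, integral_const_mul]

namespace IsCZSlices

variable {n : ℕ} {k : ℝ → Eu n → Eu n → ℂ} {B δ : ℝ}

section Operator

lemma stronglyMeasurable_integral (hk : IsCZSlices k B δ) (f : 𝓢(Eu n, ℂ)) :
    StronglyMeasurable (fun p : ℝ × Eu n => ∫ x', k p.1 p.2 x' * f x') := by
  simpa only [setIntegral_univ] using hk.stronglyMeasurable_setIntegral f.continuous.measurable univ

lemma integrableOn_integral (hk : IsCZSlices k B δ) (hn : 0 < n) (f : 𝓢(Eu n, ℂ)) (x : Eu n) :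
    IntegrableOn (fun y => ∫ x', k y x x' * f x') (Ioi 0) := by
  obtain ⟨s, D, hs, hD⟩ := hk.exists_norm_integral_mul_le f
  exact integrableOn_of_norm_le_scaleWeight hs (Nat.cast_pos.2 hn) one_pos
    ((hk.stronglyMeasurable_integral f).comp_measurable (g := fun y => (y, x))
      (by fun_prop)).aestronglyMeasurable fun y hy => hD y hy x

lemma slicesOp_add (hk : IsCZSlices k B δ) (hn : 0 < n) (f g : 𝓢(Eu n, ℂ)) (x : Eu n) :
    slicesOp k (f + g) x = slicesOp k f x + slicesOp k g x := by
  unfold slicesOp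
  rw [← integral_add (hk.integrableOn_integral hn f x) (hk.integrableOn_integral hn g x)]
  refine setIntegral_congr_fun measurableSet_Ioi fun y hy => ?_
  simp only [add_apply, mul_add]
  exact integral_add (hk.integrable_mul hy x f.integrable) (hk.integrable_mul hy x g.integrable)

lemma stronglyMeasurable_slicesOp (hk : IsCZSlices k B δ) (f : 𝓢(Eu n, ℂ)) :
    StronglyMeasurable (slicesOp k f) :=
  (hk.stronglyMeasurable_integral f).integral_prod_left' (μ := volume.restrict (Ioi 0))

lemma exists_norm_slicesOp_le (hk : IsCZSlices k B δ) (hn : 0 < n) (f : 𝓢(Eu n, ℂ)) :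
    ∃ D, ∀ x, ‖slicesOp k f x‖ ≤ D := by
  obtain ⟨s, D, hs, hD⟩ := hk.exists_norm_integral_mul_le f
  exact ⟨_, fun x => norm_integral_le_of_norm_le_scaleWeight hs (Nat.cast_pos.2 hn) one_pos
    fun y hy => hD y hy x⟩

lemma integrable_prod_integral_mul (hk : IsCZSlices k B δ) (hn : 0 < n) (f : 𝓢(Eu n, ℂ))
    {g : Eu n → ℂ} (hg : Integrable g) :
    Integrable (fun p : ℝ × Eu n => (∫ x', k p.1 p.2 x' * f x') * g p.2)
      ((volume.restrict (Ioi (0 : ℝ))).prod volume) := by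
  obtain ⟨s, D, hs, hD⟩ := hk.exists_norm_integral_mul_le f
  refine (((integrableOn_scaleWeight hs (Nat.cast_pos.2 hn) one_pos).const_mul D).mul_prod
    hg.norm).mono' ((hk.stronglyMeasurable_integral f).aestronglyMeasurable.mul
      hg.aestronglyMeasurable.comp_snd) ?_
  filter_upwards [Measure.quasiMeasurePreserving_fst.ae (ae_restrict_mem measurableSet_Ioi)]
    with p hp
  rw [norm_mul]
  exact mul_le_mul_of_nonneg_right (hD _ hp _) (norm_nonneg _)

lemma enorm_integral_slicesOp_mul_le (hk : IsCZSlices k B δ) (hn : 0 < n) (f : 𝓢(Eu n, ℂ))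
    {g : Eu n → ℂ} (hg : Integrable g) (hg2 : MemLp g 2 volume) :
    ‖∫ x, slicesOp k f x * g x‖ₑ ≤ ENNReal.ofReal B * eLpNorm f 2 volume * eLpNorm g 2 volume := by
  have hswap : ∫ x, slicesOp k f x * g x =
      ∫ y in Ioi (0 : ℝ), ∫ x, (∫ x', k y x x' * f x') * g x := by
    rw [integral_integral_swap (hk.integrable_prod_integral_mul hn f hg)]
    exact integral_congr_ae (.of_forall fun x => (integral_mul_const _ _).symm)
  rw [hswap]
  exact (enorm_integral_le_lintegral_enorm _).trans (hk.l2 f g hg hg2)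

lemma eLpNorm_slicesOp_le (hk : IsCZSlices k B δ) (hn : 0 < n) (f : 𝓢(Eu n, ℂ)) :
    eLpNorm (slicesOp k f) 2 volume ≤ ENNReal.ofReal B * eLpNorm f 2 volume := by
  obtain ⟨D, hD⟩ := hk.exists_norm_slicesOp_le hn f
  exact eLpNorm_two_le_of_enorm_integral_mul_le_of_bound
    (hk.stronglyMeasurable_slicesOp f).aestronglyMeasurable hD fun g hg hg2 =>
      hk.enorm_integral_slicesOp_mul_le hn f hg hg2

lemma integrable_slicesKernel_mul_of_notMem_tsupport (hk : IsCZSlices k B δ) (hn : 0 < n)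
    (f : 𝓢(Eu n, ℂ)) {x : Eu n} (hx : x ∉ tsupport f) :
    Integrable (fun x' => slicesKernel k x x' * f x') := by
  obtain ⟨r, hr, hfar⟩ := exists_far_of_notMem (isClosed_tsupport f) hx
  rw [← integrableOn_iff_integrable_of_support_subset (s := tsupport f) fun x' hx' =>
    subset_tsupport _ (right_ne_zero_of_mul hx')]
  exact hk.integrableOn_slicesKernel_mul hn hr (isClosed_tsupport f).measurableSet hfar
    f.integrable.integrableOn

lemma slicesOp_eq_of_notMem_tsupport (hk : IsCZSlices k B δ) (hn : 0 < n) (f : 𝓢(Eu n, ℂ))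
    {x : Eu n} (hx : x ∉ tsupport f) : slicesOp k f x = ∫ x', slicesKernel k x x' * f x' := by
  obtain ⟨r, hr, hfar⟩ := exists_far_of_notMem (isClosed_tsupport f) hx
  have hrestrict (q : Eu n → ℂ) : ∫ x', q x' * f x' = ∫ x' in tsupport f, q x' * f x' :=
    (setIntegral_eq_integral_of_forall_compl_eq_zero fun x' hx' => by
      rw [image_eq_zero_of_notMem_tsupport hx', mul_zero]).symm
  rw [slicesOp, hrestrict, ← hk.integral_setIntegral_eq_of_far hn hr
    (isClosed_tsupport f).measurableSet hfar f.integrable.integrableOn]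
  simp only [hrestrict]

end Operator

end IsCZSlices

lemma IsCZKernel.mono {n : ℕ} {K : Eu n → Eu n → ℂ} {κ κ' : ℝ} (hK : IsCZKernel K κ)
    (h : κ ≤ κ') : IsCZKernel K κ' where
  size x x' hx := (hK.size x x' hx).trans (by gcongr)
  differentiable_fst := hK.differentiable_fst
  differentiable_snd := hK.differentiable_snd
  grad_fst x x' hx := (hK.grad_fst x x' hx).trans (by gcongr)
  grad_snd x x' hx := (hK.grad_snd x x' hx).trans (by gcongr)

/-- A constant, relative to the constant of the slices, for the operator they assemble to. -/
def czConst (n : ℕ) (δ : ℝ) : ℝ :=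
  max (max 1 (1 / δ + 1 / n)) (nearConst n δ (δ / 2) * (1 / (δ / 2) + 1 / n))

namespace IsCZSlices

variable {n : ℕ} {k : ℝ → Eu n → Eu n → ℂ} {B δ : ℝ}

theorem isCZOperator (hk : IsCZSlices k B δ) (hn : 0 < n) :
    IsCZOperator (slicesOp k) (slicesKernel k) (B * czConst n δ) where
  map_add := hk.slicesOp_add hn
  map_smul := slicesOp_smul
  l2_bounded := by
    obtain ⟨S, hS, hSf⟩ := exists_clm_extension_of_eLpNorm_le hk.nonneg (hk.slicesOp_add hn)
      slicesOp_smul (fun f => (hk.stronglyMeasurable_slicesOp f).aestronglyMeasurable)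
      (hk.eLpNorm_slicesOp_le hn)
    exact ⟨S, hS.trans (le_mul_of_one_le_right hk.nonneg
      ((le_max_left _ _).trans (le_max_left _ _))), hSf⟩
  kernel := (hk.isCZKernel hn).mono
    (mul_le_mul_of_nonneg_left ((le_max_right _ _).trans (le_max_left _ _)) hk.nonneg)
  off_support f x hx := ⟨hk.integrable_slicesKernel_mul_of_notMem_tsupport hn f hx,
    hk.slicesOp_eq_of_notMem_tsupport hn f hx⟩
  truncated_integrable f x ε hε := by
    rw [setOf_lt_norm_sub_eq_compl_closedBall]
    exact hk.integrableOn_slicesKernel_mul hn hε measurableSet_closedBall.compl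
      (fun x' hx' => by
        rw [← setOf_lt_norm_sub_eq_compl_closedBall] at hx'
        exact le_of_lt hx') f.integrable.integrableOn
  principal_value := by
    refine ⟨pvMultiplier k, fun ε hε x => ?_, fun f x => ?_⟩
    · refine (hk.norm_pvMultiplier_le hn hε x).trans ?_
      rw [mul_assoc]
      exact mul_le_mul_of_nonneg_left (le_max_right _ _) hk.nonneg
    · simpa only [setOf_lt_norm_sub_eq_compl_closedBall] using hk.tendsto_truncated hn f x

end IsCZSlices

section Decay

/-- `F` decays like `(1 + |u|)^(-N)`. -/
def HasDecay {E V : Type*} [Norm E] [Norm V] (F : E → V) (N : ℝ) : Prop :=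
  ∃ D, 0 ≤ D ∧ ∀ u, ‖F u‖ ≤ D * (1 + ‖u‖) ^ (-N)

variable {E V : Type*} [NormedAddCommGroup E] [NormedAddCommGroup V] {F : E → V} {N N' : ℝ}

lemma HasDecay.mono (h : HasDecay F N) (hN : N' ≤ N) : HasDecay F N' := by
  obtain ⟨D, hD, h⟩ := h
  refine ⟨D, hD, fun u => (h u).trans ?_⟩
  gcongr
  linarith [norm_nonneg u]

lemma HasDecay.exists_bound (h : HasDecay F N) (hN : 0 ≤ N) : ∃ D, 0 ≤ D ∧ ∀ u, ‖F u‖ ≤ D := by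
  obtain ⟨D, hD, h⟩ := h
  exact ⟨D, hD, fun u => (h u).trans <| mul_le_of_le_one_right hD <|
    Real.rpow_le_one_of_one_le_of_nonpos (by linarith [norm_nonneg u]) (by linarith)⟩

lemma HasDecay.integrable {n : ℕ} {F : Eu n → V} (h : HasDecay F N) (hN : (n : ℝ) < N)
    (hF : Continuous F) : Integrable F := by
  obtain ⟨D, -, h⟩ := h
  exact ((integrable_decay hN).const_mul D).mono' hF.aestronglyMeasurable (.of_forall h)

lemma decay_mul_decay_le (hN : 0 ≤ N) {y : ℝ} (hy : 0 < y) (x x' z : E) :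
    (1 + ‖z - x'‖ / y) ^ (-N) * (1 + ‖z - x‖ / y) ^ (-N) ≤
      2 ^ N * (1 + ‖x - x'‖ / y) ^ (-N) *
        ((1 + ‖z - x'‖ / y) ^ (-N) + (1 + ‖z - x‖ / y) ^ (-N)) := by
  have htri : ‖x - x'‖ / y ≤ ‖z - x'‖ / y + ‖z - x‖ / y := by
    rw [← add_div, norm_sub_rev z x, add_comm]
    gcongr
    exact norm_sub_le_norm_sub_add_norm_sub x z x'
  have hfar (t : ℝ) (ht : (1 + ‖x - x'‖ / y) / 2 ≤ t) :
      t ^ (-N) ≤ 2 ^ N * (1 + ‖x - x'‖ / y) ^ (-N) := by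
    refine (Real.rpow_le_rpow_of_nonpos (by positivity) ht (by linarith)).trans_eq ?_
    rw [Real.div_rpow (by positivity) zero_le_two, Real.rpow_neg zero_le_two, div_inv_eq_mul,
      mul_comm]
  have hx' : 0 ≤ (1 + ‖z - x'‖ / y) ^ (-N) := by positivity
  have hx : 0 ≤ (1 + ‖z - x‖ / y) ^ (-N) := by positivity
  have hxx' : 0 ≤ 2 ^ N * (1 + ‖x - x'‖ / y) ^ (-N) := by positivity
  -- the farther of `x` and `x'` from `z` is at distance at least `|x - x'| / 2`
  rcases le_total (‖z - x'‖ / y) (‖z - x‖ / y) with h | h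
  · nlinarith [hfar (1 + ‖z - x‖ / y) (by linarith)]
  · nlinarith [hfar (1 + ‖z - x'‖ / y) (by linarith)]

end Decay

section DecayProduct

variable {n : ℕ} {N y : ℝ}

lemma integrable_decay_div_sub (hN : n < N) (hy : 0 < y) (c : Eu n) :
    Integrable (fun z : Eu n => (1 + ‖z - c‖ / y) ^ (-N)) :=
  (integrable_decay_div hN hy).comp_sub_right c

lemma integral_decay_div_sub (hy : 0 < y) (c : Eu n) :
    ∫ z : Eu n, (1 + ‖z - c‖ / y) ^ (-N) = y ^ n * decayMass n N := by
  rw [← integral_decay_div hy]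
  exact integral_sub_right_eq_self (fun z : Eu n => (1 + ‖z‖ / y) ^ (-N)) c

lemma integrable_decay_mul_decay (hN : n < N) (hy : 0 < y) (x x' : Eu n) :
    Integrable (fun z : Eu n => (1 + ‖z - x'‖ / y) ^ (-N) * (1 + ‖z - x‖ / y) ^ (-N)) := by
  refine (((integrable_decay_div_sub hN hy x').add (integrable_decay_div_sub hN hy x)).const_mul
    (2 ^ N * (1 + ‖x - x'‖ / y) ^ (-N))).mono' (by fun_prop) (.of_forall fun z => ?_)
  rw [Real.norm_of_nonneg (by positivity)]
  exact decay_mul_decay_le ((Nat.cast_nonneg n).trans hN.le) hy x x' z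

lemma integral_decay_mul_decay_le (hN : n < N) (hy : 0 < y) (x x' : Eu n) :
    ∫ z : Eu n, (1 + ‖z - x'‖ / y) ^ (-N) * (1 + ‖z - x‖ / y) ^ (-N) ≤
      2 ^ N * 2 * decayMass n N * y ^ n * (1 + ‖x - x'‖ / y) ^ (-N) := by
  refine (integral_mono (integrable_decay_mul_decay hN hy x x')
    (((integrable_decay_div_sub hN hy x').add (integrable_decay_div_sub hN hy x)).const_mul
      (2 ^ N * (1 + ‖x - x'‖ / y) ^ (-N)))
    (decay_mul_decay_le ((Nat.cast_nonneg n).trans hN.le) hy x x')).trans_eq ?_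
  simp only [Pi.add_apply]
  rw [integral_const_mul, integral_add (integrable_decay_div_sub hN hy x')
    (integrable_decay_div_sub hN hy x), integral_decay_div_sub hy, integral_decay_div_sub hy]
  ring

lemma norm_integral_le_of_decay_mul_decay {V : Type*} [NormedAddCommGroup V] [NormedSpace ℝ V]
    (hN : n < N) (hy : 0 < y) {x x' : Eu n} {F : Eu n → V} {D : ℝ} (hD : 0 ≤ D)
    (hF : ∀ z, ‖F z‖ ≤ D * ((1 + ‖z - x'‖ / y) ^ (-N) * (1 + ‖z - x‖ / y) ^ (-N))) :
    ‖∫ z, F z‖ ≤ D * (2 ^ N * 2 * decayMass n N) * y ^ n * (1 + ‖x - x'‖ / y) ^ (-N) := by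
  refine (norm_integral_le_of_norm_le ((integrable_decay_mul_decay hN hy x x').const_mul D)
    (.of_forall hF)).trans ?_
  rw [integral_const_mul]
  refine (mul_le_mul_of_nonneg_left (integral_decay_mul_decay_le hN hy x x') hD).trans_eq ?_
  ring

end DecayProduct

section CompKernel

variable {n : ℕ}

/-- The scalar factor of the kernel slice at height `y`: one `2 y` from the square function and one
`y⁻ⁿ⁻¹` from each of the two gradients of `φ_y`. -/
def sliceFactor (n : ℕ) (y : ℝ) : ℝ := 2 * y * ((y ^ (n + 1))⁻¹) ^ 2

/-- The kernel slice at height `y` of a single coefficient `a`, with the entries of the two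
gradients of `φ_y` written as dilates of fixed profiles `P` and `Q`. -/
def compKernel (a : Eu n → ℝ → ℂ) (P Q : Eu n → ℂ) (y : ℝ) (x x' : Eu n) : ℂ :=
  (sliceFactor n y : ℂ) * ∫ z, a z y * (P (y⁻¹ • (z - x')) * Q (y⁻¹ • (z - x)))

variable {a : Eu n → ℝ → ℂ} {P Q : Eu n → ℂ} {M N δ y : ℝ}

lemma sliceFactor_nonneg (hy : 0 < y) : 0 ≤ sliceFactor n y := by
  unfold sliceFactor
  positivity

lemma norm_sliceFactor (hy : 0 < y) : ‖(sliceFactor n y : ℂ)‖ = sliceFactor n y := by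
  rw [Complex.norm_real, Real.norm_of_nonneg (sliceFactor_nonneg hy)]

lemma sliceFactor_mul_pow (hy : 0 < y) : sliceFactor n y * y ^ n = 2 * y ^ (-(n : ℝ) - 1) := by
  rw [sliceFactor, Real.rpow_sub_one hy.ne', Real.rpow_neg hy.le, Real.rpow_natCast]
  field_simp
  ring

lemma sliceFactor_mul_inv_mul_pow (hy : 0 < y) :
    sliceFactor n y * y⁻¹ * y ^ n = 2 * y ^ (-((n : ℝ) + 1) - 1) := by
  rw [mul_right_comm, sliceFactor_mul_pow hy, mul_assoc, ← Real.rpow_neg_one, ← Real.rpow_add hy]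
  ring_nf

lemma compKernel_swap (a : Eu n → ℝ → ℂ) (P Q : Eu n → ℂ) (y : ℝ) (x x' : Eu n) :
    compKernel a P Q y x x' = compKernel a Q P y x' x := by
  unfold compKernel
  simp only [mul_comm (P _)]

lemma measurable_compKernel (ha : Measurable (fun p : Eu n × ℝ => a p.1 p.2))
    (hP : Continuous P) (hQ : Continuous Q) :
    Measurable (fun p : ℝ × Eu n × Eu n => compKernel a P Q p.1 p.2.1 p.2.2) := by
  have ha' : Measurable (fun q : (ℝ × Eu n × Eu n) × Eu n => a q.2 q.1.1) :=
    ha.comp (f := fun q : (ℝ × Eu n × Eu n) × Eu n => (q.2, q.1.1)) (by fun_prop)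
  unfold compKernel sliceFactor
  refine Measurable.mul (by fun_prop) (StronglyMeasurable.measurable ?_)
  refine StronglyMeasurable.integral_prod_right (f := fun (p : ℝ × Eu n × Eu n) z =>
    a z p.1 * (P (p.1⁻¹ • (z - p.2.2)) * Q (p.1⁻¹ • (z - p.2.1)))) ?_
  exact (ha'.mul ((hP.measurable.comp (by fun_prop)).mul
    (hQ.measurable.comp (by fun_prop)))).stronglyMeasurable

lemma norm_compKernel_integrand_le (ha : ∀ x y, ‖a x y‖ ≤ M) {D D' : ℝ} (hD : 0 ≤ D)
    (hP : ∀ u, ‖P u‖ ≤ D * (1 + ‖u‖) ^ (-N)) (hQ : ∀ u, ‖Q u‖ ≤ D' * (1 + ‖u‖) ^ (-N))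
    (hy : 0 < y) (x x' z : Eu n) :
    ‖a z y * (P (y⁻¹ • (z - x')) * Q (y⁻¹ • (z - x)))‖ ≤
      (M * (D * D')) * ((1 + ‖z - x'‖ / y) ^ (-N) * (1 + ‖z - x‖ / y) ^ (-N)) := by
  have hM : 0 ≤ M := (norm_nonneg _).trans (ha 0 0)
  have haz := ha z y
  have hPz := hP (y⁻¹ • (z - x'))
  have hQz := hQ (y⁻¹ • (z - x))
  rw [norm_inv_smul hy] at hPz hQz
  rw [norm_mul, norm_mul]
  calc _ ≤ M * ((D * (1 + ‖z - x'‖ / y) ^ (-N)) * (D' * (1 + ‖z - x‖ / y) ^ (-N))) := by gcongr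
    _ = _ := by ring

lemma aestronglyMeasurable_compKernel_integrand
    (hm : Measurable (fun p : Eu n × ℝ => a p.1 p.2)) (hP : Continuous P)
    (hQ : Continuous Q) (y : ℝ) (x x' : Eu n) :
    AEStronglyMeasurable (fun z => a z y * (P (y⁻¹ • (z - x')) * Q (y⁻¹ • (z - x)))) :=
  (hm.comp (f := fun z => (z, y)) (by fun_prop)).aestronglyMeasurable.mul (by fun_prop)

lemma integrable_compKernel_integrand (hm : Measurable (fun p : Eu n × ℝ => a p.1 p.2))
    (ha : ∀ x y, ‖a x y‖ ≤ M) (hN : (n : ℝ) < N) (hP : HasDecay P N) (hQ : HasDecay Q N)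
    (hPc : Continuous P) (hQc : Continuous Q) (hy : 0 < y) (x x' : Eu n) :
    Integrable (fun z => a z y * (P (y⁻¹ • (z - x')) * Q (y⁻¹ • (z - x)))) := by
  obtain ⟨D, hD, hP⟩ := hP
  obtain ⟨D', -, hQ⟩ := hQ
  exact ((integrable_decay_mul_decay hN hy x x').const_mul (M * (D * D'))).mono'
    (aestronglyMeasurable_compKernel_integrand hm hPc hQc y x x')
    (.of_forall fun z => norm_compKernel_integrand_le ha hD hP hQ hy x x' z)

lemma norm_compKernel_le (hy : 0 < y) (x x' : Eu n) : ‖compKernel a P Q y x x'‖ ≤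
    sliceFactor n y * ∫ z, ‖a z y * (P (y⁻¹ • (z - x')) * Q (y⁻¹ • (z - x)))‖ := by
  rw [compKernel, norm_mul, norm_sliceFactor hy]
  exact mul_le_mul_of_nonneg_left (norm_integral_le_integral_norm _) (sliceFactor_nonneg hy)

lemma exists_integral_norm_compKernel_integrand_le (hδ : 0 < δ) (hP : HasDecay P (n + δ))
    (hQ : HasDecay Q (n + δ)) :
    ∃ C, 0 ≤ C ∧ ∀ (a : Eu n → ℝ → ℂ) (M : ℝ), (∀ x y, ‖a x y‖ ≤ M) → ∀ y, 0 < y → ∀ x x',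
      sliceFactor n y * ∫ z, ‖a z y * (P (y⁻¹ • (z - x')) * Q (y⁻¹ • (z - x)))‖ ≤
        C * M * sliceWeight n δ ‖x - x'‖ y := by
  obtain ⟨D, hD, hP⟩ := hP
  obtain ⟨D', hD', hQ⟩ := hQ
  have hI := decayMass_nonneg n (n + δ)
  refine ⟨2 * (D * D') * (2 ^ (n + δ) * 2 * decayMass n (n + δ)), by positivity,
    fun a M ha y hy x x' => ?_⟩
  have hM : 0 ≤ M := (norm_nonneg _).trans (ha 0 0)
  have hint := norm_integral_le_of_decay_mul_decay (N := n + δ) (by linarith) hy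
    (D := M * (D * D')) (by positivity) fun z =>
      (norm_norm _).trans_le (norm_compKernel_integrand_le ha hD hP hQ hy x x' z)
  rw [Real.norm_of_nonneg (integral_nonneg fun z => norm_nonneg _)] at hint
  refine (mul_le_mul_of_nonneg_left hint (sliceFactor_nonneg hy)).trans_eq ?_
  rw [sliceWeight]
  linear_combination (M * (D * D') * (2 ^ (n + δ) * 2 * decayMass n (n + δ)) *
    (1 + ‖x - x'‖ / y) ^ (-(n + δ))) * sliceFactor_mul_pow (n := n) hy

lemma integrable_dilate {V : Type*} [NormedAddCommGroup V] {P : Eu n → V} (hP : Integrable P)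
    (hy : 0 < y) : Integrable (fun u => P (y⁻¹ • u)) :=
  hP.comp_smul (inv_ne_zero hy.ne')

lemma integral_dilate_eq_zero (hP : ∫ u, P u = 0) (hy : 0 < y) (z : Eu n) :
    ∫ x', P (y⁻¹ • (z - x')) = 0 := by
  rw [integral_sub_left_eq_self (fun u => P (y⁻¹ • u)) volume z,
    Measure.integral_comp_inv_smul_of_nonneg volume P hy.le, hP, smul_zero]

lemma integrable_prod_dilate {h g : Eu n → ℂ} (hP : Integrable P) (hh : Integrable h)
    (hg : AEStronglyMeasurable g) {D : ℝ} (hgD : ∀ x, ‖g x‖ ≤ D) (hy : 0 < y) :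
    Integrable (fun p : Eu n × Eu n => h p.2 * (P (y⁻¹ • (p.2 - p.1)) * g p.1))
      (volume.prod volume) := by
  have hconv := Integrable.convolution_integrand (ContinuousLinearMap.mul ℂ ℂ) hh
    (integrable_dilate hP hy).comp_neg (μ := volume)
  simp only [neg_sub] at hconv
  refine (hconv.mul_bdd hg.comp_fst (.of_forall fun p => hgD p.1)).congr (.of_forall fun p => ?_)
  simp [mul_assoc]

lemma integral_compKernel_eq_zero (hm : Measurable (fun p : Eu n × ℝ => a p.1 p.2))
    (ha : ∀ x y, ‖a x y‖ ≤ M) (hP : Integrable P) (hQ : Integrable Q) (hP0 : ∫ u, P u = 0)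
    (hy : 0 < y) (x : Eu n) : ∫ x', compKernel a P Q y x x' = 0 := by
  have hint : Integrable (fun z => a z y * Q (y⁻¹ • (z - x))) :=
    ((integrable_dilate hQ hy).comp_sub_right x).bdd_mul
      (hm.comp (f := fun z => (z, y)) (by fun_prop)).aestronglyMeasurable
      (.of_forall fun z => ha z y)
  have hprod := integrable_prod_dilate hP hint (g := fun _ => 1) aestronglyMeasurable_const
    (D := 1) (by simp) hy
  have hcomm (x' z : Eu n) : a z y * (P (y⁻¹ • (z - x')) * Q (y⁻¹ • (z - x))) =
      a z y * Q (y⁻¹ • (z - x)) * (P (y⁻¹ • (z - x')) * 1) := by ring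
  simp only [compKernel, integral_const_mul, hcomm]
  rw [integral_integral_swap hprod]
  simp only [mul_one, integral_const_mul, integral_dilate_eq_zero hP0 hy, mul_zero, integral_zero]

end CompKernel

section Gradient

variable {n : ℕ} {a : Eu n → ℝ → ℂ} {P Q : Eu n → ℂ} {M δ y : ℝ}

/-- The gradient bounds in both variables for the slices `compKernel a P Q`, uniformly over the
coefficients `a` that satisfy `R`. -/
def HasGradBound (R : (Eu n → ℝ → ℂ) → Prop) (P Q : Eu n → ℂ) (δ : ℝ) : Prop :=
  ∃ C, 0 ≤ C ∧ ∀ (a : Eu n → ℝ → ℂ) (M : ℝ), R a → Measurable (fun p : Eu n × ℝ => a p.1 p.2) →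
    (∀ x y, ‖a x y‖ ≤ M) → ∀ y, 0 < y → ∀ x x',
      DifferentiableAt ℝ (fun z => compKernel a P Q y z x') x ∧
      ‖fderiv ℝ (fun z => compKernel a P Q y z x') x‖ ≤
        C * M * sliceWeight (n + 1) δ ‖x - x'‖ y ∧
      DifferentiableAt ℝ (fun z => compKernel a P Q y x z) x' ∧
      ‖fderiv ℝ (fun z => compKernel a P Q y x z) x'‖ ≤
        C * M * sliceWeight (n + 1) δ ‖x - x'‖ y

lemma hasFDerivAt_dilate_sub_left {E F : Type*} [NormedAddCommGroup E] [NormedSpace ℝ E]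
    [NormedAddCommGroup F] [NormedSpace ℝ F] {Q : E → F} (hQ : Differentiable ℝ Q) (y : ℝ)
    (w z : E) :
    HasFDerivAt (fun z => Q (y⁻¹ • (w - z))) (-(y⁻¹ • fderiv ℝ Q (y⁻¹ • (w - z)))) z := by
  refine ((hQ _).hasFDerivAt.comp z
    (((hasFDerivAt_id z).const_sub w).const_smul y⁻¹)).congr_fderiv ?_
  ext v
  simp

lemma hasFDerivAt_dilate_sub_right {E F : Type*} [NormedAddCommGroup E] [NormedSpace ℝ E]
    [NormedAddCommGroup F] [NormedSpace ℝ F] {Q : E → F} (hQ : Differentiable ℝ Q) (y : ℝ)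
    (w z : E) :
    HasFDerivAt (fun z => Q (y⁻¹ • (z - w))) (y⁻¹ • fderiv ℝ Q (y⁻¹ • (z - w))) z := by
  refine ((hQ _).hasFDerivAt.comp z
    (((hasFDerivAt_id z).sub_const w).const_smul y⁻¹)).congr_fderiv ?_
  ext v
  simp

/-- The derivative in `z` of the integrand of `compKernel a P Q y z x'`. -/
def compKernelDeriv (a : Eu n → ℝ → ℂ) (P Q : Eu n → ℂ) (y : ℝ) (x' z w : Eu n) : Eu n →L[ℝ] ℂ :=
  (a w y * P (y⁻¹ • (w - x'))) • (-(y⁻¹ • fderiv ℝ Q (y⁻¹ • (w - z))))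

lemma norm_compKernelDeriv (hy : 0 < y) (x' z w : Eu n) : ‖compKernelDeriv a P Q y x' z w‖ =
    ‖a w y‖ * ‖P (y⁻¹ • (w - x'))‖ * (y⁻¹ * ‖fderiv ℝ Q (y⁻¹ • (w - z))‖) := by
  simp only [compKernelDeriv, norm_smul, norm_neg, norm_mul, norm_inv, Real.norm_of_nonneg hy.le]

lemma aestronglyMeasurable_compKernelDeriv (hm : Measurable (fun p : Eu n × ℝ => a p.1 p.2))
    (hP : Continuous P) (x' z : Eu n) :
    AEStronglyMeasurable (compKernelDeriv a P Q y x' z) := by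
  have hcoeff : AEStronglyMeasurable (fun w => a w y * P (y⁻¹ • (w - x'))) :=
    (hm.comp (f := fun w => (w, y)) (by fun_prop)).aestronglyMeasurable.mul (by fun_prop)
  have hderiv : Measurable (fun w => -(y⁻¹ • fderiv ℝ Q (y⁻¹ • (w - z)))) :=
    (((measurable_fderiv ℝ Q).comp (f := fun w => y⁻¹ • (w - z)) (by fun_prop)).const_smul y⁻¹).neg
  exact hcoeff.smul hderiv.aestronglyMeasurable

lemma hasFDerivAt_compKernel_fst (hm : Measurable (fun p : Eu n × ℝ => a p.1 p.2))
    (ha : ∀ x y, ‖a x y‖ ≤ M) {N : ℝ} (hN : n < N) (hPc : Continuous P) (hP : HasDecay P N)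
    (hQd : Differentiable ℝ Q) (hQ : HasDecay Q N) (hQ' : HasDecay (fderiv ℝ Q) N)
    (hy : 0 < y) (x x' : Eu n) :
    HasFDerivAt (fun z => compKernel a P Q y z x')
      ((sliceFactor n y : ℂ) • ∫ w, compKernelDeriv a P Q y x' x w) x := by
  have hM : 0 ≤ M := (norm_nonneg _).trans (ha 0 0)
  obtain ⟨S, -, hS⟩ := hQ'.exists_bound ((Nat.cast_nonneg n).trans hN.le)
  refine HasFDerivAt.const_mul (hasFDerivAt_integral_of_dominated_of_fderiv_le
    (F' := compKernelDeriv a P Q y x')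
    (bound := fun w => M * ‖P (y⁻¹ • (w - x'))‖ * (y⁻¹ * S)) univ_mem
    (.of_forall fun z => aestronglyMeasurable_compKernel_integrand hm hPc hQd.continuous y z x')
    (integrable_compKernel_integrand hm ha hN hP hQ hPc hQd.continuous hy x x')
    (aestronglyMeasurable_compKernelDeriv hm hPc x' x) (.of_forall fun w z _ => ?_)
    ((((integrable_dilate (hP.integrable hN hPc) hy).comp_sub_right x').norm.const_mul
      M).mul_const _)
    (.of_forall fun w z _ => ?_)) _
  · rw [norm_compKernelDeriv hy]
    gcongr
    exacts [ha w y, hS _]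
  · simp only [← mul_assoc]
    exact (hasFDerivAt_dilate_sub_left hQd y w z).const_mul (a w y * P (y⁻¹ • (w - x')))

lemma exists_norm_fderiv_compKernel_fst_le (hδ : 0 < δ)
    (hPc : Continuous P) (hP : HasDecay P (n + 1 + δ)) (hQd : Differentiable ℝ Q)
    (hQ : HasDecay Q (n + 1 + δ)) (hQ' : HasDecay (fderiv ℝ Q) (n + 1 + δ)) :
    ∃ C, 0 ≤ C ∧ ∀ (a : Eu n → ℝ → ℂ) (M : ℝ), Measurable (fun p : Eu n × ℝ => a p.1 p.2) →
      (∀ x y, ‖a x y‖ ≤ M) → ∀ y, 0 < y → ∀ x x',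
      ‖fderiv ℝ (fun z => compKernel a P Q y z x') x‖ ≤
        C * M * sliceWeight (n + 1) δ ‖x - x'‖ y := by
  have hN : (n : ℝ) < n + 1 + δ := by linarith
  obtain ⟨D, hD, hPD⟩ := id hP
  obtain ⟨D', hD', hQD⟩ := id hQ'
  have hI := decayMass_nonneg n (n + 1 + δ)
  refine ⟨2 * (D * D') * (2 ^ (n + 1 + δ) * 2 * decayMass n (n + 1 + δ)), by positivity,
    fun a M hm ha y hy x x' => ?_⟩
  have hM : 0 ≤ M := (norm_nonneg _).trans (ha 0 0)
  rw [(hasFDerivAt_compKernel_fst hm ha hN hPc hP hQd hQ hQ' hy x x').fderiv, norm_smul,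
    norm_sliceFactor hy]
  have hint := norm_integral_le_of_decay_mul_decay hN hy (D := M * (D * D') * y⁻¹) (by positivity)
    (x := x) (x' := x') (F := compKernelDeriv a P Q y x' x) fun w => by
      have haw := ha w y
      have hPw := hPD (y⁻¹ • (w - x'))
      have hQw := hQD (y⁻¹ • (w - x))
      rw [norm_inv_smul hy] at hPw hQw
      rw [norm_compKernelDeriv hy]
      calc _ ≤ M * (D * (1 + ‖w - x'‖ / y) ^ (-((n : ℝ) + 1 + δ))) *
            (y⁻¹ * (D' * (1 + ‖w - x‖ / y) ^ (-((n : ℝ) + 1 + δ)))) := by gcongr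
        _ = _ := by ring
  refine (mul_le_mul_of_nonneg_left hint (sliceFactor_nonneg hy)).trans_eq ?_
  rw [sliceWeight]
  linear_combination (M * (D * D') * (2 ^ (n + 1 + δ) * 2 * decayMass n (n + 1 + δ)) *
    (1 + ‖x - x'‖ / y) ^ (-(n + 1 + δ))) * sliceFactor_mul_inv_mul_pow (n := n) hy

lemma hasGradBound_of_decay (hδ : 0 < δ) (hPd : Differentiable ℝ P)
    (hP : HasDecay P (n + 1 + δ)) (hP' : HasDecay (fderiv ℝ P) (n + 1 + δ))
    (hQd : Differentiable ℝ Q) (hQ : HasDecay Q (n + 1 + δ))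
    (hQ' : HasDecay (fderiv ℝ Q) (n + 1 + δ)) :
    HasGradBound (fun _ => True) P Q δ := by
  have hN : (n : ℝ) < n + 1 + δ := by linarith
  obtain ⟨C₁, hC₁, h₁⟩ :=
    exists_norm_fderiv_compKernel_fst_le hδ hPd.continuous hP hQd hQ hQ'
  obtain ⟨C₂, hC₂, h₂⟩ :=
    exists_norm_fderiv_compKernel_fst_le hδ hQd.continuous hQ hPd hP hP'
  refine ⟨C₁ + C₂, by positivity, fun a M _ hm ha y hy x x' => ?_⟩
  have hM : 0 ≤ M := (norm_nonneg _).trans (ha 0 0)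
  have hw := sliceWeight_nonneg (m := n + 1) (δ := δ) (norm_nonneg (x - x')) hy
  have hswap : (fun z => compKernel a P Q y x z) = fun z => compKernel a Q P y z x :=
    funext fun z => compKernel_swap a P Q y x z
  rw [hswap]
  refine ⟨(hasFDerivAt_compKernel_fst hm ha hN hPd.continuous hP hQd hQ hQ' hy
      x x').differentiableAt, (h₁ a M hm ha y hy x x').trans ?_,
    (hasFDerivAt_compKernel_fst hm ha hN hQd.continuous hQ hPd hP hP' hy
      x' x).differentiableAt, (h₂ a M hm ha y hy x' x).trans ?_⟩
  · gcongr
    linarith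
  · rw [norm_sub_rev x' x]
    gcongr
    linarith

/-- The correlation of two profiles, to which a slice with an `x`-independent coefficient
reduces. -/
def correlation (P Q : Eu n → ℂ) (u : Eu n) : ℂ := ∫ w, P (w + u) * Q w

lemma compKernel_eq_correlation (ha : ∀ x x' y, a x y = a x' y) (P Q : Eu n → ℂ) (hy : 0 < y)
    (x x' : Eu n) : compKernel a P Q y x x' =
      ((sliceFactor n y * y ^ n : ℝ) : ℂ) * a 0 y * correlation P Q (y⁻¹ • (x - x')) := by
  have hint : ∫ z, P (y⁻¹ • (z - x')) * Q (y⁻¹ • (z - x)) =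
      (y ^ n : ℝ) * correlation P Q (y⁻¹ • (x - x')) := by
    have hshift (z : Eu n) : P (y⁻¹ • (z - x')) * Q (y⁻¹ • (z - x)) =
        (fun w => P (y⁻¹ • w + y⁻¹ • (x - x')) * Q (y⁻¹ • w)) (z - x) := by
      simp only [← smul_add, sub_add_sub_cancel]
    simp only [hshift]
    rw [integral_sub_right_eq_self (fun w => P (y⁻¹ • w + y⁻¹ • (x - x')) * Q (y⁻¹ • w)) x,
      Measure.integral_comp_inv_smul_of_nonneg volume
        (fun w : Eu n => P (w + y⁻¹ • (x - x')) * Q w) hy.le]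
    simp [correlation]
  rw [compKernel]
  simp only [ha _ 0 y, integral_const_mul, hint]
  push_cast
  ring

lemma norm_correlation_deriv_le {D : ℝ}
    (hG : ∀ u, ‖fderiv ℝ (correlation P Q) u‖ ≤ D * (1 + ‖u‖) ^ (-(n + 1 + δ)))
    (ha : ∀ x y, ‖a x y‖ ≤ M) (hy : 0 < y) (x x' : Eu n) {L : Eu n →L[ℝ] ℂ}
    (hL : ‖L‖ = y⁻¹ * ‖fderiv ℝ (correlation P Q) (y⁻¹ • (x - x'))‖) :
    ‖(((sliceFactor n y * y ^ n : ℝ) : ℂ) * a 0 y) • L‖ ≤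
      2 * D * M * sliceWeight (n + 1) δ ‖x - x'‖ y := by
  have hM : 0 ≤ M := (norm_nonneg _).trans (ha 0 0)
  have hf := sliceFactor_nonneg (n := n) hy
  have hu := hG (y⁻¹ • (x - x'))
  have ha0 := ha 0 y
  rw [norm_inv_smul hy] at hu
  rw [norm_smul, hL, norm_mul, Complex.norm_real, Real.norm_of_nonneg (by positivity)]
  calc _ ≤ sliceFactor n y * y ^ n * M *
        (y⁻¹ * (D * (1 + ‖x - x'‖ / y) ^ (-((n : ℝ) + 1 + δ)))) := by gcongr
    _ = _ := by
      rw [sliceWeight]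
      linear_combination (M * D * (1 + ‖x - x'‖ / y) ^ (-((n : ℝ) + 1 + δ))) *
        sliceFactor_mul_inv_mul_pow (n := n) hy

lemma hasGradBound_of_correlation (hG : Differentiable ℝ (correlation P Q))
    (hG' : HasDecay (fderiv ℝ (correlation P Q)) (n + 1 + δ)) :
    HasGradBound (fun a => ∀ x x' y, a x y = a x' y) P Q δ := by
  obtain ⟨D, hD, hG'⟩ := hG'
  refine ⟨2 * D, by positivity, fun a M hR _ ha y hy x x' => ?_⟩
  have hy' : ‖y⁻¹‖ = y⁻¹ := Real.norm_of_nonneg (by positivity)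
  have hfst := (hasFDerivAt_dilate_sub_right hG y x' x).const_mul
    (((sliceFactor n y * y ^ n : ℝ) : ℂ) * a 0 y)
  have hsnd := (hasFDerivAt_dilate_sub_left hG y x x').const_mul
    (((sliceFactor n y * y ^ n : ℝ) : ℂ) * a 0 y)
  simp only [compKernel_eq_correlation hR P Q hy]
  refine ⟨hfst.differentiableAt, ?_, hsnd.differentiableAt, ?_⟩
  · rw [hfst.fderiv]
    exact norm_correlation_deriv_le hG' ha hy x x' (by rw [norm_smul, hy'])
  · rw [hsnd.fderiv]
    exact norm_correlation_deriv_le hG' ha hy x x' (by rw [norm_neg, norm_smul, hy'])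

end Gradient

section Plancherel

open FourierTransform

variable {V : Type*} [NormedAddCommGroup V] [InnerProductSpace ℝ V] [FiniteDimensional ℝ V]
  [MeasurableSpace V] [BorelSpace V] {f g : V → ℂ}

lemma integral_fourier_mul_eq (hf : Integrable f) (hg : Integrable g) :
    ∫ ξ, 𝓕 f ξ * g ξ = ∫ x, f x * 𝓕 g x := by
  have h := VectorFourier.integral_fourierIntegral_smul_eq_flip (μ := volume) (ν := volume)
    (L := innerₗ V) Real.continuous_fourierChar continuous_inner hf hg
  rwa [flip_innerₗ] at h

lemma continuous_fourier (hf : Integrable f) : Continuous (𝓕 f) :=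
  VectorFourier.fourierIntegral_continuous (L := innerₗ V) Real.continuous_fourierChar
    continuous_inner hf

lemma norm_fourier_le (f : V → ℂ) (ξ : V) : ‖𝓕 f ξ‖ ≤ ∫ x, ‖f x‖ :=
  VectorFourier.norm_fourierIntegral_le_integral_norm _ _ _ _ _

lemma fourier_toLp_ae_eq (hf : Integrable f) (hf2 : MemLp f 2 volume) :
    (𝓕 hf2.toLp : Lp ℂ 2 (volume : Measure V)) =ᵐ[volume] 𝓕 f := by
  set F : Lp ℂ 2 (volume : Measure V) := 𝓕 hf2.toLp
  refine ae_eq_of_integral_contDiff_smul_eq ((Lp.memLp F).locallyIntegrable (by norm_num))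
    (continuous_fourier hf).locallyIntegrable fun g hg hgs => ?_
  have hgs' : HasCompactSupport (⇑Complex.ofRealCLM ∘ g) := hgs.comp_left (by simp)
  set G : 𝓢(V, ℂ) := hgs'.toSchwartzMap (Complex.ofRealCLM.contDiff.comp hg)
  have hG : ∀ x, G x = (g x : ℂ) := fun _ => rfl
  have hdual : ∫ x, (𝓕 G) x • hf2.toLp f x = ∫ x, G x • F x := by
    rw [← Lp.toTemperedDistribution_apply, ← Lp.toTemperedDistribution_apply,
      ← TemperedDistribution.fourier_apply, Lp.fourier_toTemperedDistribution_eq]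
  calc ∫ x, g x • F x
      = ∫ x, G x • F x := by simp only [hG, smul_eq_mul, Complex.real_smul]
    _ = ∫ x, 𝓕 (G : V → ℂ) x * f x := by
      rw [← hdual]
      refine integral_congr_ae ?_
      filter_upwards [hf2.coeFn_toLp] with x hx
      rw [hx, smul_eq_mul, SchwartzMap.fourier_coe]
    _ = ∫ x, g x • 𝓕 f x := by
      simp only [integral_fourier_mul_eq G.integrable hf, hG, Complex.real_smul]

lemma eLpNorm_fourier (hf : Integrable f) (hf2 : MemLp f 2 volume) :
    eLpNorm (𝓕 f) 2 volume = eLpNorm f 2 volume := by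
  have h : ‖(𝓕 hf2.toLp : Lp ℂ 2 (volume : Measure V))‖ = ‖hf2.toLp‖ := Lp.norm_fourier_eq _
  rw [Lp.norm_def, Lp.norm_def,
    ENNReal.toReal_eq_toReal_iff' (Lp.eLpNorm_ne_top _) (Lp.eLpNorm_ne_top _)] at h
  rwa [eLpNorm_congr_ae (fourier_toLp_ae_eq hf hf2), eLpNorm_congr_ae hf2.coeFn_toLp] at h

end Plancherel

section SquareFunction

open FourierTransform

lemma multiplier_zero_eq_zero {V : Type*} [NormedAddCommGroup V] {m : V → ℂ} {δ D : ℝ}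
    (hδ : 0 < δ) (hm : ∀ ξ, ‖m ξ‖ ≤ D * (‖ξ‖ ^ (δ / 2) * (1 + ‖ξ‖) ^ (-δ))) : m 0 = 0 := by
  have h0 := hm 0
  rw [norm_zero, Real.zero_rpow (by positivity), zero_mul, mul_zero] at h0
  exact norm_le_zero_iff.1 h0

lemma norm_sq_multiplier_le {V : Type*} [NormedAddCommGroup V] {m : V → ℂ} {δ D : ℝ}
    (hm : ∀ ξ, ‖m ξ‖ ≤ D * (‖ξ‖ ^ (δ / 2) * (1 + ‖ξ‖) ^ (-δ))) (ξ : V) :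
    ‖m ξ‖ ^ 2 ≤ D ^ 2 * (‖ξ‖ ^ δ * (1 + ‖ξ‖) ^ (-(2 * δ))) :=
  calc ‖m ξ‖ ^ 2 ≤ (D * (‖ξ‖ ^ (δ / 2) * (1 + ‖ξ‖) ^ (-δ))) ^ 2 := by gcongr; exact hm ξ
    _ = D ^ 2 * (‖ξ‖ ^ δ * (1 + ‖ξ‖) ^ (-(2 * δ))) := by
      rw [mul_pow, mul_pow, ← Real.rpow_mul_natCast (norm_nonneg ξ),
        ← Real.rpow_mul_natCast (by positivity)]
      ring_nf

lemma inv_mul_norm_sq_multiplier_le {V : Type*} [NormedAddCommGroup V] [NormedSpace ℝ V]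
    {m : V → ℂ} {δ D : ℝ} (hδ : 0 < δ)
    (hm : ∀ ξ, ‖m ξ‖ ≤ D * (‖ξ‖ ^ (δ / 2) * (1 + ‖ξ‖) ^ (-δ))) {ξ : V} (hξ : ξ ≠ 0) {y : ℝ}
    (hy : 0 < y) : y⁻¹ * ‖m (y • ξ)‖ ^ 2 ≤ D ^ 2 * scaleWeight ‖ξ‖⁻¹ δ δ y := by
  have hs : 0 < ‖ξ‖ := norm_pos_iff.2 hξ
  have ht : 0 < y * ‖ξ‖ := by positivity
  have h := norm_sq_multiplier_le hm (y • ξ)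
  rw [norm_smul, Real.norm_of_nonneg hy.le] at h
  refine (mul_le_mul_of_nonneg_left h (by positivity)).trans ?_
  rw [mul_left_comm]
  gcongr
  rcases le_or_gt y ‖ξ‖⁻¹ with hle | hlt
  · calc y⁻¹ * ((y * ‖ξ‖) ^ δ * (1 + y * ‖ξ‖) ^ (-(2 * δ)))
        ≤ y⁻¹ * ((y * ‖ξ‖) ^ δ * 1) := by
          gcongr
          exact Real.rpow_le_one_of_one_le_of_nonpos (by linarith) (by linarith)
      _ = scaleWeight ‖ξ‖⁻¹ δ δ y := by
          rw [scaleWeight_of_le hle, Real.mul_rpow hy.le hs.le, Real.rpow_sub_one hy.ne',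
            Real.inv_rpow hs.le, Real.rpow_neg hs.le]
          field_simp
  · calc y⁻¹ * ((y * ‖ξ‖) ^ δ * (1 + y * ‖ξ‖) ^ (-(2 * δ)))
        ≤ y⁻¹ * ((y * ‖ξ‖) ^ δ * (y * ‖ξ‖) ^ (-(2 * δ))) := by
          gcongr y⁻¹ * (_ * ?_)
          exact Real.rpow_le_rpow_of_nonpos ht (by linarith) (by linarith)
      _ = scaleWeight ‖ξ‖⁻¹ δ δ y := by
          rw [← Real.rpow_add ht, show δ + -(2 * δ) = -δ by ring, scaleWeight_of_lt hlt,
            Real.mul_rpow hy.le hs.le, Real.rpow_sub_one hy.ne', Real.inv_rpow hs.le,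
            Real.rpow_neg hs.le]
          field_simp

lemma lintegral_multiplier_le {V : Type*} [NormedAddCommGroup V] [NormedSpace ℝ V]
    {m : V → ℂ} {δ D : ℝ} (hδ : 0 < δ)
    (hm : ∀ ξ, ‖m ξ‖ ≤ D * (‖ξ‖ ^ (δ / 2) * (1 + ‖ξ‖) ^ (-δ))) (ξ : V) :
    ∫⁻ y in Ioi (0 : ℝ), ENNReal.ofReal y⁻¹ * ‖m (y • ξ)‖ₑ ^ 2 ≤
      ENNReal.ofReal (D ^ 2 * (1 / δ + 1 / δ)) := by
  rcases eq_or_ne ξ 0 with rfl | hξ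
  · simp [multiplier_zero_eq_zero hδ hm]
  have hs : 0 < ‖ξ‖⁻¹ := inv_pos.2 (norm_pos_iff.2 hξ)
  rw [← integral_scaleWeight hδ hδ hs, ← integral_const_mul,
    ofReal_integral_eq_lintegral_ofReal ((integrableOn_scaleWeight hδ hδ hs).const_mul _)]
  · refine setLIntegral_mono' measurableSet_Ioi fun y hy => ?_
    rw [← ofReal_norm, ← ENNReal.ofReal_pow (norm_nonneg _),
      ← ENNReal.ofReal_mul (inv_nonneg.2 (le_of_lt hy))]
    exact ENNReal.ofReal_le_ofReal (inv_mul_norm_sq_multiplier_le hδ hm hξ hy)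
  · filter_upwards [ae_restrict_mem measurableSet_Ioi] with y hy
    exact mul_nonneg (sq_nonneg D) (scaleWeight_nonneg hs hy)

variable {n : ℕ} {P Q f g : Eu n → ℂ} {δ D y : ℝ}

/-- A profile: a continuous function with `n + δ` orders of decay whose Fourier transform vanishes
at the origin and at infinity to the order `δ / 2`. -/
structure IsProfile (P : Eu n → ℂ) (δ : ℝ) : Prop where
  continuous : Continuous P
  decay : HasDecay P (n + δ)
  fourier : ∃ D, 0 ≤ D ∧ ∀ ξ, ‖𝓕 P ξ‖ ≤ D * (‖ξ‖ ^ (δ / 2) * (1 + ‖ξ‖) ^ (-δ))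

lemma IsProfile.integrable (hP : IsProfile P δ) (hδ : 0 < δ) : Integrable P :=
  hP.decay.integrable (by linarith) hP.continuous

lemma IsProfile.integral_eq_zero (hP : IsProfile P δ) (hδ : 0 < δ) : ∫ u, P u = 0 := by
  obtain ⟨D, -, h⟩ := hP.fourier
  have h0 := multiplier_zero_eq_zero hδ h
  rw [Real.fourier_eq] at h0
  simpa using h0

/-- The unnormalised convolution of `f` with the dilate of the profile `P` to scale `y`. -/
def profConv (P f : Eu n → ℂ) (y : ℝ) (z : Eu n) : ℂ := ∫ x', P (y⁻¹ • (z - x')) * f x'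

lemma profConv_eq_convolution (P f : Eu n → ℂ) (y : ℝ) :
    profConv P f y =
      MeasureTheory.convolution f (fun u => P (y⁻¹ • u)) (ContinuousLinearMap.mul ℂ ℂ) volume := by
  funext z
  simp only [profConv, convolution_def, ContinuousLinearMap.mul_apply', mul_comm]

lemma fourier_dilate (P : Eu n → ℂ) (hy : 0 < y) (ξ : Eu n) :
    𝓕 (fun u => P (y⁻¹ • u)) ξ = ((y ^ n : ℝ) : ℂ) * 𝓕 P (y • ξ) := by
  have h := Measure.integral_comp_inv_smul_of_nonneg volume
    (fun w : Eu n => Real.fourierChar (-inner ℝ w (y • ξ)) • P w) hy.le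
  rw [finrank_euclideanSpace_fin] at h
  rw [Real.fourier_eq, Real.fourier_eq, ← Complex.real_smul, ← h]
  simp only [real_inner_smul_left, real_inner_smul_right, mul_inv_cancel_left₀ hy.ne']

lemma fourier_profConv (hP : Integrable P) (hf : Integrable f) (hy : 0 < y) (ξ : Eu n) :
    𝓕 (profConv P f y) ξ = 𝓕 f ξ * (((y ^ n : ℝ) : ℂ) * 𝓕 P (y • ξ)) := by
  rw [profConv_eq_convolution, Real.fourier_mul_convolution_eq hf (integrable_dilate hP hy),
    fourier_dilate P hy]

lemma integrable_profConv (hP : Integrable P) (hf : Integrable f) (hy : 0 < y) :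
    Integrable (profConv P f y) := by
  rw [profConv_eq_convolution]
  exact hf.integrable_convolution _ (integrable_dilate hP hy)

lemma norm_profConv_le (hP : ∀ u, ‖P u‖ ≤ D) (hf : Integrable f) (y : ℝ) (z : Eu n) :
    ‖profConv P f y z‖ ≤ D * ∫ x, ‖f x‖ := by
  rw [← integral_const_mul]
  refine norm_integral_le_of_norm_le (hf.norm.const_mul D) (.of_forall fun x => ?_)
  rw [norm_mul]
  gcongr
  exact hP _

lemma memLp_profConv (hP : Integrable P) (hPD : ∀ u, ‖P u‖ ≤ D) (hf : Integrable f)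
    (hy : 0 < y) : MemLp (profConv P f y) 2 volume := by
  have hi := integrable_profConv hP hf hy
  rw [memLp_two_iff_integrable_sq_norm hi.aestronglyMeasurable]
  simp only [sq]
  refine hi.norm.bdd_mul (c := D * ∫ x, ‖f x‖) hi.norm.aestronglyMeasurable
    (.of_forall fun z => ?_)
  rw [norm_norm]
  exact norm_profConv_le hPD hf y z

/-- The square of the vertical square function of `f` at height `y`, on the Fourier side. -/
def sqFourier (P f : Eu n → ℂ) (y : ℝ) : ℝ≥0∞ :=
  ∫⁻ ξ, ‖𝓕 f ξ‖ₑ ^ 2 * (ENNReal.ofReal y⁻¹ * ‖𝓕 P (y • ξ)‖ₑ ^ 2)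

lemma measurable_sqFourier_integrand (hP : Integrable P) (hf : Integrable f) :
    Measurable (fun p : ℝ × Eu n =>
      ‖𝓕 f p.2‖ₑ ^ 2 * (ENNReal.ofReal p.1⁻¹ * ‖𝓕 P (p.1 • p.2)‖ₑ ^ 2)) := by
  have h1 : Measurable (fun p : ℝ × Eu n => 𝓕 f p.2) :=
    (continuous_fourier hf).measurable.comp _root_.measurable_snd
  have h2 : Measurable (fun p : ℝ × Eu n => 𝓕 P (p.1 • p.2)) :=
    (continuous_fourier hP).measurable.comp (by fun_prop)
  fun_prop

lemma measurable_sqFourier (hP : Integrable P) (hf : Integrable f) :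
    Measurable (sqFourier P f) :=
  (measurable_sqFourier_integrand hP hf).lintegral_prod_right'

lemma sqFourier_eq (hP : Integrable P) (hPD : ∀ u, ‖P u‖ ≤ D) (hf : Integrable f) (hy : 0 < y) :
    sqFourier P f y =
      (ENNReal.ofReal (√y * (y ^ (n + 1))⁻¹) * eLpNorm (profConv P f y) 2 volume) ^ 2 := by
  rw [mul_pow, ← eLpNorm_fourier (integrable_profConv hP hf hy) (memLp_profConv hP hPD hf hy),
    eLpNorm_two_sq, ← lintegral_const_mul' _ _ (ENNReal.pow_ne_top ENNReal.ofReal_ne_top),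
    sqFourier]
  refine lintegral_congr fun ξ => ?_
  have hpow : ‖((y ^ n : ℝ) : ℂ)‖ₑ = ENNReal.ofReal (y ^ n) := by
    rw [← ofReal_norm, Complex.norm_real, Real.norm_of_nonneg (by positivity)]
  have hfactor : ENNReal.ofReal (√y * (y ^ (n + 1))⁻¹) ^ 2 * ENNReal.ofReal (y ^ n) ^ 2 =
      ENNReal.ofReal y⁻¹ := by
    rw [← mul_pow, ← ENNReal.ofReal_mul (by positivity), ← ENNReal.ofReal_pow (by positivity),
      mul_pow, mul_pow, Real.sq_sqrt hy.le]
    congr 1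
    field_simp
    ring
  rw [fourier_profConv hP hf hy, enorm_mul, enorm_mul, hpow, ← hfactor]
  ring

lemma lintegral_sqFourier_le (hδ : 0 < δ) (hD : 0 ≤ D)
    (hm : ∀ ξ, ‖𝓕 P ξ‖ ≤ D * (‖ξ‖ ^ (δ / 2) * (1 + ‖ξ‖) ^ (-δ))) (hP : Integrable P)
    (hf : Integrable f) (hf2 : MemLp f 2 volume) :
    ∫⁻ y in Ioi (0 : ℝ), sqFourier P f y ≤
      (ENNReal.ofReal (D * √(1 / δ + 1 / δ)) * eLpNorm f 2 volume) ^ 2 := by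
  have hslice (ξ : Eu n) : ∫⁻ y in Ioi (0 : ℝ),
      ‖𝓕 f ξ‖ₑ ^ 2 * (ENNReal.ofReal y⁻¹ * ‖𝓕 P (y • ξ)‖ₑ ^ 2) ≤
      ENNReal.ofReal (D ^ 2 * (1 / δ + 1 / δ)) * ‖𝓕 f ξ‖ₑ ^ 2 := by
    rw [lintegral_const_mul' _ _ (by simp), mul_comm]
    gcongr
    exact lintegral_multiplier_le hδ hm ξ
  calc ∫⁻ y in Ioi (0 : ℝ), sqFourier P f y
      ≤ ∫⁻ ξ, ENNReal.ofReal (D ^ 2 * (1 / δ + 1 / δ)) * ‖𝓕 f ξ‖ₑ ^ 2 := by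
        unfold sqFourier
        rw [lintegral_lintegral_swap (measurable_sqFourier_integrand hP hf).aemeasurable]
        exact lintegral_mono hslice
    _ = (ENNReal.ofReal (D * √(1 / δ + 1 / δ)) * eLpNorm f 2 volume) ^ 2 := by
        rw [lintegral_const_mul' _ _ ENNReal.ofReal_ne_top, ← eLpNorm_two_sq,
          eLpNorm_fourier hf hf2, mul_pow, ← ENNReal.ofReal_pow (by positivity), mul_pow,
          Real.sq_sqrt (by positivity)]

end SquareFunction

section L2Bound

lemma lintegral_rpow_half_mul_le {X : Type*} [MeasurableSpace X] {μ : Measure X}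
    {F G : X → ℝ≥0∞} (hF : AEMeasurable F μ) (hG : AEMeasurable G μ) {A B : ℝ≥0∞}
    (hA : ∫⁻ x, F x ∂μ ≤ A ^ 2) (hB : ∫⁻ x, G x ∂μ ≤ B ^ 2) :
    ∫⁻ x, F x ^ (1 / 2 : ℝ) * G x ^ (1 / 2 : ℝ) ∂μ ≤ A * B := by
  have hroot : ∀ t : ℝ≥0∞, (t ^ (1 / 2 : ℝ)) ^ (2 : ℝ) = t := fun t => by
    rw [← ENNReal.rpow_mul]; norm_num
  have hsq {S T : ℝ≥0∞} (h : S ≤ T ^ 2) : S ^ (1 / 2 : ℝ) ≤ T := by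
    rw [← hroot S, ENNReal.rpow_ofNat] at h
    exact (ENNReal.pow_le_pow_left_iff two_ne_zero).1 h
  have hCS := ENNReal.lintegral_mul_le_Lp_mul_Lq μ Real.HolderConjugate.two_two
    (hF.pow_const (1 / 2 : ℝ)) (hG.pow_const (1 / 2 : ℝ))
  simp only [Pi.mul_apply, hroot] at hCS
  exact hCS.trans (mul_le_mul' (hsq hA) (hsq hB))

lemma enorm_integral_mul_mul_le {X : Type*} [MeasurableSpace X] {μ : Measure X} {a u v : X → ℂ}
    {M : ℝ} (ha : ∀ x, ‖a x‖ ≤ M) (hu : AEStronglyMeasurable u μ) (hv : AEStronglyMeasurable v μ) :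
    ‖∫ x, a x * (u x * v x) ∂μ‖ₑ ≤ ENNReal.ofReal M * (eLpNorm u 2 μ * eLpNorm v 2 μ) := by
  have hpt : ∀ x, ‖a x * (u x * v x)‖ₑ ≤ ENNReal.ofReal M * (‖u x‖ₑ * ‖v x‖ₑ) := by
    intro x
    rw [enorm_mul, enorm_mul, ← ofReal_norm (a x)]
    gcongr
    exact ha x
  refine (enorm_integral_le_lintegral_enorm _).trans ((lintegral_mono hpt).trans ?_)
  rw [lintegral_const_mul' _ _ ENNReal.ofReal_ne_top]
  gcongr
  have hCS := ENNReal.lintegral_mul_le_Lp_mul_Lq μ Real.HolderConjugate.two_two hu.enorm hv.enorm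
  rwa [eLpNorm_eq_lintegral_rpow_enorm_toReal two_ne_zero ENNReal.ofNat_ne_top,
    eLpNorm_eq_lintegral_rpow_enorm_toReal two_ne_zero ENNReal.ofNat_ne_top]

variable {n : ℕ} {a : Eu n → ℝ → ℂ} {P Q f g h : Eu n → ℂ} {M D δ y : ℝ}

lemma integrable_prod_of_bounded (hP : Continuous P) (hPD : ∀ u, ‖P u‖ ≤ D) (hh : Integrable h)
    (hg : Integrable g) (y : ℝ) :
    Integrable (fun p : Eu n × Eu n => h p.2 * (P (y⁻¹ • (p.2 - p.1)) * g p.1))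
      (volume.prod volume) := by
  refine ((hg.mul_prod hh).bdd_mul (f := fun p : Eu n × Eu n => P (y⁻¹ • (p.2 - p.1)))
    (by fun_prop) (.of_forall fun p => hPD _)).congr (.of_forall fun p => ?_)
  simp only
  ring

lemma integral_swap_profConv (hP : Continuous P) (hPD : ∀ u, ‖P u‖ ≤ D) (hh : Integrable h)
    (hg : Integrable g) (y : ℝ) :
    ∫ x, (∫ z, h z * P (y⁻¹ • (z - x))) * g x = ∫ z, h z * profConv P g y z := by
  simp only [← integral_mul_const, mul_assoc]
  rw [integral_integral_swap (integrable_prod_of_bounded hP hPD hh hg y)]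
  simp only [integral_const_mul, profConv]

lemma integral_compKernel_mul (hm : Measurable (fun p : Eu n × ℝ => a p.1 p.2))
    (ha : ∀ x y, ‖a x y‖ ≤ M) (hQ : Integrable Q) (hPc : Continuous P) (hPD : ∀ u, ‖P u‖ ≤ D)
    (hf : Integrable f) (hy : 0 < y) (x : Eu n) :
    ∫ x', compKernel a P Q y x x' * f x' =
      (sliceFactor n y : ℂ) * ∫ z, (a z y * profConv P f y z) * Q (y⁻¹ • (z - x)) := by
  have hh : Integrable (fun z => a z y * Q (y⁻¹ • (z - x))) :=
    ((integrable_dilate hQ hy).comp_sub_right x).bdd_mul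
      (hm.comp measurable_prodMk_right).aestronglyMeasurable (.of_forall fun z => ha z y)
  have hswap := integral_swap_profConv hPc hPD hh hf y
  simp only [compKernel, mul_assoc, integral_const_mul]
  simp only [mul_assoc, mul_comm (Q _)] at hswap
  rw [hswap]

lemma integral_compKernel_mul_mul (hm : Measurable (fun p : Eu n × ℝ => a p.1 p.2))
    (ha : ∀ x y, ‖a x y‖ ≤ M) (hP : Integrable P) (hQ : Integrable Q) (hPc : Continuous P)
    (hQc : Continuous Q) (hPD : ∀ u, ‖P u‖ ≤ D) (hQD : ∀ u, ‖Q u‖ ≤ D)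
    (hf : Integrable f) (hg : Integrable g) (hy : 0 < y) :
    ∫ x, (∫ x', compKernel a P Q y x x' * f x') * g x =
      (sliceFactor n y : ℂ) * ∫ z, a z y * (profConv P f y z * profConv Q g y z) := by
  have hh : Integrable (fun z => a z y * profConv P f y z) :=
    (integrable_profConv hP hf hy).bdd_mul (hm.comp measurable_prodMk_right).aestronglyMeasurable
      (.of_forall fun z => ha z y)
  have hswap := integral_swap_profConv hQc hQD hh hg y
  simp only [mul_assoc] at hswap
  simp only [integral_compKernel_mul hm ha hQ hPc hPD hf hy, mul_assoc, integral_const_mul, hswap]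

lemma enorm_integral_compKernel_mul_mul_le (hδ : 0 < δ) (hP : IsProfile P δ) (hQ : IsProfile Q δ)
    (hm : Measurable (fun p : Eu n × ℝ => a p.1 p.2)) (ha : ∀ x y, ‖a x y‖ ≤ M)
    (hf : Integrable f) (hg : Integrable g) (hy : 0 < y) :
    ‖∫ x, (∫ x', compKernel a P Q y x x' * f x') * g x‖ₑ ≤
      ENNReal.ofReal (2 * M) *
        (sqFourier P f y ^ (1 / 2 : ℝ) * sqFourier Q g y ^ (1 / 2 : ℝ)) := by
  obtain ⟨S₁, -, hS₁⟩ := hP.decay.exists_bound (by positivity)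
  obtain ⟨S₂, -, hS₂⟩ := hQ.decay.exists_bound (by positivity)
  have hPi := hP.integrable hδ
  have hQi := hQ.integrable hδ
  have hroot : ∀ t : ℝ≥0∞, (t ^ 2) ^ (1 / 2 : ℝ) = t := fun t => by
    rw [← ENNReal.rpow_natCast, ← ENNReal.rpow_mul]; norm_num
  set w := √y * (y ^ (n + 1))⁻¹ with hw
  have hfactor : ‖(sliceFactor n y : ℂ)‖ₑ =
      ENNReal.ofReal 2 * (ENNReal.ofReal w * ENNReal.ofReal w) := by
    rw [← ofReal_norm, norm_sliceFactor hy, ← ENNReal.ofReal_mul (by positivity),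
      ← ENNReal.ofReal_mul zero_le_two, ← sq, hw, mul_pow, Real.sq_sqrt hy.le, ← mul_assoc]
    rfl
  rw [sqFourier_eq hPi hS₁ hf hy, sqFourier_eq hQi hS₂ hg hy, hroot, hroot, ← hw,
    integral_compKernel_mul_mul hm ha hPi hQi hP.continuous hQ.continuous (D := max S₁ S₂)
      (fun u => (hS₁ u).trans (le_max_left _ _)) (fun u => (hS₂ u).trans (le_max_right _ _)) hf hg
      hy, enorm_mul, hfactor, ENNReal.ofReal_mul (q := M) zero_le_two]
  refine (mul_le_mul_right (enorm_integral_mul_mul_le (fun z => ha z y)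
    (integrable_profConv hPi hf hy).aestronglyMeasurable
    (integrable_profConv hQi hg hy).aestronglyMeasurable) _).trans (le_of_eq ?_)
  ring

lemma exists_lintegral_compKernel_le (hδ : 0 < δ) (hP : IsProfile P δ) (hQ : IsProfile Q δ) :
    ∃ C, 0 ≤ C ∧ ∀ (a : Eu n → ℝ → ℂ) (M : ℝ), Measurable (fun p : Eu n × ℝ => a p.1 p.2) →
      (∀ x y, ‖a x y‖ ≤ M) → ∀ (f g : Eu n → ℂ), Integrable f → MemLp f 2 volume →
      Integrable g → MemLp g 2 volume →
      ∫⁻ y in Ioi (0 : ℝ), ‖∫ x, (∫ x', compKernel a P Q y x x' * f x') * g x‖ₑ ≤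
        ENNReal.ofReal (C * M) * eLpNorm f 2 volume * eLpNorm g 2 volume := by
  have hPi := hP.integrable hδ
  have hQi := hQ.integrable hδ
  obtain ⟨D₁, hD₁, h₁⟩ := hP.fourier
  obtain ⟨D₂, hD₂, h₂⟩ := hQ.fourier
  set s := √(1 / δ + 1 / δ)
  refine ⟨(D₁ * s) * (D₂ * s) * 2, by positivity, fun a M hm ha f g hf hf2 hg hg2 => ?_⟩
  calc ∫⁻ y in Ioi (0 : ℝ), ‖∫ x, (∫ x', compKernel a P Q y x x' * f x') * g x‖ₑ
      ≤ ∫⁻ y in Ioi (0 : ℝ), ENNReal.ofReal (2 * M) *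
          (sqFourier P f y ^ (1 / 2 : ℝ) * sqFourier Q g y ^ (1 / 2 : ℝ)) :=
        setLIntegral_mono' measurableSet_Ioi fun y hy =>
          enorm_integral_compKernel_mul_mul_le hδ hP hQ hm ha hf hg hy
    _ ≤ ENNReal.ofReal (2 * M) * ((ENNReal.ofReal (D₁ * s) * eLpNorm f 2 volume) *
          (ENNReal.ofReal (D₂ * s) * eLpNorm g 2 volume)) := by
        rw [lintegral_const_mul' _ _ ENNReal.ofReal_ne_top]
        gcongr
        exact lintegral_rpow_half_mul_le (measurable_sqFourier hPi hf).aemeasurable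
          (measurable_sqFourier hQi hg).aemeasurable
          (lintegral_sqFourier_le hδ hD₁ h₁ hPi hf hf2)
          (lintegral_sqFourier_le hδ hD₂ h₂ hQi hg hg2)
    _ = ENNReal.ofReal (D₁ * s * (D₂ * s) * 2 * M) * eLpNorm f 2 volume *
          eLpNorm g 2 volume := by
        rw [mul_assoc (_ * _) 2 M, ENNReal.ofReal_mul (q := 2 * M) (by positivity),
          ENNReal.ofReal_mul (p := D₁ * s) (by positivity)]
        ring

theorem exists_isCZSlices_compKernel {R : (Eu n → ℝ → ℂ) → Prop} (hδ : 0 < δ)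
    (hP : IsProfile P δ) (hQ : IsProfile Q δ) (hgrad : HasGradBound R P Q δ) :
    ∃ C, 0 ≤ C ∧ ∀ (a : Eu n → ℝ → ℂ) (M : ℝ), R a →
      Measurable (fun p : Eu n × ℝ => a p.1 p.2) → (∀ x y, ‖a x y‖ ≤ M) →
      IsCZSlices (compKernel a P Q) (C * M) δ := by
  obtain ⟨C₁, hC₁, hsize⟩ := exists_integral_norm_compKernel_integrand_le hδ hP.decay hQ.decay
  obtain ⟨C₂, hC₂, hgrad⟩ := hgrad
  obtain ⟨C₃, hC₃, hl2⟩ := exists_lintegral_compKernel_le hδ hP hQ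
  refine ⟨C₁ + C₂ + C₃, by positivity, fun a M hR hm ha => ?_⟩
  have hM : 0 ≤ M := (norm_nonneg _).trans (ha 0 0)
  have henlarge {C : ℝ} (hC : C ≤ C₁ + C₂ + C₃) (m : ℝ) {y : ℝ} (hy : 0 < y) (x x' : Eu n) :
      C * M * sliceWeight m δ ‖x - x'‖ y ≤
        (C₁ + C₂ + C₃) * M * sliceWeight m δ ‖x - x'‖ y := by
    have := sliceWeight_nonneg (m := m) (δ := δ) (norm_nonneg (x - x')) hy
    gcongr
  have hle₂ : C₂ ≤ C₁ + C₂ + C₃ := by linarith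
  have hcore := fun y hy x x' => hgrad a M hR hm ha y hy x x'
  exact {
    nonneg := by positivity
    decay_pos := hδ
    measurable := measurable_compKernel hm hP.continuous hQ.continuous
    size := fun y hy x x' => (norm_compKernel_le hy x x').trans
      ((hsize a M ha y hy x x').trans (henlarge (by linarith) n hy x x'))
    cancel := fun y hy x => integral_compKernel_eq_zero hm ha (hP.integrable hδ)
      (hQ.integrable hδ) (hP.integral_eq_zero hδ) hy x
    differentiable_fst := fun y hy x x' => (hcore y hy x x').1
    differentiable_snd := fun y hy x x' => (hcore y hy x x').2.2.1
    grad_fst := fun y hy x x' => (hcore y hy x x').2.1.trans (henlarge hle₂ (n + 1) hy x x')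
    grad_snd := fun y hy x x' => (hcore y hy x x').2.2.2.trans (henlarge hle₂ (n + 1) hy x x')
    l2 := fun f g hg hg2 => (hl2 a M hm ha f g f.integrable (f.memLp 2 volume) hg hg2).trans <| by
      gcongr
      linarith }

end L2Bound

namespace IsCZSlices

variable {n : ℕ} {k k₁ k₂ : ℝ → Eu n → Eu n → ℂ} {B B₁ B₂ δ : ℝ}

lemma zero (hδ : 0 < δ) : IsCZSlices (fun (_ : ℝ) (_ _ : Eu n) => (0 : ℂ)) 0 δ := by
  refine ⟨le_rfl, hδ, measurable_const, ?_, ?_, ?_, ?_, ?_, ?_, ?_⟩ <;> intros <;> simp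

lemma integrable_integral_mul_mul (hk : IsCZSlices k B δ) {y : ℝ} (hy : 0 < y) (f : 𝓢(Eu n, ℂ))
    {g : Eu n → ℂ} (hg : Integrable g) :
    Integrable (fun x => (∫ x', k y x x' * f x') * g x) := by
  refine hg.bdd_mul (c := B * y ^ (-(n : ℝ) - 1) * ∫ x', ‖f x'‖)
    ((hk.stronglyMeasurable_integral f).comp_measurable
      (g := fun x => (y, x)) (by fun_prop)).aestronglyMeasurable (.of_forall fun x => ?_)
  rw [← integral_const_mul]
  refine norm_integral_le_of_norm_le (f.integrable.norm.const_mul _) (.of_forall fun x' => ?_)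
  rw [norm_mul]
  gcongr
  exact hk.norm_le_rpow hy x x'

lemma integral_add_mul_mul (h₁ : IsCZSlices k₁ B₁ δ) (h₂ : IsCZSlices k₂ B₂ δ) {y : ℝ}
    (hy : 0 < y) (f : 𝓢(Eu n, ℂ)) {g : Eu n → ℂ} (hg : Integrable g) :
    ∫ x, (∫ x', (k₁ y x x' + k₂ y x x') * f x') * g x =
      (∫ x, (∫ x', k₁ y x x' * f x') * g x) + ∫ x, (∫ x', k₂ y x x' * f x') * g x := by
  rw [← integral_add (h₁.integrable_integral_mul_mul hy f hg)
    (h₂.integrable_integral_mul_mul hy f hg)]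
  refine integral_congr_ae (.of_forall fun x => ?_)
  simp only [add_mul, integral_add (h₁.integrable_mul hy x f.integrable)
    (h₂.integrable_mul hy x f.integrable)]

lemma aemeasurable_enorm_integral_mul_mul (hk : IsCZSlices k B δ) (f : 𝓢(Eu n, ℂ)) {g : Eu n → ℂ}
    (hg : Integrable g) :
    AEMeasurable (fun y => ‖∫ x, (∫ x', k y x x' * f x') * g x‖ₑ) (volume.restrict (Ioi 0)) :=
  ((hk.stronglyMeasurable_integral f).aestronglyMeasurable.mul
    hg.aestronglyMeasurable.comp_snd).integral_prod_right'.enorm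

lemma add (h₁ : IsCZSlices k₁ B₁ δ) (h₂ : IsCZSlices k₂ B₂ δ) :
    IsCZSlices (fun y x x' => k₁ y x x' + k₂ y x x') (B₁ + B₂) δ where
  nonneg := add_nonneg h₁.nonneg h₂.nonneg
  decay_pos := h₁.decay_pos
  measurable := h₁.measurable.add h₂.measurable
  size y hy x x' := by
    rw [add_mul]
    exact (norm_add_le _ _).trans (add_le_add (h₁.size y hy x x') (h₂.size y hy x x'))
  cancel y hy x := by
    rw [integral_add (h₁.integrable hy x) (h₂.integrable hy x), h₁.cancel y hy,
      h₂.cancel y hy, add_zero]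
  differentiable_fst y hy x x' :=
    (h₁.differentiable_fst y hy x x').add (h₂.differentiable_fst y hy x x')
  differentiable_snd y hy x x' :=
    (h₁.differentiable_snd y hy x x').add (h₂.differentiable_snd y hy x x')
  grad_fst y hy x x' := by
    rw [add_mul, fderiv_fun_add (h₁.differentiable_fst y hy x x')
      (h₂.differentiable_fst y hy x x')]
    exact (norm_add_le _ _).trans (add_le_add (h₁.grad_fst y hy x x') (h₂.grad_fst y hy x x'))
  grad_snd y hy x x' := by
    rw [add_mul, fderiv_fun_add (h₁.differentiable_snd y hy x x')
      (h₂.differentiable_snd y hy x x')]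
    exact (norm_add_le _ _).trans (add_le_add (h₁.grad_snd y hy x x') (h₂.grad_snd y hy x x'))
  l2 f g hg hg2 := by
    calc ∫⁻ y in Ioi (0 : ℝ), ‖∫ x, (∫ x', (k₁ y x x' + k₂ y x x') * f x') * g x‖ₑ
        ≤ ∫⁻ y in Ioi (0 : ℝ), (‖∫ x, (∫ x', k₁ y x x' * f x') * g x‖ₑ +
            ‖∫ x, (∫ x', k₂ y x x' * f x') * g x‖ₑ) :=
          setLIntegral_mono' measurableSet_Ioi fun y hy => by
            rw [integral_add_mul_mul h₁ h₂ hy f hg]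
            exact enorm_add_le _ _
      _ ≤ ENNReal.ofReal (B₁ + B₂) * eLpNorm f 2 volume * eLpNorm g 2 volume := by
          rw [lintegral_add_left' (h₁.aemeasurable_enorm_integral_mul_mul f hg),
            ENNReal.ofReal_add h₁.nonneg h₂.nonneg, add_mul, add_mul]
          exact add_le_add (h₁.l2 f g hg hg2) (h₂.l2 f g hg hg2)

lemma sum {ι : Type*} (s : Finset ι) {k : ι → ℝ → Eu n → Eu n → ℂ} {B : ι → ℝ}
    (hδ : 0 < δ) (h : ∀ i ∈ s, IsCZSlices (k i) (B i) δ) :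
    IsCZSlices (fun y x x' => ∑ i ∈ s, k i y x x') (∑ i ∈ s, B i) δ := by
  classical
  induction s using Finset.induction_on with
  | empty => simpa using zero hδ
  | insert i s hi ih =>
    simp only [Finset.sum_insert hi]
    exact add (h i (Finset.mem_insert_self i s))
      (ih fun j hj => h j (Finset.mem_insert_of_mem hj))

end IsCZSlices

section Differences

open Metric

lemma norm_iterate_fwdDiff_le {V E : Type*} [SeminormedAddCommGroup V] [SeminormedAddCommGroup E]
    (h : V) (K : ℕ) (r : V → E) (ξ : V) {b : ℝ} (hb : ∀ u, ‖u - ξ‖ ≤ K * ‖h‖ → ‖r u‖ ≤ b) :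
    ‖(fwdDiff h)^[K] r ξ‖ ≤ 2 ^ K * b := by
  induction K generalizing r b with
  | zero => simpa using hb ξ (by simp)
  | succ K ih =>
    rw [Function.iterate_succ_apply]
    refine (ih (fwdDiff h r) (b := 2 * b) fun u hu => ?_).trans (le_of_eq (by ring))
    have h_shift : ‖r (u + h)‖ ≤ b := hb _ (by
      rw [add_sub_right_comm]
      refine (norm_add_le _ _).trans ?_
      push_cast
      linarith)
    have h_base : ‖r u‖ ≤ b := hb _ (by
      push_cast
      linarith [norm_nonneg h])
    rw [fwdDiff]
    linarith [norm_sub_le (r (u + h)) (r u)]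

lemma iterate_fwdDiff_eq_line {V : Type*} [AddCommGroup V] (r : V → ℂ) (F : ℂ → ℂ)
    (h ξ : V) (hrF : ∀ j : ℕ, F j = r (ξ + j • h)) (K : ℕ) :
    (fwdDiff h)^[K] r ξ = (fwdDiff 1)^[K] F 0 := by
  rw [fwdDiff_iter_eq_sum_shift, fwdDiff_iter_eq_sum_shift]
  refine Finset.sum_congr rfl fun j _ => ?_
  rw [← hrF]
  simp

variable {F : ℂ → ℂ} {b r s : ℝ} {t u : ℂ}

lemma closedBall_subset_ball_of_mem_segment (hs : 1 < s) (ht : t ∈ ball (0 : ℂ) r)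
    (hu : u ∈ segment ℝ t (t + 1)) : closedBall u ((s - 1) / 2) ⊆ ball 0 (r + s) := by
  intro z hz
  rw [mem_ball, dist_zero_right] at ht ⊢
  rw [mem_closedBall, dist_eq_norm] at hz
  have hut : ‖u - t‖ ≤ 1 := by simpa using norm_sub_le_of_mem_segment hu
  calc ‖z‖ = ‖(z - u) + (u - t) + t‖ := by ring_nf
    _ ≤ ‖z - u‖ + ‖u - t‖ + ‖t‖ := norm_add₃_le
    _ < r + s := by linarith

lemma segment_subset_ball (hs : 1 < s) (ht : t ∈ ball (0 : ℂ) r) :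
    segment ℝ t (t + 1) ⊆ ball 0 (r + s) := fun _ hu =>
  closedBall_subset_ball_of_mem_segment hs ht hu (mem_closedBall_self (by linarith))

lemma differentiableOn_fwdDiff_one (hs : 1 < s) (hF : DifferentiableOn ℂ F (ball 0 (r + s))) :
    DifferentiableOn ℂ (fwdDiff 1 F) (ball 0 r) := by
  intro t ht
  have hd : ∀ u ∈ segment ℝ t (t + 1), DifferentiableAt ℂ F u := fun u hu =>
    hF.differentiableAt (isOpen_ball.mem_nhds (segment_subset_ball hs ht hu))
  have h_shift : DifferentiableAt ℂ (fun z => F (z + 1)) t :=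
    (hd _ (right_mem_segment ℝ _ _)).comp t (by fun_prop)
  exact (h_shift.sub (hd _ (left_mem_segment ℝ _ _))).differentiableWithinAt

lemma norm_fwdDiff_one_le (hs : 1 < s) (hF : DifferentiableOn ℂ F (ball 0 (r + s)))
    (hb : ∀ t ∈ ball (0 : ℂ) (r + s), ‖F t‖ ≤ b) (ht : t ∈ ball (0 : ℂ) r) :
    ‖fwdDiff 1 F t‖ ≤ b * (2 / (s - 1)) := by
  have hsub := fun u hu => closedBall_subset_ball_of_mem_segment (u := u) hs ht hu
  have hderiv : ∀ u ∈ segment ℝ t (t + 1), ‖deriv F u‖ ≤ b / ((s - 1) / 2) := fun u hu =>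
    Complex.norm_deriv_le_of_forall_mem_sphere_norm_le (by linarith)
      ((hF.mono (hsub u hu)).diffContOnCl_ball subset_rfl)
      fun z hz => hb z (hsub u hu (sphere_subset_closedBall hz))
  have hmv := (convex_segment t (t + 1)).norm_image_sub_le_of_norm_deriv_le
    (fun u hu => hF.differentiableAt (isOpen_ball.mem_nhds (segment_subset_ball hs ht hu)))
    hderiv (left_mem_segment ℝ _ _) (right_mem_segment ℝ _ _)
  rw [fwdDiff]
  refine hmv.trans (le_of_eq ?_)
  rw [add_sub_cancel_left, norm_one, mul_one]
  field_simp

lemma norm_iterate_fwdDiff_one_le (hs : 1 < s) (K : ℕ)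
    (hF : DifferentiableOn ℂ F (ball 0 ((K + 1) * s)))
    (hb : ∀ t ∈ ball (0 : ℂ) ((K + 1) * s), ‖F t‖ ≤ b) :
    ‖(fwdDiff 1)^[K] F 0‖ ≤ b * (2 / (s - 1)) ^ K := by
  induction K generalizing F b with
  | zero => simpa using hb 0 (by simp; linarith)
  | succ K ih =>
    have hr : ((K + 1 : ℕ) + 1) * s = (K + 1) * s + s := by push_cast; ring
    rw [hr] at hF hb
    rw [Function.iterate_succ_apply]
    refine (ih (differentiableOn_fwdDiff_one hs hF) fun t ht =>
      norm_fwdDiff_one_le hs hF hb ht).trans (le_of_eq (by ring))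

end Differences

section PolyRadial

variable {V : Type*} [NormedAddCommGroup V] [InnerProductSpace ℝ V] {l : ℕ} {v : Fin l → V}
  {g : ℂ → ℂ} {C a : ℝ} {h ξ : V} {t : ℂ}

/-- The function `g` of one complex variable is holomorphic on the right half-plane and of size
`O(|w| ^ (a / 2))` there, so that the radial function `ξ ↦ g (‖ξ‖ ^ 2)` is of size `O(‖ξ‖ ^ a)`
and extends holomorphically along lines that avoid the origin. -/
structure IsRadialSymbol (g : ℂ → ℂ) (C a : ℝ) : Prop where
  const_nonneg : 0 ≤ C
  order_nonneg : 0 ≤ a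
  differentiableOn : DifferentiableOn ℂ g {w | 0 < w.re}
  norm_le : ∀ w : ℂ, 0 ≤ w.re → ‖g w‖ ≤ C * ‖w‖ ^ (a / 2)

/-- The product of the linear forms `⟪v i, ·⟫` with the radial function `ξ ↦ g (‖ξ‖ ^ 2)`. The
multipliers of the stable semigroup and of its derivatives are of this form. -/
def polyRadial (v : Fin l → V) (g : ℂ → ℂ) (ξ : V) : ℂ :=
  (∏ i, ((inner ℝ (v i) ξ : ℝ) : ℂ)) * g ((‖ξ‖ ^ 2 : ℝ) : ℂ)

/-- The polynomial in `t` with values `‖ξ + t • h‖ ^ 2` at real `t`, evaluated at complex `t`. -/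
def lineNormSq (ξ h : V) (t : ℂ) : ℂ :=
  ((‖ξ‖ ^ 2 : ℝ) : ℂ) + 2 * t * ((inner ℝ ξ h : ℝ) : ℂ) + t ^ 2 * ((‖h‖ ^ 2 : ℝ) : ℂ)

/-- The extension of `t ↦ polyRadial v g (ξ + t • h)` to complex `t`. -/
def linePolyRadial (v : Fin l → V) (g : ℂ → ℂ) (ξ h : V) (t : ℂ) : ℂ :=
  (∏ i, (((inner ℝ (v i) ξ : ℝ) : ℂ) + t * ((inner ℝ (v i) h : ℝ) : ℂ))) * g (lineNormSq ξ h t)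

lemma sq_rpow_half {x : ℝ} (hx : 0 ≤ x) (a : ℝ) : (x ^ 2) ^ (a / 2) = x ^ a := by
  rw [← Real.rpow_natCast_mul hx]
  congr 1
  push_cast
  ring

lemma norm_prod_inner_le (hv : ∀ i, ‖v i‖ ≤ 1) (ξ : V) :
    ‖∏ i, ((inner ℝ (v i) ξ : ℝ) : ℂ)‖ ≤ ‖ξ‖ ^ l := by
  rw [norm_prod]
  calc _ ≤ ∏ _i : Fin l, ‖ξ‖ := by
        refine Finset.prod_le_prod (fun i _ => norm_nonneg _) fun i _ => ?_
        rw [Complex.norm_real]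
        exact (norm_inner_le_norm _ _).trans (mul_le_of_le_one_left (norm_nonneg _) (hv i))
    _ = _ := by simp

lemma norm_polyRadial_le (hv : ∀ i, ‖v i‖ ≤ 1) (hg : IsRadialSymbol g C a) (ξ : V) :
    ‖polyRadial v g ξ‖ ≤ C * ‖ξ‖ ^ (l + a) := by
  have hbound := hg.norm_le ((‖ξ‖ ^ 2 : ℝ) : ℂ) (by rw [Complex.ofReal_re]; positivity)
  rw [Complex.norm_real, Real.norm_of_nonneg (by positivity), sq_rpow_half (norm_nonneg _)]
    at hbound
  rw [polyRadial, norm_mul,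
    Real.rpow_add_of_nonneg (norm_nonneg _) (Nat.cast_nonneg l) hg.order_nonneg,
    Real.rpow_natCast]
  calc _ ≤ ‖ξ‖ ^ l * (C * ‖ξ‖ ^ a) :=
        mul_le_mul (norm_prod_inner_le hv ξ) hbound (norm_nonneg _) (by positivity)
    _ = _ := by ring

lemma lineNormSq_natCast (ξ h : V) (j : ℕ) : lineNormSq ξ h j = ((‖ξ + j • h‖ ^ 2 : ℝ) : ℂ) := by
  rw [lineNormSq, ← Nat.cast_smul_eq_nsmul ℝ, norm_add_sq_real, inner_smul_right, norm_smul,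
    Real.norm_of_nonneg (Nat.cast_nonneg j)]
  push_cast
  ring

lemma norm_lineNormSq_sub_le (ht : ‖t‖ * ‖h‖ ≤ ‖ξ‖ / 4) :
    ‖lineNormSq ξ h t - ((‖ξ‖ ^ 2 : ℝ) : ℂ)‖ ≤ 9 / 16 * ‖ξ‖ ^ 2 := by
  have hinner : |inner ℝ ξ h| ≤ ‖ξ‖ * ‖h‖ := abs_real_inner_le_norm ξ h
  calc ‖lineNormSq ξ h t - ((‖ξ‖ ^ 2 : ℝ) : ℂ)‖
      = ‖2 * t * ((inner ℝ ξ h : ℝ) : ℂ) + t ^ 2 * ((‖h‖ ^ 2 : ℝ) : ℂ)‖ := by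
        rw [lineNormSq]; ring_nf
    _ ≤ 2 * ‖t‖ * |inner ℝ ξ h| + ‖t‖ ^ 2 * ‖h‖ ^ 2 :=
        (norm_add_le _ _).trans (by simp)
    _ ≤ 2 * ‖t‖ * (‖ξ‖ * ‖h‖) + ‖t‖ ^ 2 * ‖h‖ ^ 2 := by gcongr
    _ ≤ 9 / 16 * ‖ξ‖ ^ 2 := by nlinarith [mul_nonneg (norm_nonneg t) (norm_nonneg h)]

lemma lineNormSq_re_pos (hξ : ξ ≠ 0) (ht : ‖t‖ * ‖h‖ ≤ ‖ξ‖ / 4) : 0 < (lineNormSq ξ h t).re := by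
  have hre := (Complex.abs_re_le_norm _).trans (norm_lineNormSq_sub_le ht)
  rw [Complex.sub_re, Complex.ofReal_re] at hre
  have hpos : 0 < ‖ξ‖ ^ 2 := by positivity
  linarith [(abs_le.1 hre).1]

lemma norm_lineNormSq_le (ht : ‖t‖ * ‖h‖ ≤ ‖ξ‖ / 4) : ‖lineNormSq ξ h t‖ ≤ 2 * ‖ξ‖ ^ 2 := by
  have htri := norm_le_norm_add_norm_sub' (lineNormSq ξ h t) ((‖ξ‖ ^ 2 : ℝ) : ℂ)
  rw [Complex.norm_real, Real.norm_of_nonneg (by positivity)] at htri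
  linarith [norm_lineNormSq_sub_le ht, sq_nonneg ‖ξ‖]

lemma norm_prod_inner_line_le (hv : ∀ i, ‖v i‖ ≤ 1) (ht : ‖t‖ * ‖h‖ ≤ ‖ξ‖ / 4) :
    ‖∏ i, (((inner ℝ (v i) ξ : ℝ) : ℂ) + t * ((inner ℝ (v i) h : ℝ) : ℂ))‖ ≤ (2 * ‖ξ‖) ^ l := by
  have hinner : ∀ i (w : V), |inner ℝ (v i) w| ≤ ‖w‖ := fun i w =>
    (abs_real_inner_le_norm _ _).trans (mul_le_of_le_one_left (norm_nonneg _) (hv i))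
  rw [norm_prod]
  calc _ ≤ ∏ _i : Fin l, (2 * ‖ξ‖) := by
        refine Finset.prod_le_prod (fun i _ => norm_nonneg _) fun i _ => ?_
        calc _ ≤ |inner ℝ (v i) ξ| + ‖t‖ * |inner ℝ (v i) h| :=
              (norm_add_le _ _).trans (by simp)
          _ ≤ ‖ξ‖ + ‖t‖ * ‖h‖ := by gcongr <;> exact hinner i _
          _ ≤ 2 * ‖ξ‖ := by linarith [norm_nonneg ξ]
    _ = _ := by simp

lemma linePolyRadial_natCast (v : Fin l → V) (g : ℂ → ℂ) (ξ h : V) (j : ℕ) :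
    linePolyRadial v g ξ h j = polyRadial v g (ξ + j • h) := by
  rw [linePolyRadial, polyRadial, lineNormSq_natCast]
  congr 1
  refine Finset.prod_congr rfl fun i _ => ?_
  rw [inner_add_right, ← Nat.cast_smul_eq_nsmul ℝ, inner_smul_right]
  push_cast
  ring

lemma norm_linePolyRadial_le (hv : ∀ i, ‖v i‖ ≤ 1) (hg : IsRadialSymbol g C a) (hξ : ξ ≠ 0)
    (ht : ‖t‖ * ‖h‖ ≤ ‖ξ‖ / 4) :
    ‖linePolyRadial v g ξ h t‖ ≤ 2 ^ l * (C * 2 ^ (a / 2)) * ‖ξ‖ ^ (l + a) := by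
  have hC := hg.const_nonneg
  have ha := hg.order_nonneg
  have hradial : ‖g (lineNormSq ξ h t)‖ ≤ C * (2 ^ (a / 2) * ‖ξ‖ ^ a) := by
    refine (hg.norm_le _ (lineNormSq_re_pos hξ ht).le).trans ?_
    rw [← sq_rpow_half (norm_nonneg ξ), ← Real.mul_rpow (by norm_num) (by positivity)]
    gcongr
    exact norm_lineNormSq_le ht
  rw [linePolyRadial, norm_mul]
  refine (mul_le_mul (norm_prod_inner_line_le hv ht) hradial (norm_nonneg _)
    (by positivity)).trans (le_of_eq ?_)
  rw [Real.rpow_add_of_nonneg (norm_nonneg _) (Nat.cast_nonneg l) ha, Real.rpow_natCast, mul_pow]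
  ring

lemma differentiableOn_linePolyRadial (hg : IsRadialSymbol g C a) (hξ : ξ ≠ 0) :
    DifferentiableOn ℂ (linePolyRadial v g ξ h) {t | ‖t‖ * ‖h‖ ≤ ‖ξ‖ / 4} := by
  unfold linePolyRadial
  refine DifferentiableOn.mul (by fun_prop) ?_
  exact hg.differentiableOn.comp (by unfold lineNormSq; fun_prop) fun t ht =>
    lineNormSq_re_pos hξ ht

lemma iterate_fwdDiff_prod_inner (v : Fin l → V) {K : ℕ} (hK : l < K) (h ξ : V) :
    (fwdDiff h)^[K] (fun ξ => ∏ i, ((inner ℝ (v i) ξ : ℝ) : ℂ)) ξ = 0 := by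
  let p : Polynomial ℂ := ∏ i, (Polynomial.C ((inner ℝ (v i) ξ : ℝ) : ℂ) +
    Polynomial.C ((inner ℝ (v i) h : ℝ) : ℂ) * Polynomial.X)
  have hp : p.natDegree ≤ l := by
    refine (Polynomial.natDegree_prod_le _ _).trans ?_
    calc _ ≤ ∑ _i : Fin l, 1 := Finset.sum_le_sum fun i _ => by compute_degree
      _ = l := by simp
  rw [iterate_fwdDiff_eq_line _ (fun t => p.eval t) h ξ]
  · exact congrFun (Polynomial.fwdDiff_iter_eq_zero_of_degree_lt (hp.trans_lt hK)) 0
  · intro j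
    simp only [p, Polynomial.eval_prod]
    refine Finset.prod_congr rfl fun i _ => ?_
    rw [inner_add_right, ← Nat.cast_smul_eq_nsmul ℝ, inner_smul_right]
    simp
    ring

lemma norm_iterate_fwdDiff_polyRadial_near (hv : ∀ i, ‖v i‖ ≤ 1) (hg : IsRadialSymbol g C a)
    (K : ℕ) {R : ℝ} (hR : 0 ≤ R) (hξ : ‖ξ‖ ≤ R * ‖h‖) :
    ‖(fwdDiff h)^[K] (polyRadial v g) ξ‖ ≤
      2 ^ K * (C * (R + K) ^ (l + a)) * ‖h‖ ^ (l + a) := by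
  have hC := hg.const_nonneg
  have ha := hg.order_nonneg
  have hbound : ∀ u, ‖u - ξ‖ ≤ K * ‖h‖ →
      ‖polyRadial v g u‖ ≤ C * ((R + K) * ‖h‖) ^ (l + a) := fun u hu => by
    refine (norm_polyRadial_le hv hg u).trans ?_
    have hu' : ‖u‖ ≤ (R + K) * ‖h‖ := by linarith [norm_le_norm_add_norm_sub' u ξ]
    gcongr
  refine (norm_iterate_fwdDiff_le h K _ ξ hbound).trans (le_of_eq ?_)
  rw [Real.mul_rpow (by positivity) (norm_nonneg h)]
  ring

lemma norm_iterate_fwdDiff_polyRadial_far (hv : ∀ i, ‖v i‖ ≤ 1) (hg : IsRadialSymbol g C a)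
    (K : ℕ) (hh : h ≠ 0) (hξ : 8 * (K + 1) * ‖h‖ ≤ ‖ξ‖) :
    ‖(fwdDiff h)^[K] (polyRadial v g) ξ‖ ≤
      (2 ^ l * (C * 2 ^ (a / 2)) * ‖ξ‖ ^ (l + a)) * (16 * (K + 1) * ‖h‖ / ‖ξ‖) ^ K := by
  have hC := hg.const_nonneg
  have hξ0 : 0 < ‖ξ‖ := lt_of_lt_of_le (by positivity) hξ
  have hξne : ξ ≠ 0 := norm_pos_iff.1 hξ0
  set s : ℝ := ‖ξ‖ / (4 * (K + 1) * ‖h‖) with hs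
  have hs2 : 2 ≤ s := by
    rw [hs, le_div_iff₀ (by positivity)]
    linarith
  have hball : Metric.ball (0 : ℂ) ((K + 1) * s) ⊆ {t | ‖t‖ * ‖h‖ ≤ ‖ξ‖ / 4} := fun t ht => by
    rw [Metric.mem_ball, dist_zero_right] at ht
    calc ‖t‖ * ‖h‖ ≤ (K + 1) * s * ‖h‖ := by gcongr
      _ = ‖ξ‖ / 4 := by rw [hs]; field_simp
  have hratio : 2 / (s - 1) ≤ 16 * ((K : ℝ) + 1) * ‖h‖ / ‖ξ‖ := by
    have e : 16 * ((K : ℝ) + 1) * ‖h‖ / ‖ξ‖ = 4 / s := by rw [hs]; field_simp; ring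
    rw [e, div_le_div_iff₀ (by linarith) (by linarith)]
    linarith
  have hquot : 0 ≤ 2 / (s - 1) := div_nonneg (by norm_num) (by linarith)
  rw [iterate_fwdDiff_eq_line _ _ h ξ (linePolyRadial_natCast v g ξ h)]
  refine (norm_iterate_fwdDiff_one_le (by linarith) K
    ((differentiableOn_linePolyRadial hg hξne).mono hball) fun t ht =>
      norm_linePolyRadial_le hv hg hξne (hball ht)).trans ?_
  gcongr

lemma one_le_rpow_mul_rpow_neg {τ R p : ℝ} (hτ : 0 ≤ τ) (hτR : τ ≤ R) (hp : 0 ≤ p) :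
    1 ≤ (1 + R) ^ p * (1 + τ) ^ (-p) := by
  rw [Real.rpow_neg (by positivity), ← div_eq_mul_inv,
    ← Real.div_rpow (by linarith) (by positivity)]
  refine Real.one_le_rpow ?_ hp
  rw [le_div_iff₀ (by positivity)]
  linarith

lemma rpow_neg_le_two_rpow_mul {τ p : ℝ} (hτ : 1 ≤ τ) (hp : 0 ≤ p) :
    τ ^ (-p) ≤ 2 ^ p * (1 + τ) ^ (-p) := by
  have hτ0 : 0 < τ := by linarith
  rw [Real.rpow_neg hτ0.le, Real.rpow_neg (by positivity), ← div_eq_mul_inv,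
    ← Real.div_rpow (by norm_num) (by positivity), ← Real.inv_rpow hτ0.le]
  refine Real.rpow_le_rpow (by positivity) ?_ hp
  rw [inv_le_comm₀ hτ0 (by positivity), inv_div, div_le_iff₀ (by norm_num)]
  linarith

lemma norm_iterate_fwdDiff_polyRadial_far_decay (hv : ∀ i, ‖v i‖ ≤ 1) (hg : IsRadialSymbol g C a)
    {K : ℕ} (hK : l + a ≤ K) (hh : h ≠ 0) (hξ : 8 * (K + 1) ≤ ‖ξ‖ / ‖h‖) :
    ‖(fwdDiff h)^[K] (polyRadial v g) ξ‖ ≤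
      2 ^ l * (C * 2 ^ (a / 2)) * (16 * (K + 1)) ^ K * 2 ^ (K - (l + a)) * ‖h‖ ^ (l + a) *
        (1 + ‖ξ‖ / ‖h‖) ^ (-(K - (l + a))) := by
  have hC := hg.const_nonneg
  have hh0 : 0 < ‖h‖ := norm_pos_iff.2 hh
  have hfar := norm_iterate_fwdDiff_polyRadial_far hv hg K hh ((le_div_iff₀ hh0).1 hξ)
  set τ := ‖ξ‖ / ‖h‖ with hτ
  have hτ1 : 1 ≤ τ := le_trans (by linarith [Nat.cast_nonneg (α := ℝ) K]) hξ
  have hξτ : ‖ξ‖ = τ * ‖h‖ := by rw [hτ]; field_simp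
  have hratio : 16 * ((K : ℝ) + 1) * ‖h‖ / ‖ξ‖ = 16 * (K + 1) * τ⁻¹ := by
    rw [hτ]; field_simp
  calc _ ≤ (2 ^ l * (C * 2 ^ (a / 2)) * ‖ξ‖ ^ (l + a)) * (16 * (K + 1) * ‖h‖ / ‖ξ‖) ^ K := hfar
    _ = 2 ^ l * (C * 2 ^ (a / 2)) * (16 * (K + 1)) ^ K * ‖h‖ ^ (l + a) *
          τ ^ (-(K - (l + a))) := by
        rw [hratio, mul_pow, hξτ, Real.mul_rpow (by linarith) hh0.le, neg_sub,
          Real.rpow_sub (by linarith), Real.rpow_natCast, inv_pow]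
        ring
    _ ≤ 2 ^ l * (C * 2 ^ (a / 2)) * (16 * (K + 1)) ^ K * ‖h‖ ^ (l + a) *
          (2 ^ (K - (l + a)) * (1 + τ) ^ (-(K - (l + a)))) := by
        gcongr
        exact rpow_neg_le_two_rpow_mul hτ1 (by linarith)
    _ = _ := by ring

lemma exists_norm_iterate_fwdDiff_polyRadial_le (hv : ∀ i, ‖v i‖ ≤ 1)
    (hg : IsRadialSymbol g C a) {K : ℕ} (hK : l + a ≤ K) :
    ∃ D : ℝ, ∀ h ξ : V, h ≠ 0 → ‖(fwdDiff h)^[K] (polyRadial v g) ξ‖ ≤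
      D * ‖h‖ ^ (l + a) * (1 + ‖ξ‖ / ‖h‖) ^ (-(K - (l + a))) := by
  have hC := hg.const_nonneg
  set R : ℝ := 8 * (K + 1)
  set D₁ : ℝ := 2 ^ K * (C * (R + K) ^ (l + a)) * (1 + R) ^ (K - (l + a)) with hD₁
  set D₂ : ℝ := 2 ^ l * (C * 2 ^ (a / 2)) * (16 * (K + 1)) ^ K * 2 ^ (K - (l + a))
  refine ⟨max D₁ D₂, fun h ξ hh => ?_⟩
  have hh0 : 0 < ‖h‖ := norm_pos_iff.2 hh
  rcases le_total (‖ξ‖ / ‖h‖) R with hnear | hfar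
  · calc _ ≤ 2 ^ K * (C * (R + K) ^ (l + a)) * ‖h‖ ^ (l + a) * 1 := by
          rw [mul_one]
          exact norm_iterate_fwdDiff_polyRadial_near hv hg K (by positivity)
            ((div_le_iff₀ hh0).1 hnear)
      _ ≤ 2 ^ K * (C * (R + K) ^ (l + a)) * ‖h‖ ^ (l + a) *
            ((1 + R) ^ (K - (l + a)) * (1 + ‖ξ‖ / ‖h‖) ^ (-(K - (l + a)))) := by
          gcongr
          exact one_le_rpow_mul_rpow_neg (by positivity) hnear (by linarith)
      _ = D₁ * ‖h‖ ^ (l + a) * (1 + ‖ξ‖ / ‖h‖) ^ (-(K - (l + a))) := by rw [hD₁]; ring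
      _ ≤ _ := by gcongr; exact le_max_left _ _
  · refine (norm_iterate_fwdDiff_polyRadial_far_decay hv hg hK hh hfar).trans ?_
    gcongr
    exact le_max_right _ _

end PolyRadial

section FourierInvDecay

open FourierTransform

section

variable {V : Type*} [NormedAddCommGroup V] [InnerProductSpace ℝ V] [FiniteDimensional ℝ V]
  [MeasurableSpace V] [BorelSpace V] {m : V → ℂ}

lemma norm_fourierInv_le (m : V → ℂ) (x : V) : ‖𝓕⁻ m x‖ ≤ ∫ ξ, ‖m ξ‖ := by
  rw [Real.fourierInv_eq_fourier_neg]
  exact norm_fourier_le m _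

lemma integrable_fourierChar_smul (hm : Integrable m) (x : V) :
    Integrable (fun ξ => Real.fourierChar (inner ℝ ξ x) • m ξ) := by
  simpa using (Real.fourierIntegral_convergent_iff (μ := volume) (f := m) (-x)).2 hm

lemma fourierChar_half : (Real.fourierChar (1 / 2 : ℝ) : ℂ) = -1 := by
  rw [Real.fourierChar_apply, ← Complex.exp_pi_mul_I]
  congr 1
  push_cast
  ring

lemma fourierInv_fwdDiff (hm : Integrable m) {h x : V} (hx : inner ℝ h x = 1 / 2) :
    𝓕⁻ (fwdDiff h m) x = -2 * 𝓕⁻ m x := by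
  have h_shift : ∫ v, Real.fourierChar (inner ℝ v x) • m (v + h) =
      - ∫ v, Real.fourierChar (inner ℝ v x) • m v := by
    rw [← integral_neg, ← integral_add_right_eq_self
      (fun v => -(Real.fourierChar (inner ℝ v x) • m v)) h]
    refine integral_congr_ae (.of_forall fun v => ?_)
    simp only [inner_add_left, hx, AddChar.map_add_eq_mul, Circle.smul_def, Circle.coe_mul,
      fourierChar_half]
    simp
  rw [Real.fourierInv_eq, Real.fourierInv_eq]
  simp only [fwdDiff, smul_sub]
  rw [integral_sub (integrable_fourierChar_smul (hm.comp_add_right h) x)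
    (integrable_fourierChar_smul hm x), h_shift]
  ring

lemma integrable_iterate_fwdDiff (hm : Integrable m) (h : V) (K : ℕ) :
    Integrable ((fwdDiff h)^[K] m) := by
  induction K with
  | zero => simpa using hm
  | succ K ih =>
    rw [Function.iterate_succ_apply']
    exact (ih.comp_add_right h).sub ih

lemma fourierInv_iterate_fwdDiff (hm : Integrable m) {h x : V} (hx : inner ℝ h x = 1 / 2)
    (K : ℕ) : 𝓕⁻ ((fwdDiff h)^[K] m) x = (-2) ^ K * 𝓕⁻ m x := by
  induction K with
  | zero => simp
  | succ K ih =>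
    rw [Function.iterate_succ_apply', fourierInv_fwdDiff (integrable_iterate_fwdDiff hm h K) hx, ih]
    ring

lemma norm_fourierInv_le_integral_fwdDiff (hm : Integrable m) {h x : V}
    (hx : inner ℝ h x = 1 / 2) (K : ℕ) : ‖𝓕⁻ m x‖ ≤ ∫ ξ, ‖(fwdDiff h)^[K] m ξ‖ :=
  calc ‖𝓕⁻ m x‖ ≤ 2 ^ K * ‖𝓕⁻ m x‖ :=
        le_mul_of_one_le_left (norm_nonneg _) (one_le_pow₀ (by norm_num))
    _ = ‖𝓕⁻ ((fwdDiff h)^[K] m) x‖ := by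
        rw [fourierInv_iterate_fwdDiff hm hx, norm_mul, norm_pow, norm_neg, Complex.norm_ofNat]
    _ ≤ _ := norm_fourierInv_le _ x

end

variable {n : ℕ} {m : Eu n → ℂ} {d D p : ℝ} {K : ℕ}

lemma norm_fourierInv_le_of_fwdDiff (hm : Integrable m) (hp : n < p)
    (hb : ∀ h ξ : Eu n, h ≠ 0 →
      ‖(fwdDiff h)^[K] m ξ‖ ≤ D * ‖h‖ ^ d * (1 + ‖ξ‖ / ‖h‖) ^ (-p)) {x : Eu n} (hx : x ≠ 0) :
    ‖𝓕⁻ m x‖ ≤ D * decayMass n p * (2 * ‖x‖) ^ (-(n + d)) := by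
  set h : Eu n := (2 * ‖x‖ ^ 2)⁻¹ • x with hh
  have hnorm : ‖h‖ = (2 * ‖x‖)⁻¹ := by
    rw [hh, norm_smul, Real.norm_of_nonneg (by positivity)]
    field_simp
  have hpos : 0 < ‖h‖ := by rw [hnorm]; positivity
  have hinner : inner ℝ h x = 1 / 2 := by
    rw [hh, real_inner_smul_left, real_inner_self_eq_norm_sq]
    field_simp
  calc ‖𝓕⁻ m x‖ ≤ ∫ ξ, ‖(fwdDiff h)^[K] m ξ‖ := norm_fourierInv_le_integral_fwdDiff hm hinner K
    _ ≤ ∫ ξ : Eu n, D * ‖h‖ ^ d * (1 + ‖ξ‖ / ‖h‖) ^ (-p) :=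
        integral_mono (integrable_iterate_fwdDiff hm h K).norm
          ((integrable_decay_div hp hpos).const_mul _) fun ξ => hb h ξ (norm_pos_iff.1 hpos)
    _ = D * decayMass n p * (‖h‖ ^ d * ‖h‖ ^ n) := by
        rw [integral_const_mul, integral_decay_div hpos]
        ring
    _ = _ := by
        rw [← Real.rpow_natCast, ← Real.rpow_add hpos, hnorm, Real.inv_rpow (by positivity),
          Real.rpow_neg (by positivity), add_comm d]

lemma hasDecay_fourierInv_of_fwdDiff (hm : Integrable m) (hd : 0 ≤ d) (hp : n < p)
    (hb : ∀ h ξ : Eu n, h ≠ 0 →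
      ‖(fwdDiff h)^[K] m ξ‖ ≤ D * ‖h‖ ^ d * (1 + ‖ξ‖ / ‖h‖) ^ (-p)) :
    HasDecay (𝓕⁻ m) (n + d) := by
  refine ⟨max ((∫ ξ, ‖m ξ‖) * 2 ^ (n + d)) (D * decayMass n p), by positivity, fun x => ?_⟩
  rcases le_total ‖x‖ 1 with hx | hx
  · calc ‖𝓕⁻ m x‖ ≤ (∫ ξ, ‖m ξ‖) * 1 := by
          rw [mul_one]
          exact norm_fourierInv_le m x
      _ ≤ (∫ ξ, ‖m ξ‖) * ((1 + 1) ^ (n + d) * (1 + ‖x‖) ^ (-(n + d))) := by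
          gcongr
          exact one_le_rpow_mul_rpow_neg (norm_nonneg x) hx (by positivity)
      _ = (∫ ξ, ‖m ξ‖) * 2 ^ (n + d) * (1 + ‖x‖) ^ (-(n + d)) := by
          rw [one_add_one_eq_two, mul_assoc]
      _ ≤ _ := by gcongr; exact le_max_left _ _
  · have hx0 : x ≠ 0 := norm_pos_iff.1 (by linarith)
    have hbase : (2 * ‖x‖) ^ (-(n + d)) ≤ (1 + ‖x‖) ^ (-(n + d)) :=
      Real.rpow_le_rpow_of_nonpos (by positivity) (by linarith)
        (neg_nonpos.2 (by positivity))
    calc ‖𝓕⁻ m x‖ ≤ D * decayMass n p * (2 * ‖x‖) ^ (-(n + d)) :=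
          norm_fourierInv_le_of_fwdDiff hm hp hb hx0
      _ ≤ _ := by gcongr; exact le_max_right _ _

/-- Terms of `m` that high order differences annihilate are irrelevant for the decay of `𝓕⁻ m`. -/
theorem hasDecay_fourierInv (hm : Integrable m) {l : ℕ} {v : Fin l → Eu n}
    (hv : ∀ i, ‖v i‖ ≤ 1) {g : ℂ → ℂ} {C a : ℝ} (hg : IsRadialSymbol g C a)
    (hdiff : ∀ K, l < K → ∀ h ξ, (fwdDiff h)^[K] m ξ = (fwdDiff h)^[K] (polyRadial v g) ξ) :
    HasDecay (𝓕⁻ m) (n + (l + a)) := by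
  have ha := hg.order_nonneg
  obtain ⟨K, hK⟩ := exists_nat_gt ((n : ℝ) + (l + a))
  have hlK : l < K := by exact_mod_cast (show (l : ℝ) < K by linarith)
  obtain ⟨D, hb⟩ := exists_norm_iterate_fwdDiff_polyRadial_le hv hg (K := K) (by linarith)
  refine hasDecay_fourierInv_of_fwdDiff (K := K) (D := D) (p := K - (l + a)) hm (by positivity)
    (by linarith) fun h ξ hh => ?_
  rw [hdiff K hlK]
  exact hb h ξ hh

end FourierInvDecay

section ExpDecay

variable {b α t : ℝ}

lemma one_add_rpow_le (ht : 0 ≤ t) {p : ℝ} (hp : 0 ≤ p) : (1 + t) ^ p ≤ 2 ^ p * (1 + t ^ p) := by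
  rcases le_total t 1 with h | h
  · calc (1 + t) ^ p ≤ 2 ^ p := Real.rpow_le_rpow (by positivity) (by linarith) hp
      _ ≤ 2 ^ p * (1 + t ^ p) :=
          le_mul_of_one_le_right (by positivity) (by linarith [Real.rpow_nonneg ht p])
  · calc (1 + t) ^ p ≤ (2 * t) ^ p := Real.rpow_le_rpow (by positivity) (by linarith) hp
      _ = 2 ^ p * t ^ p := Real.mul_rpow (by norm_num) ht
      _ ≤ 2 ^ p * (1 + t ^ p) := by gcongr; linarith

lemma rpow_mul_exp_neg_rpow_le (hb : 0 < b) (ht : 0 ≤ t) (k : ℕ) :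
    t ^ (α * k) * Real.exp (-(b * t ^ α)) ≤ k.factorial / b ^ k := by
  have hexp := Real.pow_div_factorial_le_exp (x := b * t ^ α) (by positivity) k
  rw [div_le_iff₀ (by positivity), mul_pow] at hexp
  rw [Real.rpow_mul ht, Real.rpow_natCast, Real.exp_neg, ← div_eq_mul_inv,
    div_le_div_iff₀ (Real.exp_pos _) (by positivity)]
  linarith

lemma exists_exp_neg_rpow_le (hb : 0 < b) (hα : 0 < α) (N : ℝ) :
    ∃ D, 0 ≤ D ∧ ∀ t : ℝ, 0 ≤ t → Real.exp (-(b * t ^ α)) ≤ D * (1 + t) ^ (-N) := by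
  obtain ⟨k, hk⟩ := exists_nat_ge (N / α)
  have hkN : N ≤ α * k := by rwa [div_le_iff₀' hα] at hk
  refine ⟨2 ^ (α * k) * (1 + k.factorial / b ^ k), by positivity, fun t ht => ?_⟩
  rw [Real.rpow_neg (by positivity), ← div_eq_mul_inv, le_div_iff₀ (by positivity)]
  have hexp : Real.exp (-(b * t ^ α)) ≤ 1 := by
    rw [Real.exp_le_one_iff, neg_nonpos]
    positivity
  calc Real.exp (-(b * t ^ α)) * (1 + t) ^ N
      ≤ Real.exp (-(b * t ^ α)) * (2 ^ (α * k) * (1 + t ^ (α * k))) := by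
        gcongr
        exact (Real.rpow_le_rpow_of_exponent_le (by linarith) hkN).trans
          (one_add_rpow_le ht (by positivity))
    _ = 2 ^ (α * k) * (Real.exp (-(b * t ^ α)) + t ^ (α * k) * Real.exp (-(b * t ^ α))) := by
        ring
    _ ≤ 2 ^ (α * k) * (1 + k.factorial / b ^ k) := by
        gcongr
        exact rpow_mul_exp_neg_rpow_le hb ht k

end ExpDecay

section ComplexPower

lemma cpow_re_nonneg {β : ℝ} (hβ0 : 0 ≤ β) (hβ1 : β ≤ 1) {w : ℂ} (hw : 0 ≤ w.re) :
    0 ≤ (w ^ (β : ℂ)).re := by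
  rcases eq_or_ne w 0 with rfl | h0
  · rcases hβ0.eq_or_lt with rfl | h
    · simp
    · rw [Complex.zero_cpow (by exact_mod_cast h.ne')]
      simp
  · have harg : |w.arg * β| ≤ Real.pi / 2 := by
      rw [abs_mul, abs_of_nonneg hβ0]
      exact (mul_le_of_le_one_right (abs_nonneg _) hβ1).trans
        (Complex.abs_arg_le_pi_div_two_iff.2 hw)
    rw [Complex.cpow_def_of_ne_zero h0, Complex.exp_re, Complex.im_mul_ofReal, Complex.log_im]
    exact mul_nonneg (Real.exp_pos _).le
      (Real.cos_nonneg_of_neg_pi_div_two_le_of_le (abs_le.1 harg).1 (abs_le.1 harg).2)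

lemma norm_exp_neg_le_one {z : ℂ} (hz : 0 ≤ z.re) : ‖Complex.exp (-z)‖ ≤ 1 := by
  rw [Complex.norm_exp, Real.exp_le_one_iff]
  simpa using hz

lemma norm_exp_neg_sub_one_le {z : ℂ} (hz : 0 ≤ z.re) : ‖Complex.exp (-z) - 1‖ ≤ 2 * ‖z‖ := by
  rcases le_total ‖z‖ 1 with h | h
  · simpa using Complex.norm_exp_sub_one_le (x := -z) (by simpa using h)
  · have htri := norm_sub_le (Complex.exp (-z)) 1
    rw [norm_one] at htri
    linarith [norm_exp_neg_le_one hz]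

lemma differentiableOn_cpow (β : ℂ) : DifferentiableOn ℂ (fun w : ℂ => w ^ β) {w | 0 < w.re} :=
  fun _ hw =>
    (DifferentiableAt.cpow_const differentiableAt_id (Or.inl hw)).differentiableWithinAt

lemma ofReal_sq_cpow_half {x : ℝ} (hx : 0 ≤ x) (α : ℝ) :
    ((x ^ 2 : ℝ) : ℂ) ^ ((α / 2 : ℝ) : ℂ) = ((x ^ α : ℝ) : ℂ) := by
  rw [← Complex.ofReal_cpow (by positivity), sq_rpow_half hx]

variable {b α : ℝ}

lemma isRadialSymbol_exp_neg_cpow_sub_one (hb : 0 ≤ b) (hα : 0 ≤ α) (hα2 : α ≤ 2) (c : ℂ) :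
    IsRadialSymbol (fun w => c * (Complex.exp (-((b : ℂ) * w ^ ((α / 2 : ℝ) : ℂ))) - 1))
      (‖c‖ * (2 * b)) α where
  const_nonneg := by positivity
  order_nonneg := hα
  differentiableOn := by
    have := differentiableOn_cpow ((α / 2 : ℝ) : ℂ)
    fun_prop
  norm_le w hw := by
    have hre : 0 ≤ ((b : ℂ) * w ^ ((α / 2 : ℝ) : ℂ)).re := by
      rw [Complex.re_ofReal_mul]
      exact mul_nonneg hb (cpow_re_nonneg (by positivity) (by linarith) hw)
    calc _ ≤ ‖c‖ * (2 * ‖(b : ℂ) * w ^ ((α / 2 : ℝ) : ℂ)‖) := by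
          rw [norm_mul]
          gcongr
          exact norm_exp_neg_sub_one_le hre
      _ = ‖c‖ * (2 * b) * ‖w‖ ^ (α / 2) := by
          rw [norm_mul, Complex.norm_cpow_real, Complex.norm_real, Real.norm_of_nonneg hb]
          ring

lemma isRadialSymbol_cpow_mul_exp_neg_cpow (hb : 0 ≤ b) (hα : 0 ≤ α) (hα2 : α ≤ 2) (c : ℂ)
    (k : ℕ) :
    IsRadialSymbol (fun w => c * ((w ^ ((α / 2 : ℝ) : ℂ)) ^ k *
      Complex.exp (-((b : ℂ) * w ^ ((α / 2 : ℝ) : ℂ))))) ‖c‖ (k * α) where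
  const_nonneg := norm_nonneg c
  order_nonneg := by positivity
  differentiableOn := by
    have := differentiableOn_cpow ((α / 2 : ℝ) : ℂ)
    fun_prop
  norm_le w hw := by
    have hre : 0 ≤ ((b : ℂ) * w ^ ((α / 2 : ℝ) : ℂ)).re := by
      rw [Complex.re_ofReal_mul]
      exact mul_nonneg hb (cpow_re_nonneg (by positivity) (by linarith) hw)
    calc _ ≤ ‖c‖ * ‖w ^ ((α / 2 : ℝ) : ℂ)‖ ^ k := by
          rw [norm_mul, norm_mul, norm_pow]
          gcongr
          exact mul_le_of_le_one_right (by positivity) (norm_exp_neg_le_one hre)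
      _ = ‖c‖ * ‖w‖ ^ (k * α / 2) := by
          rw [Complex.norm_cpow_real, ← Real.rpow_mul_natCast (norm_nonneg _)]
          ring_nf

end ComplexPower

section FourierInv

open FourierTransform

section

variable {V : Type*} [NormedAddCommGroup V] [InnerProductSpace ℝ V] [FiniteDimensional ℝ V]
  [MeasurableSpace V] [BorelSpace V] {m : V → ℂ}

lemma fourierInv_eq_fourier_comp_neg (m : V → ℂ) : 𝓕⁻ m = fun x => 𝓕 m (-x) :=
  funext fun x => Real.fourierInv_eq_fourier_neg m x

lemma continuous_fourierInv (hm : Integrable m) : Continuous (𝓕⁻ m) := by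
  rw [fourierInv_eq_fourier_comp_neg]
  exact (continuous_fourier hm).comp continuous_neg

lemma integrable_fourierSMulRight (hm : Integrable m) (hm' : Integrable (fun ξ => ‖ξ‖ * ‖m ξ‖)) :
    Integrable (VectorFourier.fourierSMulRight (innerSL ℝ) m) := by
  refine (hm'.const_mul (2 * Real.pi * ‖(innerSL ℝ : V →L[ℝ] _)‖)).mono'
    hm.1.fourierSMulRight (.of_forall fun ξ => ?_)
  refine (VectorFourier.norm_fourierSMulRight_le (innerSL ℝ) m ξ).trans (le_of_eq ?_)
  ring

lemma hasFDerivAt_fourierInv (hm : Integrable m) (hm' : Integrable (fun ξ => ‖ξ‖ * ‖m ξ‖))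
    (x : V) :
    ∃ L : V →L[ℝ] ℂ, HasFDerivAt (𝓕⁻ m) L x ∧
      ∀ w, L w = 𝓕⁻ (fun ξ => 2 * Real.pi * Complex.I * ((inner ℝ w ξ : ℝ) : ℂ) * m ξ) x := by
  have hderiv := (Real.hasFDerivAt_fourier hm hm' (-x)).comp x (hasFDerivAt_id x).neg
  refine ⟨_, hderiv.congr_of_eventuallyEq
    (.of_forall (congrFun (fourierInv_eq_fourier_comp_neg m))), fun w => ?_⟩
  rw [Real.fourierInv_eq_fourier_neg]
  simp only [ContinuousLinearMap.comp_apply, neg_apply, ContinuousLinearMap.id_apply]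
  rw [Real.fourier_eq, Real.fourier_eq, ContinuousLinearMap.integral_apply
    ((Real.fourierIntegral_convergent_iff (-x)).2 (integrable_fourierSMulRight hm hm'))]
  refine integral_congr_ae (.of_forall fun ξ => ?_)
  have hinner : (innerSL ℝ ξ : V →L[ℝ] ℝ) w = inner ℝ w ξ := by
    rw [innerSL_apply_apply, real_inner_comm]
  simp [VectorFourier.fourierSMulRight_apply, Circle.smul_def, hinner]
  ring

lemma fourierInv_sub_eq_fourier (m : V → ℂ) (u w : V) :
    𝓕⁻ m (u - w) = 𝓕 (fun ξ => Real.fourierChar (inner ℝ ξ u) • m ξ) w := by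
  rw [Real.fourierInv_eq, Real.fourier_eq]
  refine integral_congr_ae (.of_forall fun ξ => ?_)
  simp only
  rw [smul_smul, ← AddChar.map_add_eq_mul, inner_sub_right]
  ring_nf

end

variable {n : ℕ}

lemma norm_le_sum_norm_apply_single {E : Type*} [SeminormedAddCommGroup E] [NormedSpace ℝ E]
    (L : Eu n →L[ℝ] E) : ‖L‖ ≤ ∑ i, ‖L (EuclideanSpace.single i 1)‖ := by
  refine L.opNorm_le_bound (Finset.sum_nonneg fun i _ => norm_nonneg _) fun x => ?_
  have hx : x = ∑ i, x i • EuclideanSpace.single i (1 : ℝ) := by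
    ext j
    simp [Pi.single_apply]
  conv_lhs => rw [hx]
  rw [map_sum, Finset.sum_mul]
  refine (norm_sum_le _ _).trans (Finset.sum_le_sum fun i _ => ?_)
  rw [map_smul, norm_smul, mul_comm]
  gcongr
  exact PiLp.norm_apply_le x i

lemma hasDecay_of_apply_single {E : Type*} [SeminormedAddCommGroup E] [NormedSpace ℝ E]
    {F : Eu n → (Eu n →L[ℝ] E)} {N : ℝ}
    (h : ∀ i, HasDecay (fun x => F x (EuclideanSpace.single i 1)) N) : HasDecay F N := by
  choose D hD h using h
  refine ⟨∑ i, D i, Finset.sum_nonneg fun i _ => hD i, fun u => ?_⟩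
  refine (norm_le_sum_norm_apply_single _).trans ?_
  rw [Finset.sum_mul]
  exact Finset.sum_le_sum fun i _ => h i u

end FourierInv

section StableMultiplier

open FourierTransform

/-- The multiplier `c · ∏ ⟨vᵢ, ξ⟩ · |ξ|^(kα) · exp(-b |ξ|^α)`. This family is closed under
directional derivatives of the inverse Fourier transform (a further `vᵢ`), under Euler's operator
(a further power of `|ξ|^α`) and under products (twice the `b`), and so contains all the symbols
which occur for the stable density. -/
def stableMultiplier {n l : ℕ} (b α : ℝ) (c : ℂ) (v : Fin l → Eu n) (k : ℕ) (ξ : Eu n) : ℂ :=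
  c * (∏ i, ((inner ℝ (v i) ξ : ℝ) : ℂ)) *
    (((‖ξ‖ ^ α) ^ k * Real.exp (-(b * ‖ξ‖ ^ α)) : ℝ) : ℂ)

variable {n l : ℕ} {b α : ℝ} {v : Fin l → Eu n}

lemma continuous_stableMultiplier (hα : 0 ≤ α) (c : ℂ) (v : Fin l → Eu n) (k : ℕ) :
    Continuous (stableMultiplier b α c v k) := by
  have : Continuous (fun ξ : Eu n => ‖ξ‖ ^ α) :=
    continuous_norm.rpow_const fun _ => Or.inr hα
  unfold stableMultiplier
  fun_prop

lemma norm_stableMultiplier_le (hα : 0 ≤ α) (c : ℂ) (hv : ∀ i, ‖v i‖ ≤ 1) (k : ℕ) (ξ : Eu n) :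
    ‖stableMultiplier b α c v k ξ‖ ≤ ‖c‖ * (‖ξ‖ ^ (l + k * α) * Real.exp (-(b * ‖ξ‖ ^ α))) := by
  have hprod := norm_prod_inner_le hv ξ
  rw [stableMultiplier, norm_mul, norm_mul, Complex.norm_real, Real.norm_of_nonneg (by positivity),
    Real.rpow_add_of_nonneg (norm_nonneg _) (by positivity) (by positivity), Real.rpow_natCast,
    mul_comm (k : ℝ) α, Real.rpow_mul (norm_nonneg _), Real.rpow_natCast]
  calc _ ≤ ‖c‖ * ‖ξ‖ ^ l * ((‖ξ‖ ^ α) ^ k * Real.exp (-(b * ‖ξ‖ ^ α))) := by gcongr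
    _ = _ := by ring

lemma exists_norm_stableMultiplier_le (hb : 0 < b) (hα : 0 < α) (c : ℂ) (hv : ∀ i, ‖v i‖ ≤ 1)
    (k : ℕ) {s : ℝ} (hs0 : 0 ≤ s) (hs : s ≤ l + k * α) (N : ℝ) :
    ∃ D, 0 ≤ D ∧ ∀ ξ, ‖stableMultiplier b α c v k ξ‖ ≤ D * (‖ξ‖ ^ s * (1 + ‖ξ‖) ^ (-N)) := by
  set r := l + k * α - s
  obtain ⟨D, hD, h⟩ := exists_exp_neg_rpow_le hb hα (N + r)
  refine ⟨‖c‖ * D, by positivity, fun ξ => (norm_stableMultiplier_le hα.le c hv k ξ).trans ?_⟩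
  rw [mul_assoc]
  refine mul_le_mul_of_nonneg_left ?_ (norm_nonneg c)
  calc ‖ξ‖ ^ (l + k * α) * Real.exp (-(b * ‖ξ‖ ^ α))
      = ‖ξ‖ ^ s * ‖ξ‖ ^ r * Real.exp (-(b * ‖ξ‖ ^ α)) := by
        rw [← Real.rpow_add_of_nonneg (norm_nonneg _) hs0 (by linarith), add_sub_cancel]
    _ ≤ ‖ξ‖ ^ s * (1 + ‖ξ‖) ^ r * (D * (1 + ‖ξ‖) ^ (-(N + r))) := by
        gcongr
        · linarith
        · exact h _ (norm_nonneg _)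
    _ = D * (‖ξ‖ ^ s * ((1 + ‖ξ‖) ^ r * (1 + ‖ξ‖) ^ (-(N + r)))) := by ring
    _ = D * (‖ξ‖ ^ s * (1 + ‖ξ‖) ^ (-N)) := by
        rw [← Real.rpow_add (by positivity)]
        ring_nf

lemma hasDecay_stableMultiplier (hb : 0 < b) (hα : 0 < α) (c : ℂ) (hv : ∀ i, ‖v i‖ ≤ 1) (k : ℕ)
    (N : ℝ) : HasDecay (stableMultiplier b α c v k) N := by
  obtain ⟨D, hD, h⟩ := exists_norm_stableMultiplier_le hb hα c hv k le_rfl (by positivity) N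
  exact ⟨D, hD, fun ξ => by simpa using h ξ⟩

lemma integrable_stableMultiplier (hb : 0 < b) (hα : 0 < α) (c : ℂ) (hv : ∀ i, ‖v i‖ ≤ 1)
    (k : ℕ) : Integrable (stableMultiplier b α c v k) :=
  (hasDecay_stableMultiplier hb hα c hv k (n + 1)).integrable (by linarith)
    (continuous_stableMultiplier hα.le c v k)

lemma integrable_norm_mul_stableMultiplier (hb : 0 < b) (hα : 0 < α) (c : ℂ)
    (hv : ∀ i, ‖v i‖ ≤ 1) (k : ℕ) :
    Integrable (fun ξ => ‖ξ‖ * ‖stableMultiplier b α c v k ξ‖) := by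
  obtain ⟨D, hD, h⟩ := hasDecay_stableMultiplier hb hα c hv k (n + 2)
  have hcont := continuous_norm.mul (continuous_stableMultiplier (b := b) hα.le c v k).norm
  refine HasDecay.integrable (N := n + 1) ⟨D, hD, fun ξ => ?_⟩ (by linarith) hcont
  rw [Real.norm_of_nonneg (by positivity)]
  calc ‖ξ‖ * ‖stableMultiplier b α c v k ξ‖
      ≤ (1 + ‖ξ‖) * (D * (1 + ‖ξ‖) ^ (-((n : ℝ) + 2))) := by
        gcongr
        · linarith
        · exact h ξ
    _ = D * ((1 + ‖ξ‖) ^ (1 : ℝ) * (1 + ‖ξ‖) ^ (-((n : ℝ) + 2))) := by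
        rw [Real.rpow_one]
        ring
    _ = D * (1 + ‖ξ‖) ^ (-((n : ℝ) + 1)) := by
        rw [← Real.rpow_add (by positivity)]
        ring_nf

lemma stableMultiplier_eq_polyRadial (c : ℂ) (v : Fin l → Eu n) (k : ℕ) :
    stableMultiplier b α c v k = polyRadial v (fun w => c * ((w ^ ((α / 2 : ℝ) : ℂ)) ^ k *
      Complex.exp (-((b : ℂ) * w ^ ((α / 2 : ℝ) : ℂ))))) := by
  funext ξ
  simp only [stableMultiplier, polyRadial, ofReal_sq_cpow_half (norm_nonneg ξ)]
  push_cast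
  ring

lemma stableMultiplier_zero_eq_polyRadial_add (c : ℂ) (v : Fin l → Eu n) :
    stableMultiplier b α c v 0 =
      polyRadial v (fun w => c * (Complex.exp (-((b : ℂ) * w ^ ((α / 2 : ℝ) : ℂ))) - 1)) +
        c • (fun ξ => ∏ i, ((inner ℝ (v i) ξ : ℝ) : ℂ)) := by
  funext ξ
  simp only [stableMultiplier, polyRadial, Pi.add_apply, Pi.smul_apply, smul_eq_mul,
    ofReal_sq_cpow_half (norm_nonneg ξ)]
  push_cast
  ring

-- Subtracting the polynomial `c ∏ ⟨vᵢ, ξ⟩`, which high differences annihilate, makes the symbol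
-- vanish to order `α` at the origin.
lemma hasDecay_fourierInv_stableMultiplier_zero (hb : 0 < b) (hα : 0 < α) (hα2 : α ≤ 2) (c : ℂ)
    (hv : ∀ i, ‖v i‖ ≤ 1) : HasDecay (𝓕⁻ (stableMultiplier b α c v 0)) (n + (l + α)) := by
  refine hasDecay_fourierInv (integrable_stableMultiplier hb hα c hv 0) hv
    (isRadialSymbol_exp_neg_cpow_sub_one hb.le hα.le hα2 c) fun K hK h ξ => ?_
  rw [stableMultiplier_zero_eq_polyRadial_add, fwdDiff_iter_add, fwdDiff_iter_const_smul,
    Pi.add_apply, Pi.smul_apply, iterate_fwdDiff_prod_inner v hK, smul_zero, add_zero]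

theorem hasDecay_fourierInv_stableMultiplier (hb : 0 < b) (hα : 0 < α) (hα2 : α ≤ 2) (c : ℂ)
    (hv : ∀ i, ‖v i‖ ≤ 1) (k : ℕ) :
    HasDecay (𝓕⁻ (stableMultiplier b α c v k)) (n + (l + α)) := by
  rcases Nat.eq_zero_or_pos k with rfl | hk
  · exact hasDecay_fourierInv_stableMultiplier_zero hb hα hα2 c hv
  · have hk1 : (1 : ℝ) ≤ k := by exact_mod_cast hk
    have hdecay := hasDecay_fourierInv (integrable_stableMultiplier hb hα c hv k) hv
      (isRadialSymbol_cpow_mul_exp_neg_cpow hb.le hα.le hα2 c k) fun K _ h ξ => by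
        rw [stableMultiplier_eq_polyRadial]
    exact hdecay.mono (by linarith [le_mul_of_one_le_left hα.le hk1])

lemma two_pi_I_mul_stableMultiplier (c : ℂ) (v : Fin l → Eu n) (k : ℕ) (w : Eu n) :
    (fun ξ => 2 * Real.pi * Complex.I * ((inner ℝ w ξ : ℝ) : ℂ) *
      stableMultiplier b α c v k ξ) =
      stableMultiplier b α (2 * Real.pi * Complex.I * c) (Fin.cons w v : Fin (l + 1) → Eu n) k := by
  funext ξ
  simp only [stableMultiplier, Fin.prod_univ_succ, Fin.cons_zero, Fin.cons_succ]
  ring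

lemma differentiable_fourierInv_stableMultiplier (hb : 0 < b) (hα : 0 < α) (c : ℂ)
    (hv : ∀ i, ‖v i‖ ≤ 1) (k : ℕ) : Differentiable ℝ (𝓕⁻ (stableMultiplier b α c v k)) :=
  fun x =>
    let ⟨_, hL, _⟩ := hasFDerivAt_fourierInv (integrable_stableMultiplier hb hα c hv k)
      (integrable_norm_mul_stableMultiplier hb hα c hv k) x
    hL.differentiableAt

lemma fderiv_fourierInv_stableMultiplier (hb : 0 < b) (hα : 0 < α) (c : ℂ)
    (hv : ∀ i, ‖v i‖ ≤ 1) (k : ℕ) (x w : Eu n) :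
    fderiv ℝ (𝓕⁻ (stableMultiplier b α c v k)) x w =
      𝓕⁻ (stableMultiplier b α (2 * Real.pi * Complex.I * c)
        (Fin.cons w v : Fin (l + 1) → Eu n) k) x := by
  obtain ⟨L, hL, h⟩ := hasFDerivAt_fourierInv (integrable_stableMultiplier hb hα c hv k)
    (integrable_norm_mul_stableMultiplier hb hα c hv k) x
  rw [hL.fderiv, h, two_pi_I_mul_stableMultiplier]

lemma hasDecay_fderiv_fourierInv_stableMultiplier (hb : 0 < b) (hα : 0 < α) (hα2 : α ≤ 2) (c : ℂ)
    (hv : ∀ i, ‖v i‖ ≤ 1) (k : ℕ) :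
    HasDecay (fderiv ℝ (𝓕⁻ (stableMultiplier b α c v k))) (n + 1 + α) := by
  refine hasDecay_of_apply_single fun i => ?_
  simp only [fderiv_fourierInv_stableMultiplier hb hα c hv k]
  refine (hasDecay_fourierInv_stableMultiplier hb hα hα2 _
    (Fin.cases (by simp) fun j => by simpa using hv j) k).mono ?_
  push_cast
  linarith

lemma integrable_fourierInv_stableMultiplier (hb : 0 < b) (hα : 0 < α) (hα2 : α ≤ 2) (c : ℂ)
    (hv : ∀ i, ‖v i‖ ≤ 1) (k : ℕ) : Integrable (𝓕⁻ (stableMultiplier b α c v k)) :=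
  (hasDecay_fourierInv_stableMultiplier hb hα hα2 c hv k).integrable (by linarith)
    (continuous_fourierInv (integrable_stableMultiplier hb hα c hv k))

lemma fourier_fourierInv_stableMultiplier (hb : 0 < b) (hα : 0 < α) (hα2 : α ≤ 2) (c : ℂ)
    (hv : ∀ i, ‖v i‖ ≤ 1) (k : ℕ) :
    𝓕 (𝓕⁻ (stableMultiplier b α c v k)) = stableMultiplier b α c v k := by
  refine (continuous_stableMultiplier hα.le c v k).fourier_fourierInv_eq
    (integrable_stableMultiplier hb hα c hv k) ?_
  refine (integrable_fourierInv_stableMultiplier hb hα hα2 c hv k).comp_neg.congr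
    (.of_forall fun x => ?_)
  simp [Real.fourierInv_eq_fourier_neg]

lemma isProfile_fourierInv_stableMultiplier (hb : 0 < b) (hα : 0 < α) (hα2 : α ≤ 2) (c : ℂ)
    (hv : ∀ i, ‖v i‖ ≤ 1) {k : ℕ} (hlk : 1 ≤ l + k) :
    IsProfile (𝓕⁻ (stableMultiplier b α c v k)) α where
  continuous := continuous_fourierInv (integrable_stableMultiplier hb hα c hv k)
  decay := (hasDecay_fourierInv_stableMultiplier hb hα hα2 c hv k).mono (by linarith)
  fourier := by
    rw [fourier_fourierInv_stableMultiplier hb hα hα2 c hv k]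
    refine exists_norm_stableMultiplier_le hb hα c hv k (by positivity) ?_ α
    have h : (1 : ℝ) ≤ l + k := by exact_mod_cast hlk
    nlinarith

lemma correlation_fourierInv {m Q : Eu n → ℂ} (hm : Integrable m) (hQ : Integrable Q) :
    correlation (𝓕⁻ m) Q = 𝓕⁻ (fun ξ => m ξ * 𝓕 Q (-ξ)) := by
  funext u
  have hfourier (ξ : Eu n) : 𝓕 (fun x => Q (-x)) ξ = 𝓕 Q (-ξ) := by
    rw [Real.fourier_eq, Real.fourier_eq, ← integral_neg_eq_self]
    simp
  calc correlation (𝓕⁻ m) Q u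
      = ∫ w, 𝓕⁻ m (u - w) * Q (-w) := by
        rw [correlation, ← integral_neg_eq_self]
        simp only [neg_add_eq_sub]
    _ = ∫ w, 𝓕 (fun ξ => Real.fourierChar (inner ℝ ξ u) • m ξ) w * Q (-w) := by
        simp only [fourierInv_sub_eq_fourier]
    _ = ∫ ξ, Real.fourierChar (inner ℝ ξ u) • m ξ * 𝓕 (fun x => Q (-x)) ξ :=
        integral_fourier_mul_eq (integrable_fourierChar_smul hm u) hQ.comp_neg
    _ = 𝓕⁻ (fun ξ => m ξ * 𝓕 Q (-ξ)) u := by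
        rw [Real.fourierInv_eq]
        simp only [hfourier, smul_mul_assoc]

lemma stableMultiplier_mul_stableMultiplier_neg {l' : ℕ} (c c' : ℂ) (v : Fin l → Eu n)
    (v' : Fin l' → Eu n) (k k' : ℕ) (ξ : Eu n) :
    stableMultiplier b α c v k ξ * stableMultiplier b α c' v' k' (-ξ) =
      stableMultiplier (2 * b) α (c * c' * (-1) ^ l') (Fin.append v v') (k + k') ξ := by
  have hprod : ∏ i, ((inner ℝ (v' i) (-ξ) : ℝ) : ℂ) =
      (-1) ^ l' * ∏ i, ((inner ℝ (v' i) ξ : ℝ) : ℂ) := by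
    simp [inner_neg_right, Finset.prod_neg]
  have hexp : Real.exp (-(2 * b * ‖ξ‖ ^ α)) =
      Real.exp (-(b * ‖ξ‖ ^ α)) * Real.exp (-(b * ‖ξ‖ ^ α)) := by
    rw [← Real.exp_add]
    ring_nf
  simp only [stableMultiplier, Fin.prod_univ_add, Fin.append_left, Fin.append_right, hprod,
    norm_neg, hexp, pow_add]
  push_cast
  ring

lemma correlation_fourierInv_stableMultiplier (hb : 0 < b) (hα : 0 < α) (hα2 : α ≤ 2) {l' : ℕ}
    (c c' : ℂ) {v' : Fin l' → Eu n} (hv : ∀ i, ‖v i‖ ≤ 1) (hv' : ∀ i, ‖v' i‖ ≤ 1) (k k' : ℕ) :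
    correlation (𝓕⁻ (stableMultiplier b α c v k)) (𝓕⁻ (stableMultiplier b α c' v' k')) =
      𝓕⁻ (stableMultiplier (2 * b) α (c * c' * (-1) ^ l') (Fin.append v v') (k + k')) := by
  rw [correlation_fourierInv (integrable_stableMultiplier hb hα c hv k)
      (integrable_fourierInv_stableMultiplier hb hα hα2 c' hv' k'),
    fourier_fourierInv_stableMultiplier hb hα hα2 c' hv' k']
  simp only [stableMultiplier_mul_stableMultiplier_neg]

/-- `P` is the inverse Fourier transform of a multiplier `stableMultiplier b α c v k` that vanishes
at the origin. The components of the gradient of the stable density are of this form. -/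
def IsStableProfile (b α : ℝ) (P : Eu n → ℂ) : Prop :=
  ∃ (l : ℕ) (c : ℂ) (v : Fin l → Eu n) (k : ℕ), (∀ i, ‖v i‖ ≤ 1) ∧ 1 ≤ l + k ∧
    P = 𝓕⁻ (stableMultiplier b α c v k)

lemma IsStableProfile.isProfile (hb : 0 < b) (hα : 0 < α) (hα2 : α ≤ 2) {P : Eu n → ℂ}
    (hP : IsStableProfile b α P) : IsProfile P α := by
  obtain ⟨l, c, v, k, hv, hlk, rfl⟩ := hP
  exact isProfile_fourierInv_stableMultiplier hb hα hα2 c hv hlk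

/-- For coefficients that depend on the height only, the slice kernel is a dilate of the
correlation of the two profiles, and this is smooth enough for every pair of profiles. -/
lemma IsStableProfile.hasGradBound (hb : 0 < b) (hα : 0 < α) (hα2 : α ≤ 2) {P Q : Eu n → ℂ}
    (hP : IsStableProfile b α P) (hQ : IsStableProfile b α Q) :
    HasGradBound (fun a => ∀ x x' y, a x y = a x' y) P Q α := by
  obtain ⟨l, c, v, k, hv, -, rfl⟩ := hP
  obtain ⟨l', c', v', k', hv', -, rfl⟩ := hQ
  have happend : ∀ i, ‖Fin.append v v' i‖ ≤ 1 :=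
    Fin.addCases (fun i => by simpa using hv i) fun i => by simpa using hv' i
  have hcorr := correlation_fourierInv_stableMultiplier hb hα hα2 c c' hv hv' k k'
  refine hasGradBound_of_correlation ?_ ?_ <;> rw [hcorr]
  · exact differentiable_fourierInv_stableMultiplier (by positivity) hα _ happend _
  · exact hasDecay_fderiv_fourierInv_stableMultiplier (by positivity) hα hα2 _ happend _

lemma hasGradBound_fourierInv_stableMultiplier (hb : 0 < b) (hα : 0 < α) (hα2 : α ≤ 2) {l' : ℕ}
    (hl : 1 ≤ l) (hl' : 1 ≤ l') (c c' : ℂ) {v' : Fin l' → Eu n} (hv : ∀ i, ‖v i‖ ≤ 1)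
    (hv' : ∀ i, ‖v' i‖ ≤ 1) (k k' : ℕ) :
    HasGradBound (fun _ => True) (𝓕⁻ (stableMultiplier b α c v k))
      (𝓕⁻ (stableMultiplier b α c' v' k')) α := by
  have hl1 : (1 : ℝ) ≤ l := by exact_mod_cast hl
  have hl1' : (1 : ℝ) ≤ l' := by exact_mod_cast hl'
  exact hasGradBound_of_decay hα
    (differentiable_fourierInv_stableMultiplier hb hα c hv k)
    ((hasDecay_fourierInv_stableMultiplier hb hα hα2 c hv k).mono (by linarith))
    (hasDecay_fderiv_fourierInv_stableMultiplier hb hα hα2 c hv k)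
    (differentiable_fourierInv_stableMultiplier hb hα c' hv' k')
    ((hasDecay_fourierInv_stableMultiplier hb hα hα2 c' hv' k').mono (by linarith))
    (hasDecay_fderiv_fourierInv_stableMultiplier hb hα hα2 c' hv' k')

end StableMultiplier

section Density

open FourierTransform

section Dilation

variable {n l : ℕ} {b α : ℝ}

lemma fourierInv_comp_smul (m : Eu n → ℂ) {s : ℝ} (hs : 0 < s) (x : Eu n) :
    𝓕⁻ (fun ξ => m (s • ξ)) x = (((s ^ n)⁻¹ : ℝ) : ℂ) * 𝓕⁻ m (s⁻¹ • x) := by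
  have hscale := Measure.integral_comp_smul_of_nonneg volume
    (fun w : Eu n => Real.fourierChar (inner ℝ w (s⁻¹ • x)) • m w) s (hR := hs.le)
  rw [finrank_euclideanSpace_fin, Complex.real_smul] at hscale
  rw [Real.fourierInv_eq, Real.fourierInv_eq, ← hscale]
  simp only [real_inner_smul_left, inner_smul_right, inv_mul_cancel_left₀ hs.ne']

lemma stableMultiplier_const_mul (a c : ℂ) (v : Fin l → Eu n) (k : ℕ) :
    stableMultiplier b α (a * c) v k = fun ξ => a * stableMultiplier b α c v k ξ := by
  funext ξ
  simp only [stableMultiplier]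
  ring

lemma fourierInv_const_mul (a : ℂ) (m : Eu n → ℂ) (x : Eu n) :
    𝓕⁻ (fun ξ => a * m ξ) x = a * 𝓕⁻ m x := by
  simp only [Real.fourierInv_eq, ← smul_eq_mul, smul_comm _ a, integral_smul]

lemma stableMultiplier_smul (c : ℂ) (v : Fin l → Eu n) (k : ℕ) {s : ℝ} (hs : 0 ≤ s) (ξ : Eu n) :
    stableMultiplier b α c v k (s • ξ) =
      ((s ^ l * (s ^ α) ^ k : ℝ) : ℂ) * stableMultiplier (b * s ^ α) α c v k ξ := by
  simp only [stableMultiplier, inner_smul_right, norm_smul, Real.norm_of_nonneg hs,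
    Real.mul_rpow hs (norm_nonneg ξ), Complex.ofReal_mul s, Finset.prod_mul_distrib,
    Finset.prod_const, Finset.card_univ, Fintype.card_fin, mul_assoc b]
  push_cast
  ring

lemma fourierInv_stableMultiplier_inv_smul (c : ℂ) (v : Fin l → Eu n) (k : ℕ) {s : ℝ}
    (hs : 0 < s) (x : Eu n) :
    (((s ^ n)⁻¹ : ℝ) : ℂ) * 𝓕⁻ (stableMultiplier b α c v k) (s⁻¹ • x) =
      ((s ^ l * (s ^ α) ^ k : ℝ) : ℂ) * 𝓕⁻ (stableMultiplier (b * s ^ α) α c v k) x := by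
  rw [← fourierInv_comp_smul _ hs, ← fourierInv_const_mul]
  simp only [stableMultiplier_smul c v k hs.le]

lemma inv_pow_succ_mul_fourierInv_stableMultiplier (c : ℂ) (v : Fin l → Eu n) (k : ℕ) {s : ℝ}
    (hs : 0 < s) (x : Eu n) :
    (((s ^ (n + 1))⁻¹ : ℝ) : ℂ) * 𝓕⁻ (stableMultiplier b α c v k) (s⁻¹ • x) =
      ((s⁻¹ * (s ^ l * (s ^ α) ^ k) : ℝ) : ℂ) * 𝓕⁻ (stableMultiplier (b * s ^ α) α c v k) x := by
  rw [pow_succ', mul_inv, Complex.ofReal_mul, mul_assoc,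
    fourierInv_stableMultiplier_inv_smul c v k hs, ← mul_assoc, ← Complex.ofReal_mul]

lemma hasDerivAt_stableMultiplier (c : ℂ) (v : Fin l → Eu n) (k : ℕ) (ξ : Eu n) :
    HasDerivAt (fun b => stableMultiplier b α c v k ξ) (stableMultiplier b α (-c) v (k + 1) ξ)
      b := by
  have hexp : HasDerivAt (fun b => (‖ξ‖ ^ α) ^ k * Real.exp (-(b * ‖ξ‖ ^ α)))
      ((‖ξ‖ ^ α) ^ k * (Real.exp (-(b * ‖ξ‖ ^ α)) * -(1 * ‖ξ‖ ^ α))) b :=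
    ((((hasDerivAt_id b).mul_const _).neg).exp).const_mul _
  refine (hexp.ofReal_comp.const_mul _).congr_deriv ?_
  simp only [stableMultiplier]
  push_cast
  ring

lemma norm_stableMultiplier_anti {b' : ℝ} (h : b ≤ b') (c : ℂ) (v : Fin l → Eu n) (k : ℕ)
    (ξ : Eu n) : ‖stableMultiplier b' α c v k ξ‖ ≤ ‖stableMultiplier b α c v k ξ‖ := by
  simp only [stableMultiplier, norm_mul, Complex.norm_real, Real.norm_eq_abs, Real.abs_exp]
  gcongr

lemma hasDerivAt_fourierInv_stableMultiplier (hb : 0 < b) (hα : 0 < α) (c : ℂ)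
    {v : Fin l → Eu n} (hv : ∀ i, ‖v i‖ ≤ 1) (k : ℕ) (x : Eu n) :
    HasDerivAt (fun b => 𝓕⁻ (stableMultiplier b α c v k) x)
      (𝓕⁻ (stableMultiplier b α (-c) v (k + 1)) x) b := by
  have hint {b : ℝ} (hb : 0 < b) (c : ℂ) (k : ℕ) := integrable_fourierChar_smul
    (integrable_stableMultiplier (α := α) hb hα c hv k) x
  simp only [Real.fourierInv_eq]
  refine (hasDerivAt_integral_of_dominated_loc_of_deriv_le
    (bound := fun ξ => ‖stableMultiplier (b / 2) α (-c) v (k + 1) ξ‖)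
    (F' := fun b ξ => Real.fourierChar (inner ℝ ξ x) • stableMultiplier b α (-c) v (k + 1) ξ)
    (Ioi_mem_nhds (half_lt_self hb))
    ((lt_mem_nhds hb).mono fun b' hb' => (hint hb' c k).1) (hint hb c k)
    (hint hb (-c) (k + 1)).1 (.of_forall fun ξ b' hb' => ?_)
    (integrable_stableMultiplier (by positivity) hα (-c) hv (k + 1)).norm
    (.of_forall fun ξ b' _ => (hasDerivAt_stableMultiplier c v k ξ).const_smul _)).2
  rw [Circle.norm_smul]
  exact norm_stableMultiplier_anti (mem_Ioi.1 hb').le _ _ _ ξ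

end Dilation

variable {n : ℕ}

lemma IsContDensity.integrable {Ω : Type*} [MeasurableSpace Ω] {P : Measure Ω}
    [IsFiniteMeasure P] {Y : Ω → Eu n} {φ : Eu n → ℝ} (hφ : IsContDensity φ Y P) :
    Integrable φ := by
  refine ⟨hφ.continuous.aestronglyMeasurable, ?_⟩
  have hfinite := measure_lt_top (P.map Y) univ
  rwa [hφ.map_eq, withDensity_apply _ MeasurableSet.univ, Measure.restrict_univ,
    ← hasFiniteIntegral_iff_ofReal (.of_forall hφ.nonneg)] at hfinite

lemma IsContDensity.fourier_eq {Ω : Type*} [MeasurableSpace Ω] {P : Measure Ω}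
    {Y : Ω → Eu n} {φ : Eu n → ℝ} (hφ : IsContDensity φ Y P) (ξ : Eu n) :
    𝓕 (fun x => (φ x : ℂ)) ξ = charFun (P.map Y) (-(2 * Real.pi) • ξ) := by
  rw [charFun_apply, hφ.map_eq, integral_withDensity_eq_integral_toReal_smul
    hφ.continuous.measurable.ennreal_ofReal (.of_forall fun x => ENNReal.ofReal_lt_top),
    Real.fourier_eq]
  refine integral_congr_ae (.of_forall fun x => ?_)
  simp only
  rw [ENNReal.toReal_ofReal (hφ.nonneg x), Circle.smul_def, Real.fourierChar_apply,
    inner_smul_right, Complex.real_smul, smul_eq_mul, mul_comm]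
  congr 3
  push_cast
  ring

lemma ofReal_density_eq_fourierInv {Ω : Type*} [MeasurableSpace Ω] {P : Measure Ω}
    [IsFiniteMeasure P] {X : ℝ≥0 → Ω → Eu n} {α : ℝ} (hα : 0 < α)
    (hX : IsRotInvStable α X P) {φ : Eu n → ℝ} (hφ : IsContDensity φ (X 1) P) :
    (fun x => (φ x : ℂ)) = 𝓕⁻ (stableMultiplier ((2 * Real.pi) ^ α) α 1 ![] 0) := by
  have hF : 𝓕 (fun x => (φ x : ℂ)) = stableMultiplier ((2 * Real.pi) ^ α) α 1 ![] 0 := by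
    funext ξ
    rw [hφ.fourier_eq, hX.charFun_eq, norm_smul, norm_neg, Real.norm_of_nonneg (by positivity),
      Real.mul_rpow (by positivity) (norm_nonneg _), stableMultiplier]
    simp
  have hint := integrable_stableMultiplier (n := n) (b := (2 * Real.pi) ^ α) (by positivity) hα 1
    (v := ![]) finZeroElim 0
  rw [← hF] at hint ⊢
  exact ((Complex.continuous_ofReal.comp hφ.continuous).fourierInv_fourier_eq
    hφ.integrable.ofReal hint).symm

lemma ofReal_fderiv_apply {E : Type*} [NormedAddCommGroup E] [NormedSpace ℝ E] {f : E → ℝ}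
    {x : E} (hf : DifferentiableAt ℝ (fun z => (f z : ℂ)) x) (w : E) :
    ((fderiv ℝ f x w : ℝ) : ℂ) = fderiv ℝ (fun z => (f z : ℂ)) x w := by
  have hre : DifferentiableAt ℝ f x := Complex.reCLM.differentiableAt.comp x hf
  have hcomp : HasFDerivAt (fun z => (f z : ℂ)) (Complex.ofRealCLM ∘SL fderiv ℝ f x) x :=
    Complex.ofRealCLM.hasFDerivAt.comp x hre.hasFDerivAt
  rw [hcomp.fderiv]
  rfl

lemma ofReal_deriv {f : ℝ → ℝ} {y : ℝ} (hf : DifferentiableAt ℝ (fun s => (f s : ℂ)) y) :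
    ((deriv f y : ℝ) : ℂ) = deriv (fun s => (f s : ℂ)) y := by
  rw [← fderiv_apply_one_eq_deriv, ofReal_fderiv_apply hf, fderiv_apply_one_eq_deriv]

/-- The profiles of the full gradient of `φ_y`, where `φ` has Fourier transform `exp(-b |ξ|^α)`:
the space derivatives and, last, the derivative in the height. -/
def stableProfile (n : ℕ) (b α : ℝ) : Fin (n + 1) → Eu n → ℂ :=
  Fin.snoc (α := fun _ => Eu n → ℂ)
    (fun i : Fin n => 𝓕⁻ (stableMultiplier b α (2 * Real.pi * Complex.I)
      ![EuclideanSpace.single i 1] 0))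
    (𝓕⁻ (stableMultiplier b α (-(α * b)) ![] 1))

variable {b α : ℝ}

lemma norm_vecSingle_single_le (i : Fin n) (j : Fin 1) :
    ‖(![EuclideanSpace.single i (1 : ℝ)] : Fin 1 → Eu n) j‖ ≤ 1 := by
  simp

lemma isStableProfile_stableProfile (b α : ℝ) (i : Fin (n + 1)) :
    IsStableProfile b α (stableProfile n b α i) := by
  cases i using Fin.lastCases with
  | last =>
    rw [stableProfile, Fin.snoc_last]
    exact ⟨0, _, _, 1, finZeroElim, le_rfl, rfl⟩
  | cast i =>
    rw [stableProfile, Fin.snoc_castSucc]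
    exact ⟨1, _, _, 0, norm_vecSingle_single_le i, le_rfl, rfl⟩

lemma hasGradBound_stableProfile (hb : 0 < b) (hα : 0 < α) (hα2 : α ≤ 2) (i j : Fin n) :
    HasGradBound (fun _ => True) (stableProfile n b α i.castSucc) (stableProfile n b α j.castSucc)
      α := by
  rw [stableProfile, Fin.snoc_castSucc, Fin.snoc_castSucc]
  exact hasGradBound_fourierInv_stableMultiplier hb hα hα2 le_rfl le_rfl _ _
    (norm_vecSingle_single_le i) (norm_vecSingle_single_le j) _ _

variable {φ : Eu n → ℝ}

lemma ofReal_dil (hφ : (fun x => (φ x : ℂ)) = 𝓕⁻ (stableMultiplier b α 1 ![] 0)) {s : ℝ}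
    (hs : 0 < s) (x : Eu n) :
    (dil φ s x : ℂ) = 𝓕⁻ (stableMultiplier (b * s ^ α) α 1 ![] 0) x := by
  rw [dil, Complex.ofReal_mul, congrFun hφ, fourierInv_stableMultiplier_inv_smul _ _ _ hs]
  simp

lemma ofReal_fderiv_dil (hb : 0 < b) (hα : 0 < α)
    (hφ : (fun x => (φ x : ℂ)) = 𝓕⁻ (stableMultiplier b α 1 ![] 0)) {y : ℝ} (hy : 0 < y)
    (x : Eu n) (i : Fin n) :
    ((fderiv ℝ (dil φ y) x (EuclideanSpace.single i 1) : ℝ) : ℂ) =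
      (((y ^ (n + 1))⁻¹ : ℝ) : ℂ) * stableProfile n b α i.castSucc (y⁻¹ • x) := by
  have hby : 0 < b * y ^ α := by positivity
  have hdil : (fun z => (dil φ y z : ℂ)) = _ := funext (ofReal_dil hφ hy)
  rw [ofReal_fderiv_apply (hdil ▸ differentiable_fourierInv_stableMultiplier hby hα 1
      finZeroElim 0 x), hdil, fderiv_fourierInv_stableMultiplier hby hα 1 finZeroElim 0,
    stableProfile, Fin.snoc_castSucc, inv_pow_succ_mul_fourierInv_stableMultiplier _ _ _ hy,
    pow_one, pow_zero, mul_one, mul_one, inv_mul_cancel₀ hy.ne', Complex.ofReal_one, one_mul]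
  rfl

lemma hasDerivAt_ofReal_dil (hb : 0 < b) (hα : 0 < α)
    (hφ : (fun x => (φ x : ℂ)) = 𝓕⁻ (stableMultiplier b α 1 ![] 0)) {y : ℝ} (hy : 0 < y)
    (x : Eu n) :
    HasDerivAt (fun s => (dil φ s x : ℂ))
      ((((y ^ (n + 1))⁻¹ : ℝ) : ℂ) * stableProfile n b α (Fin.last n) (y⁻¹ • x)) y := by
  have hpow : HasDerivAt (fun s => b * s ^ α) (b * (α * y ^ (α - 1))) y :=
    (Real.hasDerivAt_rpow_const (Or.inl hy.ne')).const_mul b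
  have hcomp := (hasDerivAt_fourierInv_stableMultiplier (v := ![]) (by positivity) hα 1
    finZeroElim 0 x).scomp y hpow
  refine (hcomp.congr_of_eventuallyEq
    ((lt_mem_nhds hy).mono fun s hs => ofReal_dil hφ hs x)).congr_deriv ?_
  have hconst : (-(α * b) : ℂ) = (α * b) * -1 := by ring
  rw [stableProfile, Fin.snoc_last, hconst, inv_pow_succ_mul_fourierInv_stableMultiplier _ _ _ hy,
    stableMultiplier_const_mul, fourierInv_const_mul, Real.rpow_sub_one hy.ne', Complex.real_smul]
  push_cast
  ring

/-- The `i`-th entry of the gradient of `φ_y` at `x` is `y⁻⁽ⁿ⁺¹⁾ Φ i (x / y)`. -/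
def HasGradProfile (φ : Eu n → ℝ) (Φ : Fin (n + 1) → Eu n → ℂ) : Prop :=
  ∀ y, 0 < y → ∀ x i, fullGrad φ y x i = (((y ^ (n + 1))⁻¹ : ℝ) : ℂ) * Φ i (y⁻¹ • x)

theorem hasGradProfile_stableProfile (hb : 0 < b) (hα : 0 < α)
    (hφ : (fun x => (φ x : ℂ)) = 𝓕⁻ (stableMultiplier b α 1 ![] 0)) :
    HasGradProfile φ (stableProfile n b α) := by
  intro y hy x i
  cases i using Fin.lastCases with
  | last =>
    have hderiv := hasDerivAt_ofReal_dil hb hα hφ hy x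
    rw [fullGrad, Fin.snoc_last, ofReal_deriv hderiv.differentiableAt, hderiv.deriv]
  | cast i => rw [fullGrad, Fin.snoc_castSucc, ofReal_fderiv_dil hb hα hφ hy]

theorem IsContDensity.hasGradProfile {Ω : Type*} [MeasurableSpace Ω] {P : Measure Ω}
    [IsFiniteMeasure P] {X : ℝ≥0 → Ω → Eu n} (hα : 0 < α) (hX : IsRotInvStable α X P)
    (hφ : IsContDensity φ (X 1) P) :
    HasGradProfile φ (stableProfile n ((2 * Real.pi) ^ α) α) :=
  hasGradProfile_stableProfile (by positivity) hα (ofReal_density_eq_fourierInv hα hX hφ)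

end Density

section Coefficients

variable {n : ℕ} {A A' : Eu n → ℝ → Matrix (Fin (n + 1)) (Fin (n + 1)) ℂ}

/-- A coefficient matrix with Borel measurable entries that are bounded by `M` and whose last row
and column are independent of `x`, all of this everywhere and not only almost everywhere. -/
structure IsRegularCoeff (A : Eu n → ℝ → Matrix (Fin (n + 1)) (Fin (n + 1)) ℂ) (M : ℝ) : Prop where
  measurable : ∀ i j, Measurable (fun p : Eu n × ℝ => A p.1 p.2 i j)
  norm_le : ∀ i j x y, ‖A x y i j‖ ≤ M
  const_of_last : ∀ i j, (i = Fin.last n ∨ j = Fin.last n) → ∀ x x' y, A x y i j = A x' y i j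

lemma norm_entry_le_norm_toEuclideanCLM {m : ℕ} (A : Matrix (Fin m) (Fin m) ℂ) (i j : Fin m) :
    ‖A i j‖ ≤ ‖Matrix.toEuclideanCLM (n := Fin m) (𝕜 := ℂ) A‖ := by
  have hentry : (Matrix.toEuclideanCLM (n := Fin m) (𝕜 := ℂ) A (EuclideanSpace.single j 1)) i =
      A i j := by
    rw [EuclideanSpace.single, Matrix.toEuclideanCLM_toLp]
    simp
  rw [← hentry]
  refine (PiLp.norm_apply_le _ i).trans ((ContinuousLinearMap.le_opNorm _ _).trans ?_)
  simp

lemma ae_norm_entry_le_coeffNorm (hA : coeffNorm A < ∞) :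
    ∀ᵐ p ∂halfMeasure n, ∀ i j, ‖A p.1 p.2 i j‖ ≤ (coeffNorm A).toReal := by
  filter_upwards [ae_le_eLpNormEssSup (μ := halfMeasure n) (f := fun p : Eu n × ℝ =>
    Matrix.toEuclideanCLM (n := Fin (n + 1)) (𝕜 := ℂ) (A p.1 p.2))] with p hp i j
  refine (norm_entry_le_norm_toEuclideanCLM _ i j).trans ?_
  rw [← toReal_enorm]
  refine ENNReal.toReal_mono hA.ne ?_
  rwa [coeffNorm, eLpNorm_exponent_top]

lemma ae_halfMeasure_snd_pos : ∀ᵐ p ∂halfMeasure n, 0 < p.2 :=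
  Measure.quasiMeasurePreserving_snd.ae (ae_restrict_mem (s := Ioi (0 : ℝ)) measurableSet_Ioi)

lemma ae_ae_of_ae_halfMeasure {p : Eu n × ℝ → Prop} (h : ∀ᵐ q ∂halfMeasure n, p q) :
    ∀ᵐ y ∂(volume.restrict (Ioi (0 : ℝ))), ∀ᵐ x, p (x, y) :=
  Measure.ae_ae_of_ae_prod (p := fun q => p q.swap)
    (Measure.measurePreserving_swap.quasiMeasurePreserving.ae h)

lemma exists_measurable_ae_eq_of_height {h : ℝ → ℂ}
    (hh : AEMeasurable (fun p : Eu n × ℝ => h p.2) (halfMeasure n)) :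
    ∃ g : ℝ → ℂ, Measurable g ∧ ∀ᵐ p ∂halfMeasure n, h p.2 = g p.2 := by
  obtain ⟨x, hx⟩ := (Measure.ae_ae_of_ae_prod hh.ae_eq_mk).exists
  exact ⟨fun y => hh.mk _ (x, y), hh.measurable_mk.comp (by fun_prop),
    Measure.quasiMeasurePreserving_snd.ae hx⟩

lemma exists_measurable_ae_eq_entry {i j : Fin (n + 1)}
    (hm : AEMeasurable (fun p : Eu n × ℝ => A p.1 p.2 i j) (halfMeasure n))
    (hconst : (i = Fin.last n ∨ j = Fin.last n) → ∀ y, 0 < y → ∀ x x', A x y i j = A x' y i j) :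
    ∃ g : Eu n → ℝ → ℂ, Measurable (fun p : Eu n × ℝ => g p.1 p.2) ∧
      ((i = Fin.last n ∨ j = Fin.last n) → ∀ x x' y, g x y = g x' y) ∧
      ∀ᵐ p ∂halfMeasure n, A p.1 p.2 i j = g p.1 p.2 := by
  by_cases hij : i = Fin.last n ∨ j = Fin.last n
  · have hA0 : ∀ᵐ p ∂halfMeasure n, A p.1 p.2 i j = A 0 p.2 i j :=
      ae_halfMeasure_snd_pos.mono fun p hp => hconst hij p.2 hp p.1 0
    obtain ⟨g, hg, hAg⟩ := exists_measurable_ae_eq_of_height (h := fun y => A 0 y i j)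
      (hm.congr hA0)
    exact ⟨fun _ y => g y, by fun_prop, fun _ _ _ _ => rfl,
      by filter_upwards [hA0, hAg] with p h0 h using h0.trans h⟩
  · exact ⟨fun x y => hm.mk _ (x, y), hm.measurable_mk, fun h => absurd h hij, hm.ae_eq_mk⟩

theorem exists_isRegularCoeff_ae_eq
    (hm : ∀ i j, AEMeasurable (fun p : Eu n × ℝ => A p.1 p.2 i j) (halfMeasure n))
    (hA : coeffNorm A < ∞)
    (hconst : ∀ i j, (i = Fin.last n ∨ j = Fin.last n) →
      ∀ y, 0 < y → ∀ x x', A x y i j = A x' y i j) :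
    ∃ A' : Eu n → ℝ → Matrix (Fin (n + 1)) (Fin (n + 1)) ℂ,
      IsRegularCoeff A' (coeffNorm A).toReal ∧ ∀ᵐ p ∂halfMeasure n, A p.1 p.2 = A' p.1 p.2 := by
  choose g hgm hgc hg using fun i j => exists_measurable_ae_eq_entry (hm i j) (hconst i j)
  refine ⟨fun x y => .of fun i j => if ‖g i j x y‖ ≤ (coeffNorm A).toReal then g i j x y else 0,
    ⟨fun i j => ?_, fun i j x y => ?_, fun i j hij x x' y => ?_⟩, ?_⟩
  · exact Measurable.ite (measurableSet_le (hgm i j).norm measurable_const) (hgm i j)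
      measurable_const
  · simp only [Matrix.of_apply]
    split_ifs with h
    · exact h
    · simp
  · simp only [Matrix.of_apply, hgc i j hij x x' y]
  · filter_upwards [ae_all_iff.2 fun i => ae_all_iff.2 (hg i), ae_norm_entry_le_coeffNorm hA]
      with p hp hle
    ext i j
    rw [Matrix.of_apply, ← hp i j, if_pos (hle i j)]

lemma ae_kernelIntegrand_ae_eq (φ : Eu n → ℝ)
    (hA : ∀ᵐ p ∂halfMeasure n, A p.1 p.2 = A' p.1 p.2) :
    ∀ᵐ y ∂(volume.restrict (Ioi (0 : ℝ))), ∀ x x', (fun z => kernelIntegrand φ A x x' z y)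
      =ᵐ[volume] fun z => kernelIntegrand φ A' x x' z y := by
  filter_upwards [ae_ae_of_ae_halfMeasure hA] with y hy x x'
  filter_upwards [hy] with z hz
  simp only [kernelIntegrand, hz]

lemma sliceKernel_ae_eq (φ : Eu n → ℝ) (hA : ∀ᵐ p ∂halfMeasure n, A p.1 p.2 = A' p.1 p.2) :
    sliceKernel φ A =ᵐ[volume.restrict (Ioi 0)] sliceKernel φ A' := by
  filter_upwards [ae_kernelIntegrand_ae_eq φ hA] with y hy
  ext x x'
  exact integral_congr_ae (hy x x')

variable {k : ℝ → Eu n → Eu n → ℂ} {φ : Eu n → ℝ}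

lemma kernelK_eq_slicesKernel (hk : sliceKernel φ A =ᵐ[volume.restrict (Ioi 0)] k) :
    kernelK φ A = slicesKernel k := by
  ext x x'
  exact integral_congr_ae (hk.mono fun y hy => congrFun₂ hy x x')

lemma opT_eq_slicesOp (hk : sliceKernel φ A =ᵐ[volume.restrict (Ioi 0)] k) :
    opT φ A = slicesOp k := by
  ext f x
  exact integral_congr_ae (hk.mono fun y hy => by simp only [hy])

end Coefficients

section Assembly

variable {n : ℕ} {φ : Eu n → ℝ} {Φ : Fin (n + 1) → Eu n → ℂ}
  {A : Eu n → ℝ → Matrix (Fin (n + 1)) (Fin (n + 1)) ℂ} {a : Eu n → ℝ → ℂ} {P Q : Eu n → ℂ}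
  {M δ y : ℝ}

/-- The integrand of `compKernel`, as a function on the half-space. -/
def compIntegrand (a : Eu n → ℝ → ℂ) (P Q : Eu n → ℂ) (x x' z : Eu n) (y : ℝ) : ℂ :=
  (sliceFactor n y : ℂ) * (a z y * (P (y⁻¹ • (z - x')) * Q (y⁻¹ • (z - x))))

lemma integral_compIntegrand (a : Eu n → ℝ → ℂ) (P Q : Eu n → ℂ) (x x' : Eu n) (y : ℝ) :
    ∫ z, compIntegrand a P Q x x' z y = compKernel a P Q y x x' :=
  integral_const_mul _ _

lemma integral_norm_compIntegrand (hy : 0 < y) (x x' : Eu n) :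
    ∫ z, ‖compIntegrand a P Q x x' z y‖ =
      sliceFactor n y * ∫ z, ‖a z y * (P (y⁻¹ • (z - x')) * Q (y⁻¹ • (z - x)))‖ := by
  simp only [compIntegrand, norm_mul (sliceFactor n y : ℂ), norm_sliceFactor hy,
    integral_const_mul]

lemma measurable_compIntegrand (hm : Measurable (fun p : Eu n × ℝ => a p.1 p.2))
    (hP : Continuous P) (hQ : Continuous Q) (x x' : Eu n) :
    Measurable (fun p : Eu n × ℝ => compIntegrand a P Q x x' p.1 p.2) := by
  unfold compIntegrand sliceFactor
  fun_prop

lemma integrable_compIntegrand_slice (hm : Measurable (fun p : Eu n × ℝ => a p.1 p.2))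
    (ha : ∀ x y, ‖a x y‖ ≤ M) (hδ : 0 < δ) (hP : IsProfile P δ) (hQ : IsProfile Q δ) (hy : 0 < y)
    (x x' : Eu n) : Integrable (fun z => compIntegrand a P Q x x' z y) :=
  (integrable_compKernel_integrand hm ha (by linarith) hP.decay hQ.decay hP.continuous
    hQ.continuous hy x x').const_mul _

lemma integrable_compIntegrand (hn : 0 < n) (hm : Measurable (fun p : Eu n × ℝ => a p.1 p.2))
    (ha : ∀ x y, ‖a x y‖ ≤ M) (hδ : 0 < δ) (hP : IsProfile P δ) (hQ : IsProfile Q δ)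
    {x x' : Eu n} (hx : x ≠ x') :
    Integrable (fun p : Eu n × ℝ => compIntegrand a P Q x x' p.1 p.2) (halfMeasure n) := by
  have hmeas := measurable_compIntegrand hm hP.continuous hQ.continuous x x'
  have hM : 0 ≤ M := (norm_nonneg _).trans (ha 0 0)
  have hr : 0 < ‖x - x'‖ := norm_sub_pos_iff.2 hx
  obtain ⟨C, hC, hle⟩ := exists_integral_norm_compKernel_integrand_le hδ hP.decay hQ.decay
  rw [halfMeasure, integrable_prod_iff' hmeas.aestronglyMeasurable]
  refine ⟨(ae_restrict_mem measurableSet_Ioi).mono fun y hy =>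
    integrable_compIntegrand_slice hm ha hδ hP hQ hy x x', ?_⟩
  refine integrableOn_of_norm_le_scaleWeight (b := C * M * ‖x - x'‖ ^ (-(n : ℝ))) hδ
    (Nat.cast_pos.2 hn) hr (hmeas.norm.stronglyMeasurable.comp_measurable
      measurable_swap).integral_prod_right'.aestronglyMeasurable fun y hy => ?_
  rw [Real.norm_of_nonneg (integral_nonneg fun z => norm_nonneg _),
    integral_norm_compIntegrand hy, mul_assoc (C * M)]
  exact (hle a M ha y hy x x').trans
    (mul_le_mul_of_nonneg_left (sliceWeight_le_scaleWeight (by positivity) hr hy) (by positivity))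

/-- The kernel slices of the coefficient matrix `A` for a gradient with profiles `Φ`. -/
def gradSlices (Φ : Fin (n + 1) → Eu n → ℂ)
    (A : Eu n → ℝ → Matrix (Fin (n + 1)) (Fin (n + 1)) ℂ) (y : ℝ) (x x' : Eu n) : ℂ :=
  ∑ p : Fin (n + 1) × Fin (n + 1),
    compKernel (fun z y => A z y p.1 p.2) (Φ p.2) (Φ p.1) y x x'

namespace HasGradProfile

lemma kernelIntegrand_eq_sum (hΦ : HasGradProfile φ Φ) (hy : 0 < y) (x x' z : Eu n) :
    kernelIntegrand φ A x x' z y = ∑ p : Fin (n + 1) × Fin (n + 1),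
      compIntegrand (fun z y => A z y p.1 p.2) (Φ p.2) (Φ p.1) x x' z y := by
  simp only [kernelIntegrand, Fintype.sum_prod_type, dotProduct, Matrix.mulVec, Finset.mul_sum,
    Finset.sum_mul, hΦ y hy, compIntegrand, sliceFactor]
  refine Finset.sum_congr rfl fun i _ => Finset.sum_congr rfl fun j _ => ?_
  push_cast
  ring

variable (hΦ : HasGradProfile φ Φ) (hδ : 0 < δ) (hprof : ∀ i, IsProfile (Φ i) δ)
  (hA : IsRegularCoeff A M)

include hΦ hδ hprof hA

lemma integrable_kernelIntegrand (hn : 0 < n) {x x' : Eu n} (hx : x ≠ x') :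
    Integrable (fun p : Eu n × ℝ => kernelIntegrand φ A x x' p.1 p.2) (halfMeasure n) := by
  refine (integrable_finsetSum Finset.univ fun (p : Fin (n + 1) × Fin (n + 1)) _ =>
    integrable_compIntegrand hn (hA.measurable p.1 p.2) (hA.norm_le p.1 p.2) hδ (hprof p.2)
      (hprof p.1) hx).congr ?_
  filter_upwards [ae_halfMeasure_snd_pos] with q hq
  exact (hΦ.kernelIntegrand_eq_sum hq x x' q.1).symm

lemma integrable_kernelIntegrand_slice (hy : 0 < y) (x x' : Eu n) :
    Integrable (fun z => kernelIntegrand φ A x x' z y) := by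
  simp only [hΦ.kernelIntegrand_eq_sum hy]
  exact integrable_finsetSum _ fun p _ => integrable_compIntegrand_slice (hA.measurable p.1 p.2)
    (hA.norm_le p.1 p.2) hδ (hprof p.2) (hprof p.1) hy x x'

lemma sliceKernel_eq (hy : 0 < y) : sliceKernel φ A y = gradSlices Φ A y := by
  ext x x'
  simp only [sliceKernel, gradSlices, hΦ.kernelIntegrand_eq_sum hy, ← integral_compIntegrand]
  exact integral_finsetSum _ fun p _ => integrable_compIntegrand_slice (hA.measurable p.1 p.2)
    (hA.norm_le p.1 p.2) hδ (hprof p.2) (hprof p.1) hy x x'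

end HasGradProfile

variable {b α : ℝ}

lemma isProfile_stableProfile (hb : 0 < b) (hα : 0 < α) (hα2 : α ≤ 2) (i : Fin (n + 1)) :
    IsProfile (stableProfile n b α i) α :=
  (isStableProfile_stableProfile b α i).isProfile hb hα hα2

lemma exists_isCZSlices_compKernel_stableProfile (hb : 0 < b) (hα : 0 < α) (hα2 : α ≤ 2)
    (i j : Fin (n + 1)) :
    ∃ C, ∀ (A : Eu n → ℝ → Matrix (Fin (n + 1)) (Fin (n + 1)) ℂ) (M : ℝ), IsRegularCoeff A M →
      IsCZSlices (compKernel (fun z y => A z y i j) (stableProfile n b α j)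
        (stableProfile n b α i)) (C * M) α := by
  have hP := isProfile_stableProfile (n := n) hb hα hα2
  by_cases hij : i = Fin.last n ∨ j = Fin.last n
  · obtain ⟨C, -, hC⟩ := exists_isCZSlices_compKernel hα (hP j) (hP i)
      ((isStableProfile_stableProfile b α j).hasGradBound hb hα hα2
        (isStableProfile_stableProfile b α i))
    exact ⟨C, fun A M hA => hC _ M (hA.const_of_last i j hij) (hA.measurable i j) (hA.norm_le i j)⟩
  · push Not at hij
    obtain ⟨i, rfl⟩ := Fin.exists_castSucc_eq.2 hij.1
    obtain ⟨j, rfl⟩ := Fin.exists_castSucc_eq.2 hij.2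
    obtain ⟨C, -, hC⟩ := exists_isCZSlices_compKernel hα (hP j.castSucc) (hP i.castSucc)
      (hasGradBound_stableProfile hb hα hα2 j i)
    exact ⟨C, fun A M hA => hC _ M trivial (hA.measurable _ _) (hA.norm_le _ _)⟩

theorem exists_isCZSlices_gradSlices_stableProfile (n : ℕ) (hb : 0 < b) (hα : 0 < α)
    (hα2 : α ≤ 2) :
    ∃ C, ∀ (A : Eu n → ℝ → Matrix (Fin (n + 1)) (Fin (n + 1)) ℂ) (M : ℝ), IsRegularCoeff A M →
      IsCZSlices (gradSlices (stableProfile n b α) A) (C * M) α := by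
  choose C hC using fun p : Fin (n + 1) × Fin (n + 1) =>
    exists_isCZSlices_compKernel_stableProfile hb hα hα2 p.1 p.2
  refine ⟨∑ p, C p, fun A M hA => ?_⟩
  rw [Finset.sum_mul]
  exact .sum Finset.univ hα fun p _ => hC p A M hA

end Assembly

end StableCZ

end

theorem theorem1p1 (n : ℕ) (hn : 1 ≤ n) (α : ℝ) (hα0 : 0 < α) (hα2 : α ≤ 2) :
    ∃ C : ℝ, ∀ {Ω : Type*} [MeasurableSpace Ω] (P : Measure Ω) [IsProbabilityMeasure P]
      (X : ℝ≥0 → Ω → EuclideanSpace ℝ (Fin n)) (_ : StableCZ.IsRotInvStable α X P)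
      (φ : EuclideanSpace ℝ (Fin n) → ℝ) (_ : StableCZ.IsContDensity φ (X 1) P)
      (A : EuclideanSpace ℝ (Fin n) → ℝ → Matrix (Fin (n + 1)) (Fin (n + 1)) ℂ)
      (_ : ∀ i j, AEMeasurable (fun p : EuclideanSpace ℝ (Fin n) × ℝ => A p.1 p.2 i j)
        (StableCZ.halfMeasure n))
      (_ : StableCZ.coeffNorm A < ∞)
      (_ : ∀ i j, (i = Fin.last n ∨ j = Fin.last n) →
        ∀ y, 0 < y → ∀ x x', A x y i j = A x' y i j),
      -- the integral that defines the kernel converges absolutely off the diagonal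
      (∀ x x', x ≠ x' → Integrable (fun p : EuclideanSpace ℝ (Fin n) × ℝ =>
        StableCZ.kernelIntegrand φ A x x' p.1 p.2) (StableCZ.halfMeasure n)) ∧
      -- the iterated integrals that define the operator converge absolutely
      (∀ᵐ y ∂(volume.restrict (Ioi (0 : ℝ))), ∀ x x',
        Integrable (fun xbar => StableCZ.kernelIntegrand φ A x x' xbar y)) ∧
      (∀ᵐ y ∂(volume.restrict (Ioi (0 : ℝ))), ∀ (f : 𝓢(EuclideanSpace ℝ (Fin n), ℂ)) (x),
        Integrable (fun x' => StableCZ.sliceKernel φ A y x x' * f x')) ∧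
      (∀ (f : 𝓢(EuclideanSpace ℝ (Fin n), ℂ)) (x),
        IntegrableOn (fun y => ∫ x', StableCZ.sliceKernel φ A y x x' * f x') (Ioi (0 : ℝ))) ∧
      StableCZ.IsCZOperator (StableCZ.opT φ A) (StableCZ.kernelK φ A)
        (C * (StableCZ.coeffNorm A).toReal) := by
  have hb : 0 < (2 * Real.pi) ^ α := by positivity
  obtain ⟨C, hC⟩ := StableCZ.exists_isCZSlices_gradSlices_stableProfile n hb hα0 hα2
  refine ⟨C * StableCZ.czConst n α, fun P _ X hX φ hφ A hm hA hconst => ?_⟩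
  obtain ⟨A', hA', hAA'⟩ := StableCZ.exists_isRegularCoeff_ae_eq hm hA hconst
  have hk := hC A' _ hA'
  have hΦ := hφ.hasGradProfile hα0 hX
  have hprof := StableCZ.isProfile_stableProfile (n := n) hb hα0 hα2
  have hpos := ae_restrict_mem (μ := volume) (measurableSet_Ioi (a := (0 : ℝ)))
  have hslice := (StableCZ.sliceKernel_ae_eq φ hAA').trans
    (hpos.mono fun y hy => hΦ.sliceKernel_eq hα0 hprof hA' hy)
  refine ⟨fun x x' hx => ?_, ?_, ?_, fun f x => ?_, ?_⟩
  · refine (hΦ.integrable_kernelIntegrand hα0 hprof hA' hn hx).congr ?_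
    filter_upwards [hAA'] with p hp
    simp only [StableCZ.kernelIntegrand, hp]
  · filter_upwards [hpos, StableCZ.ae_kernelIntegrand_ae_eq φ hAA'] with y hy hyA x x'
    exact (hΦ.integrable_kernelIntegrand_slice hα0 hprof hA' hy x x').congr (hyA x x').symm
  · filter_upwards [hpos, hslice] with y hy hyk f x
    exact hyk ▸ hk.integrable_mul hy x f.integrable
  · exact (hk.integrableOn_integral hn f x).congr (hslice.mono fun y hy => by simp only [hy])
  · rw [StableCZ.opT_eq_slicesOp hslice, StableCZ.kernelK_eq_slicesKernel hslice, mul_right_comm]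
    exact hk.isCZOperator hn
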